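/- Let $n\ge 1$. A matching of $2n$ points on a circle, labelled $1,\dots,2n$ clockwise, is a fixed-point-free involution $\tau$ of $\{1,\dots,2n\}$; its edges are the sets $\{i,\tau(i)\}$, and two edges $\{a,b\}$, $\{c,d\}$ cross if, after naming the endpoints suitably, $a<c<b<d$. Let $P_{n,k}$ be the set of matchings of $2n$ points with exactly $k$ crossing pairs of edges. The rotation $\sigma$ acts on matchings by $\sigma(\tau)(i)=\tau(i-1)+1$ (modulo $2n$) and preserves each $P_{n,k}$; in this way the cyclic group $C_{2n}$ of order $2n$ generated by the rotation acts on $P_{n,k}$. A triple $(X,f(q),C)$, where $C$ is a cyclic group of order $N$ acting on a finite set $X$, $f$ is a polynomial and $\omega$ is a fixed isomorphism from $C$ to the group of $N$-th roots of unity in $\mathbb C$, exhibits the cyclic sieving phenomenon if $f(\omega(c))=|\{x\in X: c(x)=x\}|$ for every $c\in C$. Put $[m]_q=1+q+\cdots+q^{m-1}$ and $$\binom{m}{k}_q=\frac{[m]_q[m-1]_q\cdots[m-k+1]_q}{[k]_q[k-1]_q\cdots[1]_q}\quad(k\ge 0),\qquad \binom mk_q=\binom mk=0\quad(k<0),$$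 and let $$f_{n,1}(q)=\binom{2n}{n-2}_q,\qquad f_{n,2}(q)=\frac{[n+3]_q}{[2]_q}\binom{2n}{n-3}_q,\qquad f_{n,3}(q)=\frac{1}{[3]_q}\binom{n+5}{2}_q\binom{2n}{n-4}_q+\binom{2n}{n-3}_q .$$ Then, for $k=1,2,3$, the rational function $f_{n,k}(q)$ is a polynomial in $q$, and, with $\xi_{2n}=e^{\pi i/n}$, $$f_{n,k}(\xi_{2n}^j)=|\{\tau\in P_{n,k}:\sigma^j(\tau)=\tau\}|\qquad\text{for every integer } j\ge 0 .$$ In other words, $(P_{n,k},f_{n,k}(q),C_{2n})$ exhibits the cyclic sieving phenomenon for $k=1,2,3$, with respect to the isomorphism $\omega$ from $C_{2n}$ to the $2n$-th roots of unity that sends the generating rotation to $\xi_{2n}$. Moreover, $$|P_{n,3}|=\frac13\binom{n+5}{2}\binom{2n}{n-4}+\binom{2n}{n-3},$$ and, if $3\mid n$, $$|\{\tau\in P_{n,3}:\sigma^{2n/3}(\tau)=\tau\}|=\frac n3\binom{2n/3}{n/3-1}.$$ -/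

import Mathlib

open Polynomial

namespace CircleMatching

/-- A (perfect) matching of `2 n` points on a circle. The points are labelled clockwise by
`0, 1, …, 2 n - 1`; a matching is a fixed-point-free involution, sending each point to the point
it is joined to. -/
@[ext]
structure Matching (n : ℕ) where
  partner : Fin (2 * n) → Fin (2 * n)
  partner_partner : ∀ i, partner (partner i) = i
  partner_ne : ∀ i, partner i ≠ i

/-- The pairs of crossing edges. The edges `{i, τ i}` and `{j, τ j}` of `τ`, named by their smaller
endpoints `i` and `j` with `i < j`, cross exactly when `i < j < τ i < τ j`. -/
def crossingPairs {n : ℕ} (τ : Matching n) : Finset (Fin (2 * n) × Fin (2 * n)) :=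
  Finset.univ.filter fun p =>
    p.1 < p.2 ∧ p.2 < τ.partner p.1 ∧ τ.partner p.1 < τ.partner p.2

/-- The number `c(τ)` of crossings of a matching `τ`. -/
def crossings {n : ℕ} (τ : Matching n) : ℕ := (crossingPairs τ).card

/-- Relabelling the points of a matching by a permutation `g`: the edge `{a, b}` becomes the edge
`{g a, g b}`. -/
def relabel {n : ℕ} (g : Equiv.Perm (Fin (2 * n))) (τ : Matching n) : Matching n where
  partner i := g (τ.partner (g.symm i))
  partner_partner i := by simp [τ.partner_partner]
  partner_ne i := by
    intro h
    exact τ.partner_ne (g.symm i) (by rw [Equiv.eq_symm_apply, h])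

/-- The rotation `σ` of matchings by one step, `σ(τ)(i) = τ(i - 1) + 1` modulo `2 n`. -/
def rotate {n : ℕ} (τ : Matching n) : Matching n := relabel (finRotate (2 * n)) τ

/-- The cyclic group `C_{2n}`, generated by the rotation `i ↦ i + 1` of the `2 n` points. -/
abbrev RotationGroup (n : ℕ) : Subgroup (Equiv.Perm (Fin (2 * n))) :=
  Subgroup.zpowers (finRotate (2 * n))

/-- The generator `i ↦ i + 1` of `C_{2n}`. -/
def generator (n : ℕ) : RotationGroup n :=
  ⟨finRotate (2 * n), Subgroup.mem_zpowers (finRotate (2 * n))⟩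

/-- The set `P_{n,k}` of matchings of `2 n` points on a circle with exactly `k` crossings. -/
def MatchingWithCrossings (n k : ℕ) : Type := {τ : Matching n // crossings τ = k}

instance (n : ℕ) : Finite (Matching n) :=
  Finite.of_injective Matching.partner fun _ _ h => Matching.ext h

instance (n k : ℕ) : Finite (MatchingWithCrossings n k) :=
  inferInstanceAs (Finite {τ : Matching n // crossings τ = k})

theorem relabel_one {n : ℕ} (τ : Matching n) : relabel 1 τ = τ := rfl

theorem relabel_mul {n : ℕ} (g h : Equiv.Perm (Fin (2 * n))) (τ : Matching n) :
    relabel (g * h) τ = relabel g (relabel h τ) := rfl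

theorem val_finRotate {m : ℕ} (i : Fin m) :
    (finRotate m i).val = if i.val + 1 = m then 0 else i.val + 1 := by
  cases m with
  | zero => exact i.elim0
  | succ n =>
    rw [coe_finRotate]
    simp [Fin.ext_iff]

theorem crossings_le_rotate {n : ℕ} (τ : Matching n) : crossings τ ≤ crossings (rotate τ) := by
  have key : ∀ x, (rotate τ).partner (finRotate (2 * n) x) = finRotate (2 * n) (τ.partner x) := by
    intro x
    simp only [rotate, relabel, Equiv.symm_apply_apply]
  unfold crossings
  refine Finset.card_le_card_of_injOn
    (fun p => if (τ.partner p.2).val + 1 = 2 * n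
      then (finRotate (2 * n) (τ.partner p.2), finRotate (2 * n) p.1)
      else (finRotate (2 * n) p.1, finRotate (2 * n) p.2)) ?_ ?_
  · rintro ⟨i, j⟩ hp
    simp only [crossingPairs, Finset.coe_filter, Finset.mem_univ, true_and, Set.mem_ofPred_eq,
      Fin.lt_def] at hp ⊢
    have h1 := (τ.partner i).isLt
    have h2 := (τ.partner j).isLt
    split_ifs with h <;>
      simp only [key, val_finRotate, τ.partner_partner] <;>
      split_ifs <;> omega
  · rintro ⟨i, j⟩ hp ⟨i', j'⟩ hp' heq
    simp only [crossingPairs, Finset.coe_filter, Finset.mem_univ, true_and, Set.mem_ofPred_eq,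
      Fin.lt_def] at hp hp'
    have h1 := (τ.partner i).isLt
    have h2 := (τ.partner j).isLt
    have h1' := (τ.partner i').isLt
    have h2' := (τ.partner j').isLt
    dsimp only at heq
    split_ifs at heq with h h' h'
    · simp only [Prod.mk.injEq, EmbeddingLike.apply_eq_iff_eq] at heq
      have hj : j = j' := by
        rw [← τ.partner_partner j, heq.1, τ.partner_partner]
      rw [heq.2, hj]
    · exfalso
      have := congrArg (fun p => p.1.val) heq
      simp only [val_finRotate] at this
      split_ifs at this <;> omega
    · exfalso
      have := congrArg (fun p => p.1.val) heq
      simp only [val_finRotate] at this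
      split_ifs at this <;> omega
    · simpa using heq

theorem crossings_le_relabel_pow {n : ℕ} (τ : Matching n) (m : ℕ) :
    crossings τ ≤ crossings (relabel (finRotate (2 * n) ^ m) τ) := by
  induction m with
  | zero => exact le_rfl
  | succ m ih =>
    rw [pow_succ', relabel_mul]
    exact ih.trans (crossings_le_rotate _)

theorem crossings_relabel {n : ℕ} (g : RotationGroup n) (τ : Matching n) :
    crossings (relabel (g : Equiv.Perm (Fin (2 * n))) τ) = crossings τ := by
  have main : ∀ (h : RotationGroup n) (ρ : Matching n),
      crossings ρ ≤ crossings (relabel (h : Equiv.Perm (Fin (2 * n))) ρ) := by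
    rintro ⟨h, hh⟩ ρ
    obtain ⟨m, rfl⟩ := (mem_powers_iff_mem_zpowers.mpr hh)
    exact crossings_le_relabel_pow ρ m
  refine le_antisymm ?_ (main g τ)
  have := main g⁻¹ (relabel (g : Equiv.Perm (Fin (2 * n))) τ)
  rwa [← relabel_mul, ← Subgroup.coe_mul, inv_mul_cancel] at this

/-- The action of `C_{2n}` on `P_{n,k}` by rotation. -/
instance (n k : ℕ) : MulAction (RotationGroup n) (MatchingWithCrossings n k) where
  smul g τ := ⟨relabel (g : Equiv.Perm (Fin (2 * n))) τ.1, (crossings_relabel g τ.1).trans τ.2⟩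
  one_smul _ := rfl
  mul_smul _ _ _ := rfl

/-- The cyclic sieving phenomenon for a finite set `X`, a polynomial `f` and a cyclic group `C` of
order `N` acting on `X`, with respect to a fixed isomorphism `ω` from `C` to the group of `N`-th
roots of unity: `f (ω c)` is the number of elements of `X` fixed by `c`, for every `c` in `C`. -/
def ExhibitsCSP {C X : Type*} [Group C] [Finite X] [MulAction C X] {N : ℕ}
    (ω : C ≃* rootsOfUnity N ℂ) (f : ℂ[X]) : Prop :=
  ∀ c : C, f.eval ((ω c : ℂˣ) : ℂ) = (Nat.card (MulAction.fixedBy X c) : ℂ)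

/-- The `q`-integer `[m]_q = 1 + q + ⋯ + q ^ (m - 1)`, in the field of rational functions in `q`. -/
noncomputable def qInt (m : ℕ) : RatFunc ℂ := ∑ i ∈ Finset.range m, RatFunc.X ^ i

/-- The `q`-binomial coefficient
`([m]_q [m-1]_q ⋯ [m-k+1]_q) / ([k]_q [k-1]_q ⋯ [1]_q)`, which is `0` for `k < 0`. -/
noncomputable def qBinom (m : ℕ) (k : ℤ) : RatFunc ℂ :=
  if 0 ≤ k then
    (∏ i ∈ Finset.range k.toNat, qInt (m - i)) / ∏ i ∈ Finset.range k.toNat, qInt (i + 1)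
  else 0

/-- The binomial coefficient, which is `0` for `k < 0`. -/
def binom (m : ℕ) (k : ℤ) : ℕ := if 0 ≤ k then m.choose k.toNat else 0

/-- `f_{n,1}`, as a rational function in `q`. -/
noncomputable def fOne (n : ℕ) : RatFunc ℂ := qBinom (2 * n) (n - 2)

/-- `f_{n,2}`, as a rational function in `q`. -/
noncomputable def fTwo (n : ℕ) : RatFunc ℂ := qInt (n + 3) / qInt 2 * qBinom (2 * n) (n - 3)

/-- `f_{n,3}`, as a rational function in `q`. -/
noncomputable def fThree (n : ℕ) : RatFunc ℂ :=
  1 / qInt 3 * qBinom (n + 5) 2 * qBinom (2 * n) (n - 4) + qBinom (2 * n) (n - 3)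

/-- The expression `F` in `q` is a polynomial in `q`, the value of this polynomial at `ξ ^ j`, where
`ξ = exp (π i / n)`, is the number of matchings in `P_{n,k}` fixed by `σ ^ j`, for every `j`, and
`(P_{n,k}, F, C_{2n})` exhibits the cyclic sieving phenomenon with respect to `ω`. -/
def SievesMatchings (n k : ℕ) (ω : RotationGroup n ≃* rootsOfUnity (2 * n) ℂ) (F : RatFunc ℂ) :
    Prop :=
  ∃ f : ℂ[X], algebraMap ℂ[X] (RatFunc ℂ) f = F ∧
    (∀ j : ℕ, f.eval (Complex.exp (Real.pi * Complex.I / n) ^ j) =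
      (Nat.card {τ : Matching n // crossings τ = k ∧ rotate^[j] τ = τ} : ℂ)) ∧
    ExhibitsCSP (X := MatchingWithCrossings n k) ω f

end CircleMatching

open CircleMatching

namespace CircleMatching

/-! ### Ranks in finite linear orders -/

/-! Both sides of the sieving identity depend only on the order d of the rotation. The rotations by
j and by gcd(j, 2n) points generate the same subgroup, and the corresponding power of ξ is a
primitive root of order d = 2n / gcd(j, 2n). So for each d dividing 2n the matchings invariant under
the rotation by M = 2n/d points have to be counted, and the polynomial evaluated at a primitive d-th
root of unity (`Counts`, `Counts.eval_pow`).

Counting rests on partial matchings of a row in which free points run off to infinity. Deleting the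
last point gives a recursion in the number of free points (`pmCount_succ`), whose solution for at
most three crossings is a combination of ballot numbers (`pmCount_formula`). For d = 1 no point is
free, and this gives the total numbers (`card_crossings_few`).

For d = 2 or 3, cut the circle into d arcs. An invariant matching is a partial matching f inside one
arc together with a pattern telling how the free points are joined to other arcs
(`PeriodicMatching.join`). The number of crossings splits as 2 c(f) + (ordered pairs of an
involution) for d = 2 and as 3 (c(f) + c(pattern)) for d = 3 (`crossNum_two`, `crossNum_three`). The
patterns with small crossing number are counted by removing an edge at an extreme point, and the
sums of ballot numbers telescope.

If the number k of crossings is positive and less than d, the d rotates of the endpoint set of a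
crossing cannot all be distinct. So these four endpoints are stable under a nontrivial rotation, and
both edges are diameters (`antipodal_of_mem_crossingPairs`). Since s diameters have s(s-1)/2
crossings and the set of their endpoints is d-periodic, for d ≥ 3 and k ≤ 3 the only possibilities
are d = 4, k = 1 and d = 6, k = 3. Then each arc contains one endpoint of a diameter and otherwise a
noncrossing matching, which gives a multiple of a Catalan number (`card_fixed_ofDiameter`).

On the polynomial side, the q-analogue of Lucas' theorem (`eval_qChoose_mul_add`) evaluates the
q-binomials. The denominators [2] and [3] are cyclotomic, so divisibility is a check of zeros. Where
numerator and denominator both vanish, a factor [da] = [d](1 + q^d + ⋯ + q^(d(a-1))) is split off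
first and the factor [d] is cancelled. -/

theorem sum_card_above_eq {α : Type*} [Fintype α] [LinearOrder α] {l : ℕ}
    (hl : l < Fintype.card α) :
    ∑ a : α, (if (∑ b : α, if a < b then 1 else 0) = l then 1 else 0) = 1 := by
  have e : Fin (Fintype.card α) ≃o α := Fintype.orderIsoFinOfCardEq α rfl
  have key : ∀ i : Fin (Fintype.card α),
      (∑ b : α, if e i < b then 1 else 0) = Fintype.card α - 1 - i.val := by
    intro i
    rw [← e.toEquiv.sum_comp]
    simp only [OrderIso.coe_toEquiv, e.lt_iff_lt]
    rw [Finset.sum_boole, Nat.cast_id, ← Fin.card_Ioi]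
    congr 1
    ext; simp
  rw [← e.toEquiv.sum_comp]
  simp only [OrderIso.coe_toEquiv, key]
  rw [Finset.sum_eq_single (⟨Fintype.card α - 1 - l, by omega⟩ : Fin (Fintype.card α))]
  · rw [if_pos]; dsimp only; omega
  · intro b _ hb
    rw [if_neg]
    intro h
    apply hb
    ext
    dsimp only
    have := b.isLt
    omega
  · simp

theorem sum_card_above_lt {α : Type*} [Fintype α] [LinearOrder α] (a : α) :
    (∑ b : α, if a < b then 1 else 0) < Fintype.card α := by
  rw [Finset.sum_boole, Nat.cast_id]
  exact Finset.card_lt_univ_of_notMem (x := a) (by simp)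

/-! ### Involutions, as partial matchings -/

/-- An involution of `α`, seen as a partial matching whose free points are the fixed points. -/
abbrev Invol (α : Type*) := {f : α → α // Function.Involutive f}

noncomputable instance {α : Type*} [Finite α] : Fintype (Invol α) := Fintype.ofFinite _

/-- The free points of a partial matching. -/
abbrev Free {α : Type*} (f : Invol α) := {i : α // f.1 i = i}

/-- The number of free points. -/
def freeCard {α : Type*} [Fintype α] [DecidableEq α] (f : Invol α) : ℕ :=
  ∑ i, if f.1 i = i then 1 else 0

/-- The number of crossings of a partial matching in which each free point is joined to a point
at infinity. -/
def crossCard {α : Type*} [Fintype α] [LinearOrder α] (f : Invol α) : ℕ :=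
  ∑ i, ∑ j, if i < j ∧ j < f.1 i ∧ (f.1 j = j ∨ f.1 i < f.1 j) then 1 else 0

theorem freeCard_eq {α : Type*} [Fintype α] [DecidableEq α] (f : Invol α) :
    freeCard f = Fintype.card (Free f) := by
  rw [freeCard, Finset.sum_boole, Nat.cast_id, Fintype.card_subtype]

/-- Adding a new last point, either free or matched with one of the free points. -/
def insertLastFun {N : ℕ} (f : Invol (Fin N)) (o : Option (Free f)) : Fin (N + 1) → Fin (N + 1) :=
  Fin.lastCases (o.elim (Fin.last N) fun a => a.1.castSucc)
    fun j => if o.map Subtype.val = some j then Fin.last N else (f.1 j).castSucc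

theorem insertLastFun_last {N : ℕ} (f : Invol (Fin N)) (o : Option (Free f)) :
    insertLastFun f o (Fin.last N) = o.elim (Fin.last N) fun a => a.1.castSucc := by
  simp [insertLastFun]

theorem insertLastFun_castSucc {N : ℕ} (f : Invol (Fin N)) (o : Option (Free f)) (j : Fin N) :
    insertLastFun f o j.castSucc =
      if o.map Subtype.val = some j then Fin.last N else (f.1 j).castSucc := by
  simp [insertLastFun]

theorem insertLastFun_involutive {N : ℕ} (f : Invol (Fin N)) (o : Option (Free f)) :
    Function.Involutive (insertLastFun f o) := by
  intro x
  induction x using Fin.lastCases with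
  | last =>
    rw [insertLastFun_last]
    cases o with
    | none => simp [insertLastFun_last]
    | some a => simp [insertLastFun_castSucc]
  | cast j =>
    rw [insertLastFun_castSucc]
    cases o with
    | none => simp [insertLastFun_castSucc, f.2 j]
    | some a =>
      by_cases h : a.1 = j
      · simp [h, insertLastFun_last]
      · have h' : a.1 ≠ f.1 j := by
          intro h'
          apply h
          have := congrArg f.1 h'
          rw [a.2, f.2 j] at this
          exact this
        simp [h, h', insertLastFun_castSucc, f.2 j]

/-- Adding a new last point to a partial matching. -/
def insertLast {N : ℕ} (x : Σ f : Invol (Fin N), Option (Free f)) : Invol (Fin (N + 1)) :=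
  ⟨insertLastFun x.1 x.2, insertLastFun_involutive x.1 x.2⟩

theorem insertLast_injective {N : ℕ} : Function.Injective (insertLast (N := N)) := by
  rintro ⟨f, o⟩ ⟨f', o'⟩ h
  have h0 : insertLastFun f o = insertLastFun f' o' := congrArg Subtype.val h
  have ho : o.map Subtype.val = o'.map Subtype.val := by
    have := congrFun h0 (Fin.last N)
    rw [insertLastFun_last, insertLastFun_last] at this
    cases o <;> cases o' <;> simp_all [Fin.ext_iff]
    · have := (Subtype.val ‹Free f'›).isLt; omega
    · have := (Subtype.val ‹Free f›).isLt; omega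
  have hf : f = f' := by
    ext j : 2
    have := congrFun h0 j.castSucc
    rw [insertLastFun_castSucc, insertLastFun_castSucc, ← ho] at this
    split_ifs at this with hj
    · have e1 : f.1 j = j := by
        cases o with
        | none => simp at hj
        | some a => simp only [Option.map_some, Option.some.injEq] at hj; rw [← hj]; exact a.2
      have e2 : f'.1 j = j := by
        rw [ho] at hj
        cases o' with
        | none => simp at hj
        | some a => simp only [Option.map_some, Option.some.injEq] at hj; rw [← hj]; exact a.2
      rw [e1, e2]
    · exact Fin.castSucc_injective _ this
  subst hf
  congr 1
  exact Option.map_injective Subtype.val_injective ho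

theorem insertLast_surjective {N : ℕ} : Function.Surjective (insertLast (N := N)) := by
  rintro ⟨F, hF⟩
  let f : Fin N → Fin N := fun j => if h : F j.castSucc = Fin.last N then j
    else (F j.castSucc).castPred h
  have hf : ∀ j, F j.castSucc ≠ Fin.last N → (f j).castSucc = F j.castSucc := by
    intro j h; simp [f, h]
  have hf' : ∀ j, F j.castSucc = Fin.last N → f j = j := by
    intro j h; simp [f, h]
  have hinv : Function.Involutive f := by
    intro j
    by_cases h : F j.castSucc = Fin.last N
    · rw [hf' j h, hf' j h]
    · apply Fin.castSucc_injective
      rw [hf, hf j h, hF]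
      rw [hf j h, hF]
      exact (Fin.castSucc_lt_last j).ne
  induction hl : F (Fin.last N) using Fin.lastCases with
  | last =>
    refine ⟨⟨⟨f, hinv⟩, none⟩, Subtype.ext (funext fun x => ?_)⟩
    change insertLastFun _ _ x = F x
    induction x using Fin.lastCases with
    | last => rw [insertLastFun_last]; simp [hl]
    | cast j =>
      rw [insertLastFun_castSucc]
      simp only [Option.map_none, reduceCtorEq, if_false]
      refine hf j fun h => ?_
      have := congrArg F h
      rw [hF, hl] at this
      exact (Fin.castSucc_lt_last j).ne this
  | cast a =>
    have ha : F a.castSucc = Fin.last N := by rw [← hl, hF]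
    refine ⟨⟨⟨f, hinv⟩, some ⟨a, hf' a ha⟩⟩, Subtype.ext (funext fun x => ?_)⟩
    change insertLastFun _ _ x = F x
    induction x using Fin.lastCases with
    | last => rw [insertLastFun_last]; simp [hl]
    | cast j =>
      rw [insertLastFun_castSucc]
      by_cases h : a = j
      · subst h; simp [ha]
      · simp only [Option.map_some, Option.some.injEq, h, if_false]
        refine hf j fun h' => ?_
        have := congrArg F h'
        rw [hF, hl] at this
        exact h (Fin.castSucc_injective _ this).symm

theorem freeCard_insertLast_none {N : ℕ} (f : Invol (Fin N)) :
    freeCard (insertLast ⟨f, none⟩) = freeCard f + 1 := by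
  simp only [freeCard, insertLast, Fin.sum_univ_castSucc, insertLastFun_castSucc,
    insertLastFun_last]
  simp

theorem freeCard_insertLast_some {N : ℕ} (f : Invol (Fin N)) (a : Free f) :
    freeCard (insertLast ⟨f, some a⟩) + 1 = freeCard f := by
  simp only [freeCard, insertLast, Fin.sum_univ_castSucc, insertLastFun_castSucc,
    insertLastFun_last]
  -- The unit is spread over the row as the indicator of `a`, the only old point that stops being
  -- free, so that the comparison is termwise.
  have h1 : (1 : ℕ) = ∑ j : Fin N, if j = a.1 then 1 else 0 := by simp
  refine (congrArg _ h1).trans ?_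
  simp only [Option.elim_some, (Fin.castSucc_lt_last a.1).ne, if_false, add_zero]
  rw [← Finset.sum_add_distrib]
  refine Finset.sum_congr rfl fun j _ => ?_
  by_cases h : j = a.1
  · subst h; simp [a.2, (Fin.castSucc_lt_last a.1).ne']
  · simp [h, Ne.symm h]

theorem crossCard_insertLast_none {N : ℕ} (f : Invol (Fin N)) :
    crossCard (insertLast ⟨f, none⟩) = crossCard f := by
  simp only [crossCard, insertLast, Fin.sum_univ_castSucc, insertLastFun_castSucc,
    insertLastFun_last]
  simp [Fin.le_last, not_lt_of_ge]

/-- An arc over `a` crosses the ray from `a` to infinity just as it crosses the new edge, so old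
crossings survive. The new edge meets in addition exactly the rays of the free points between `a`
and the end. -/
theorem crossCard_insertLast_some {N : ℕ} (f : Invol (Fin N)) (a : Free f) :
    crossCard (insertLast ⟨f, some a⟩) =
      crossCard f + ∑ b : Free f, if a < b then 1 else 0 := by
  have h1 : (∑ b : Free f, if a < b then 1 else 0) =
      ∑ i : Fin N, ∑ j : Fin N, if i = a.1 then (if i < j ∧ f.1 j = j then 1 else 0) else 0 := by
    rw [Finset.sum_eq_single a.1]
    · simp only [if_true]
      rw [Finset.sum_boole, Finset.sum_boole, Nat.cast_id, Nat.cast_id, ← Finset.card_map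
        (Function.Embedding.subtype _)]
      congr 1
      ext j
      simp [← Subtype.coe_lt_coe, and_comm]
    · intro b _ hb; simp [hb]
    · simp
  rw [h1]
  simp only [crossCard, insertLast, Fin.sum_univ_castSucc, insertLastFun_castSucc,
    insertLastFun_last]
  simp only [← Finset.sum_add_distrib]
  simp only [Option.map_some, Option.elim_some, Fin.not_lt.mpr (Fin.le_last _), false_and,
    and_false, if_false, Finset.sum_const_zero, add_zero, Option.some.injEq]
  refine Finset.sum_congr rfl fun i _ => Finset.sum_congr rfl fun j _ => ?_
  have hlt := fun x : Fin N => Fin.castSucc_lt_last x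
  by_cases hi : i = a.1
  · subst hi
    by_cases hj : a.1 = j
    · subst hj; simp
    · simp [hj, a.2, not_lt_of_ge, Fin.le_last, hlt]
      intro h; exact fun h' => absurd h' h.not_gt
  · by_cases hj : a.1 = j
    · subst hj; simp [hi, Ne.symm hi, a.2, hlt]
    · simp [hi, Ne.symm hi, hj]

/-- The number of partial matchings of `N` points in a row with `h` free points and `k` crossings.
-/
noncomputable def pmCount (N h k : ℕ) : ℕ :=
  ∑ f : Invol (Fin N), if freeCard f = h ∧ crossCard f = k then 1 else 0

theorem pmCount_zero (h k : ℕ) : pmCount 0 h k = if h = 0 ∧ k = 0 then 1 else 0 := by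
  have : Unique (Invol (Fin 0)) :=
    ⟨⟨⟨id, fun _ => rfl⟩⟩, fun f => Subtype.ext (funext fun i => i.elim0)⟩
  rw [pmCount, Fintype.sum_unique]
  simp [freeCard, crossCard, eq_comm]

/-- Classify by the last point. If it is matched, the remaining partial matching has h + 1 free
points, and choosing the free point with l free points to its right adds l crossings; each l from 0
to h occurs once. -/
theorem pmCount_succ (N h k : ℕ) : pmCount (N + 1) h k =
    (if h = 0 then 0 else pmCount N (h - 1) k) +
      ∑ l ∈ Finset.range (h + 1), if l ≤ k then pmCount N (h + 1) (k - l) else 0 := by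
  classical
  have hbij : Function.Bijective (insertLast (N := N)) :=
    ⟨insertLast_injective, insertLast_surjective⟩
  rw [pmCount, ← hbij.sum_comp, Fintype.sum_sigma]
  simp only [Fintype.sum_option, freeCard_insertLast_none,
    crossCard_insertLast_none, crossCard_insertLast_some]
  rw [Finset.sum_add_distrib]
  congr 1
  · cases h with
    | zero => simp
    | succ h => simp [pmCount]
  · have : ∀ l ∈ Finset.range (h + 1), (if l ≤ k then pmCount N (h + 1) (k - l) else 0) =
        ∑ f : Invol (Fin N), if freeCard f = h + 1 ∧ crossCard f + l = k then 1 else 0 := by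
      intro l _
      split_ifs with hl
      · refine Finset.sum_congr rfl fun f _ => ?_
        congr 1
        simp only [eq_iff_iff]
        omega
      · symm
        refine Finset.sum_eq_zero fun f _ => if_neg ?_
        omega
    rw [Finset.sum_congr rfl this, Finset.sum_comm]
    refine Finset.sum_congr rfl fun f _ => ?_
    by_cases hf : freeCard f = h + 1
    · have h2 : ∀ a : Free f, freeCard (insertLast ⟨f, some a⟩) = h := fun a => by
        have := freeCard_insertLast_some f a
        omega
      have h3 : ∀ a : Free f, (if freeCard (insertLast ⟨f, some a⟩) = h ∧
          crossCard f + (∑ b : Free f, if a < b then 1 else 0) = k then 1 else 0) =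
          ∑ l ∈ Finset.range (h + 1), if crossCard f + l = k then
            (if (∑ b : Free f, if a < b then 1 else 0) = l then 1 else 0) else 0 := by
        intro a
        have hlt := sum_card_above_lt a
        rw [← freeCard_eq, hf] at hlt
        generalize (∑ b : Free f, if a < b then 1 else 0) = u at hlt ⊢
        rw [Finset.sum_eq_single u]
        · simp [h2]
        · intro l _ hl
          simp [Ne.symm hl]
        · intro h; exact absurd (Finset.mem_range.mpr hlt) h
      rw [Finset.sum_congr rfl fun a _ => h3 a, Finset.sum_comm]
      refine Finset.sum_congr rfl fun l hl => ?_
      rw [Finset.mem_range, ← hf, freeCard_eq] at hl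
      simp only [hf, true_and]
      split_ifs with hc
      · exact sum_card_above_eq hl
      · simp
    · have h2 : ∀ a : Free f, freeCard (insertLast ⟨f, some a⟩) ≠ h := fun a => by
        have := freeCard_insertLast_some f a
        omega
      simp [h2, hf]

/-! ### Counting partial matchings with few crossings -/

theorem binom_of_neg (N : ℕ) {i : ℤ} (hi : i < 0) : binom N i = 0 := if_neg hi.not_ge

theorem binom_natCast (N i : ℕ) : binom N (i : ℤ) = N.choose i := by simp [binom]

theorem binom_zero_right (N : ℕ) : binom N 0 = 1 := by simp [binom]

theorem binom_succ (N : ℕ) (i : ℤ) : binom (N + 1) i = binom N i + binom N (i - 1) := by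
  rcases lt_trichotomy i 0 with hi | rfl | hi
  · rw [binom_of_neg _ hi, binom_of_neg _ hi, binom_of_neg _ (by omega)]
  · rw [binom_of_neg N (show (0 : ℤ) - 1 < 0 by norm_num)]; simp [binom]
  · obtain ⟨j, rfl⟩ : ∃ j : ℕ, i = j + 1 := ⟨(i - 1).toNat, by omega⟩
    rw [add_sub_cancel_right, binom_natCast, ← Nat.cast_succ, binom_natCast, binom_natCast,
      Nat.choose_succ_succ, add_comm]

theorem binom_symm (N : ℕ) (i : ℤ) : binom N (N - i) = binom N i := by
  rcases lt_or_ge i 0 with hi | hi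
  · rw [binom_of_neg _ hi]
    obtain ⟨j, hj⟩ : ∃ j : ℕ, (N : ℤ) - i = j := ⟨(N - i).toNat, by omega⟩
    rw [hj, binom_natCast, Nat.choose_eq_zero_of_lt (by omega)]
  · obtain ⟨j, rfl⟩ := Int.eq_ofNat_of_zero_le hi
    rcases le_or_gt j N with h | h
    · rw [← Nat.cast_sub h, binom_natCast, binom_natCast, Nat.choose_symm h]
    · rw [binom_natCast, Nat.choose_eq_zero_of_lt h, binom_of_neg _ (by omega)]

theorem exists_of_pmCount_ne_zero {N h k : ℕ} (hne : pmCount N h k ≠ 0) : ∃ m, N = 2 * m + h := by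
  induction N generalizing h k with
  | zero =>
    rw [pmCount_zero] at hne
    exact ⟨0, by by_contra; simp_all⟩
  | succ N ih =>
    rw [pmCount_succ] at hne
    rcases not_and_or.mp (mt Nat.add_eq_zero_iff.mpr hne) with h1 | h1
    · split_ifs at h1 with h0
      · simp at h1
      · obtain ⟨m, hm⟩ := ih h1
        exact ⟨m, by omega⟩
    · obtain ⟨l, -, hl⟩ := Finset.exists_ne_zero_of_sum_ne_zero h1
      split_ifs at hl with h2
      · obtain ⟨m, hm⟩ := ih hl
        exact ⟨m + 1, by omega⟩
      · simp at hl

theorem pmCount_eq_zero {N h : ℕ} (k : ℕ) (hN : ∀ m, N ≠ 2 * m + h) : pmCount N h k = 0 := by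
  by_contra hne
  obtain ⟨m, hm⟩ := exists_of_pmCount_ne_zero hne
  exact hN m hm

theorem sum_range_ite_le_three (h : ℕ) {k : ℕ} (hk : k ≤ 3) (F : ℕ → ℕ) :
    (∑ l ∈ Finset.range (h + 1), if l ≤ k then F (k - l) else 0) =
      F k + (if 1 ≤ h ∧ 1 ≤ k then F (k - 1) else 0) + (if 2 ≤ h ∧ 2 ≤ k then F (k - 2) else 0) +
        (if 3 ≤ h ∧ 3 ≤ k then F (k - 3) else 0) := by
  match h with
  | 0 => simp
  | 1 => simp [Finset.sum_range_succ]
  | 2 => simp [Finset.sum_range_succ]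
  | h + 3 =>
    rw [Finset.sum_range_succ', Finset.sum_range_succ', Finset.sum_range_succ',
      Finset.sum_range_succ', Finset.sum_eq_zero]
    · simp [add_comm, add_assoc]
    · intro l _; rw [if_neg]; omega

/-- The difference of two consecutive binomial coefficients; for `N = 2 * m + h` and `j = 0` it
counts noncrossing partial matchings. -/
def ballot (N : ℕ) (i : ℤ) : ℚ := binom N i - binom N (i - 1)

theorem ballot_succ (N : ℕ) (i : ℤ) : ballot (N + 1) i = ballot N i + ballot N (i - 1) := by
  simp only [ballot, binom_succ]; push_cast; ring

theorem ballot_of_neg (N : ℕ) {i : ℤ} (hi : i < 0) : ballot N i = 0 := by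
  rw [ballot, binom_of_neg _ hi, binom_of_neg _ (by omega)]; simp

theorem ballot_zero_right (N : ℕ) : ballot N 0 = 1 := by
  rw [ballot, binom_zero_right, binom_of_neg _ (by omega)]; simp

/-- The two middle binomial coefficients agree. This is the reflecting boundary condition at h = 0.
-/
theorem ballot_middle (m : ℕ) : ballot (2 * m + 1) (m + 1) = 0 := by
  have := binom_symm (2 * m + 1) (m + 1)
  rw [ballot, ← this, sub_eq_zero]
  congr 2; push_cast; ring

/-- Here m is the number of edges. The right sides are the coefficients of q^0, …, q^3 in the
Touchard–Riordan type expression (1-q)^(-m) ∑_j (-1)^j q^(j(j+1)/2) [h+j choose j]_q ballot(N, m-j).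
The conditions 1 ≤ h and 2 ≤ h record the truncation of [h+1]_q, the factor belonging to j = 1. The
induction combines `pmCount_succ` with Pascal's rule for ballot numbers. -/
theorem pmCount_formula (N m h : ℕ) (hN : N = 2 * m + h) :
    (pmCount N h 0 : ℚ) = ballot N m ∧
    (pmCount N h 1 : ℚ) = m * ballot N m - ballot N (m - 1) ∧
    (pmCount N h 2 : ℚ) = m * (m + 1) / 2 * ballot N m - m * ballot N (m - 1) -
      (if 1 ≤ h then ballot N (m - 1) else 0) ∧
    (pmCount N h 3 : ℚ) = m * (m + 1) * (m + 2) / 6 * ballot N m -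
      m * (m + 1) / 2 * ballot N (m - 1) - (if 1 ≤ h then m * ballot N (m - 1) else 0) -
      (if 2 ≤ h then ballot N (m - 1) else 0) + ballot N (m - 2) := by
  induction N generalizing m h with
  | zero =>
    obtain ⟨rfl, rfl⟩ : m = 0 ∧ h = 0 := by omega
    simp [pmCount_zero, ballot_zero_right, ballot_of_neg]
  | succ N ih =>
    simp only [pmCount_succ, sum_range_ite_le_three h (F := pmCount N (h + 1)) (Nat.zero_le 3),
      sum_range_ite_le_three h (F := pmCount N (h + 1)) (show 1 ≤ 3 by norm_num),
      sum_range_ite_le_three h (F := pmCount N (h + 1)) (show 2 ≤ 3 by norm_num),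
      sum_range_ite_le_three h (F := pmCount N (h + 1)) (show 3 ≤ 3 by norm_num)]
    cases m with
    | zero =>
      obtain rfl : h = N + 1 := by omega
      -- With no edges the last point must be free: the other case would need N + 2 free points
      -- among N.
      have hz : ∀ k, pmCount N (N + 1 + 1) k = 0 := fun k => pmCount_eq_zero k (by omega)
      obtain ⟨h0, h1, h2, h3⟩ := ih 0 N (by omega)
      simp only [hz, Nat.add_sub_cancel, Nat.add_eq_zero_iff, one_ne_zero, and_false, if_false,
        ite_self, add_zero, h0, h1, h2, h3]
      simp [ballot_zero_right, ballot_of_neg]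
    | succ m =>
      obtain ⟨g0, g1, g2, g3⟩ := ih m (h + 1) (by omega)
      have e1 : ((m + 1 : ℕ) : ℤ) - 1 = m := by push_cast; ring
      have e2 : ((m + 1 : ℕ) : ℤ) - 2 = m - 1 := by push_cast; ring
      have e3 : (m : ℤ) - 1 - 1 = m - 2 := by ring
      simp only [ballot_succ, e1, e2, e3]
      match h with
      | 0 =>
        -- With h = 0 the last point cannot be free, so the recursion loses one term; the missing
        -- ballot number is the one that vanishes in the middle.
        have hmid := ballot_middle m
        obtain rfl : N = 2 * m + 1 := by omega
        push_cast at *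
        simp [g0, g1, g2, g3, hmid]
        refine ⟨?_, ?_, ?_⟩ <;> ring
      | 1 =>
        obtain ⟨h0, h1, h2, h3⟩ := ih (m + 1) 0 (by omega)
        simp only [e1, e2] at h0 h1 h2 h3
        push_cast at *
        simp [g0, g1, g2, g3, h0, h1, h2, h3]
        refine ⟨?_, ?_, ?_⟩ <;> ring
      | 2 =>
        obtain ⟨h0, h1, h2, h3⟩ := ih (m + 1) 1 (by omega)
        simp only [e1, e2] at h0 h1 h2 h3
        push_cast at *
        simp [g0, g1, g2, g3, h0, h1, h2, h3]
        refine ⟨?_, ?_, ?_⟩ <;> ring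
      | h + 3 =>
        obtain ⟨h0, h1, h2, h3⟩ := ih (m + 1) (h + 2) (by omega)
        simp only [e1, e2] at h0 h1 h2 h3
        push_cast at *
        simp [g0, g1, g2, g3, h0, h1, h2, h3]
        refine ⟨?_, ?_, ?_⟩ <;> ring

/-! ### Matchings invariant under a rotation -/

theorem rotate_iterate {n : ℕ} (m : ℕ) (τ : Matching n) :
    rotate^[m] τ = relabel (finRotate (2 * n) ^ m) τ := by
  induction m with
  | zero => rfl
  | succ m ih => rw [Function.iterate_succ_apply', ih, pow_succ', relabel_mul]; rfl

theorem val_finRotate_pow {N : ℕ} (m : ℕ) (x : Fin N) :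
    ((finRotate N ^ m) x).val = (x.val + m) % N := by
  induction m with
  | zero => simp [Nat.mod_eq_of_lt x.isLt]
  | succ m ih =>
    rw [pow_succ', Equiv.Perm.mul_apply, val_finRotate, ih, ← add_assoc]
    have h1 := Nat.mod_lt (x.val + m) (Fin.pos x)
    split_ifs with h
    · rw [← Nat.mod_add_mod, h, Nat.mod_self]
    · rw [← Nat.mod_add_mod (x.val + m) N 1, Nat.mod_eq_of_lt (by omega : (x.val + m) % N + 1 < N)]

theorem rotate_iterate_eq_self_iff {n : ℕ} (m : ℕ) (τ : Matching n) :
    rotate^[m] τ = τ ↔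
      ∀ x, τ.partner ((finRotate (2 * n) ^ m) x) = (finRotate (2 * n) ^ m) (τ.partner x) := by
  rw [rotate_iterate]
  constructor
  · intro h x
    conv_lhs => rw [← h]
    simp [relabel]
  · intro h
    ext1
    funext x
    have := h ((finRotate (2 * n) ^ m).symm x)
    rw [Equiv.apply_symm_apply] at this
    exact this.symm

theorem rotate_iterate_two_mul {n : ℕ} (τ : Matching n) : rotate^[2 * n] τ = τ := by
  rw [rotate_iterate]
  convert relabel_one τ
  ext x
  rw [val_finRotate_pow]
  simp [Nat.mod_eq_of_lt x.isLt]

theorem crossings_rotate_iterate {n : ℕ} (m : ℕ) (τ : Matching n) :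
    crossings (rotate^[m] τ) = crossings τ := by
  rw [rotate_iterate]
  exact crossings_relabel ⟨_, Subgroup.npow_mem_zpowers (finRotate (2 * n)) m⟩ τ

/-- A matching of `d * M` points on a circle invariant under the rotation by `M` points: the circle
is cut into `d` arcs of `M` points, and the point `i` of the arc `u` is joined to the point `pos i`
of the arc `u + shift i`. -/
@[ext]
structure PeriodicMatching (d M : ℕ) [NeZero d] where
  pos : Fin M → Fin M
  shift : Fin M → Fin d
  pos_pos : ∀ i, pos (pos i) = i
  shift_pos : ∀ i, shift (pos i) = -shift i
  shift_ne : ∀ i, pos i = i → shift i ≠ 0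

namespace PeriodicMatching

variable {d M n : ℕ}

/-- The point `i` of the arc `u`. -/
def point (h : d * M = 2 * n) : Fin d × Fin M ≃ Fin (2 * n) :=
  finProdFinEquiv.trans (finCongr h)

theorem val_point (h : d * M = 2 * n) (u : Fin d) (i : Fin M) :
    (point h (u, i)).val = i.val + M * u.val := rfl

theorem point_lt_point (h : d * M = 2 * n) (u v : Fin d) (i j : Fin M) :
    point h (u, i) < point h (v, j) ↔ u < v ∨ u = v ∧ i < j := by
  rw [Fin.lt_def, val_point, val_point, Fin.lt_def, Fin.lt_def, Fin.ext_iff]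
  have hi := i.isLt
  have hj := j.isLt
  rcases lt_trichotomy u.val v.val with huv | huv | huv
  · have : M * (u.val + 1) ≤ M * v.val := Nat.mul_le_mul_left _ huv
    rw [Nat.mul_add] at this
    omega
  · rw [huv]; omega
  · have : M * (v.val + 1) ≤ M * u.val := Nat.mul_le_mul_left _ huv
    rw [Nat.mul_add] at this
    omega

variable [NeZero d]

instance : Finite (PeriodicMatching d M) :=
  Finite.of_injective (fun D => (D.pos, D.shift)) fun D E h => by
    ext1
    · exact congrArg Prod.fst h
    · exact congrArg Prod.snd h

theorem finRotate_pow_point (h : d * M = 2 * n) (k : ℕ) (u : Fin d) (i : Fin M) :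
    (finRotate (2 * n) ^ (M * k)) (point h (u, i)) = point h (u + Fin.ofNat d k, i) := by
  ext
  rw [val_finRotate_pow, val_point, val_point, ← h, Fin.val_add, Fin.val_ofNat, Nat.add_mod_mod]
  have hk : u.val + k = d * ((u.val + k) / d) + (u.val + k) % d := (Nat.div_add_mod _ d).symm
  have hd := Nat.mod_lt (u.val + k) (NeZero.pos d)
  have : i.val + M * u.val + M * k =
      (i.val + M * ((u.val + k) % d)) + d * M * ((u.val + k) / d) := by
    rw [add_assoc, ← mul_add]
    conv_lhs => rw [hk]
    ring
  rw [this, Nat.add_mul_mod_self_left, Nat.mod_eq_of_lt]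
  have h2 : M * ((u.val + k) % d + 1) ≤ M * d := Nat.mul_le_mul_left _ hd
  rw [Nat.mul_add, mul_comm M d] at h2
  have := i.isLt
  omega

theorem finRotate_pow_point_zero (h : d * M = 2 * n) (u : Fin d) (i : Fin M) :
    (finRotate (2 * n) ^ (M * u.val)) (point h (0, i)) = point h (u, i) := by
  rw [finRotate_pow_point, zero_add, Fin.ofNat_val_eq_self]

/-- The matching of the whole circle. -/
def toMatching (h : d * M = 2 * n) (D : PeriodicMatching d M) : Matching n where
  partner x := point h (((point h).symm x).1 + D.shift ((point h).symm x).2,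
    D.pos ((point h).symm x).2)
  partner_partner x := by
    simp only [Equiv.symm_apply_apply, D.pos_pos, D.shift_pos, add_neg_cancel_right]
    exact (point h).apply_symm_apply x
  partner_ne x := by
    intro hx
    rw [← Equiv.eq_symm_apply, Prod.ext_iff] at hx
    exact D.shift_ne _ hx.2 (by simpa using hx.1)

theorem toMatching_point (h : d * M = 2 * n) (D : PeriodicMatching d M) (u : Fin d) (i : Fin M) :
    (D.toMatching h).partner (point h (u, i)) = point h (u + D.shift i, D.pos i) := by
  simp [toMatching]

theorem commute_pow (m k : ℕ) (τ : Matching n)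
    (hτ : ∀ x, τ.partner ((finRotate (2 * n) ^ m) x) = (finRotate (2 * n) ^ m) (τ.partner x))
    (x : Fin (2 * n)) : τ.partner ((finRotate (2 * n) ^ (m * k)) x) =
      (finRotate (2 * n) ^ (m * k)) (τ.partner x) := by
  induction k with
  | zero => rfl
  | succ k ih =>
    rw [Nat.mul_succ, add_comm, pow_add, Equiv.Perm.mul_apply, Equiv.Perm.mul_apply, hτ, ih]

theorem rotate_toMatching (h : d * M = 2 * n) (D : PeriodicMatching d M) :
    rotate^[M] (D.toMatching h) = D.toMatching h := by
  rw [rotate_iterate_eq_self_iff]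
  intro x
  obtain ⟨⟨u, i⟩, rfl⟩ := (point h).surjective x
  have := finRotate_pow_point h 1
  rw [mul_one] at this
  rw [this, toMatching_point, toMatching_point, this, add_right_comm]

theorem toMatching_injective (h : d * M = 2 * n) :
    Function.Injective (toMatching (d := d) (M := M) h) := by
  intro D E hDE
  have key : ∀ i, (D.shift i, D.pos i) = (E.shift i, E.pos i) := by
    intro i
    have := congrArg (fun τ => τ.partner (point h (0, i))) hDE
    simpa only [toMatching_point, zero_add, EmbeddingLike.apply_eq_iff_eq] using this
  ext1
  · funext i; exact congrArg Prod.snd (key i)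
  · funext i; exact congrArg Prod.fst (key i)

/-- By invariance the partners of the points in arc 0 determine all the others; their positions and
arcs are the required data. -/
theorem exists_toMatching_eq (h : d * M = 2 * n) (τ : Matching n) (hτ : rotate^[M] τ = τ) :
    ∃ D : PeriodicMatching d M, D.toMatching h = τ := by
  rw [rotate_iterate_eq_self_iff] at hτ
  let p : Fin M → Fin M := fun i => ((point h).symm (τ.partner (point h (0, i)))).2
  let s : Fin M → Fin d := fun i => ((point h).symm (τ.partner (point h (0, i)))).1
  have key : ∀ u i, τ.partner (point h (u, i)) = point h (u + s i, p i) := by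
    intro u i
    have h2 : τ.partner (point h (0, i)) = point h (s i, p i) := by simp [s, p]
    rw [← finRotate_pow_point_zero, commute_pow M _ τ hτ, h2, finRotate_pow_point,
      Fin.ofNat_val_eq_self, add_comm]
  have h2 : ∀ i, (s i + s (p i), p (p i)) = ((0 : Fin d), i) := by
    intro i
    have := τ.partner_partner (point h (0, i))
    rwa [key, key, zero_add, EmbeddingLike.apply_eq_iff_eq] at this
  refine ⟨⟨p, s, fun i => congrArg Prod.snd (h2 i),
    fun i => (neg_eq_of_add_eq_zero_right (congrArg Prod.fst (h2 i))).symm, ?_⟩, ?_⟩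
  · intro i hi hs
    apply τ.partner_ne (point h (0, i))
    rw [key, hi, hs, add_zero]
  · ext1
    funext x
    obtain ⟨⟨u, i⟩, rfl⟩ := (point h).surjective x
    rw [toMatching_point, key]

/-- The number of crossings of the matching of the whole circle. -/
noncomputable def crossNum (D : PeriodicMatching d M) : ℕ :=
  ∑ i, ∑ j, ∑ u : Fin d, ∑ v : Fin d,
    if (u < v ∨ u = v ∧ i < j) ∧ (v < u + D.shift i ∨ v = u + D.shift i ∧ j < D.pos i) ∧
      (u + D.shift i < v + D.shift j ∨ u + D.shift i = v + D.shift j ∧ D.pos i < D.pos j)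
    then 1 else 0

theorem crossings_toMatching (h : d * M = 2 * n) (D : PeriodicMatching d M) :
    crossings (D.toMatching h) = D.crossNum := by
  rw [crossings, crossingPairs, Finset.card_filter, ← Finset.univ_product_univ,
    Finset.sum_product, ← (point h).sum_comp, Fintype.sum_prod_type_right]
  simp only [← (point h).sum_comp (fun y : Fin (2 * n) => ite _ _ _), Fintype.sum_prod_type_right,
    toMatching_point, point_lt_point]
  rw [crossNum]
  refine Finset.sum_congr rfl fun i _ => ?_
  rw [Finset.sum_comm]

/-- Matchings invariant under the rotation by `M` points. -/
noncomputable def equivFixed (h : d * M = 2 * n) (k : ℕ) :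
    {D : PeriodicMatching d M // D.crossNum = k} ≃
      {τ : Matching n // crossings τ = k ∧ rotate^[M] τ = τ} :=
  Equiv.ofBijective
    (fun D => ⟨D.1.toMatching h, (crossings_toMatching h D.1).trans D.2, rotate_toMatching h D.1⟩)
    ⟨fun D E hDE => Subtype.ext (toMatching_injective h (congrArg Subtype.val hDE)), fun τ => by
      obtain ⟨D, hD⟩ := exists_toMatching_eq h τ.1 τ.2.2
      exact ⟨⟨D, by rw [← crossings_toMatching h, hD, τ.2.1]⟩, Subtype.ext hD⟩⟩

end PeriodicMatching

/-- The part of a periodic matching formed by the edges joining different arcs. -/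
@[ext]
structure Pattern (d : ℕ) [NeZero d] (α : Type*) where
  pos : α → α
  shift : α → Fin d
  pos_pos : ∀ i, pos (pos i) = i
  shift_pos : ∀ i, shift (pos i) = -shift i
  shift_ne : ∀ i, shift i ≠ 0

instance {d : ℕ} [NeZero d] {α : Type*} [Finite α] : Finite (Pattern d α) :=
  Finite.of_injective (fun D => (D.pos, D.shift)) fun D E h => by
    ext1
    · exact congrArg Prod.fst h
    · exact congrArg Prod.snd h

noncomputable instance {d : ℕ} [NeZero d] {α : Type*} [Finite α] : Fintype (Pattern d α) :=
  Fintype.ofFinite _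

noncomputable instance {d M : ℕ} [NeZero d] : Fintype (PeriodicMatching d M) :=
  Fintype.ofFinite _

namespace PeriodicMatching

variable {d M : ℕ} [NeZero d]

theorem sum_pos (D : PeriodicMatching d M) (F : Fin M → ℕ) : ∑ i, F (D.pos i) = ∑ i, F i :=
  Equiv.sum_comp (Function.Involutive.toPerm D.pos D.pos_pos) F

/-- The periodic matching with edges inside the arcs given by `f`, and the other edges by `P`. -/
def join (f : Invol (Fin M)) (P : Pattern d (Free f)) : PeriodicMatching d M where
  pos i := if h : f.1 i = i then (P.pos ⟨i, h⟩).1 else f.1 i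
  shift i := if h : f.1 i = i then P.shift ⟨i, h⟩ else 0
  pos_pos i := by
    by_cases h : f.1 i = i
    · simp only [h, dif_pos, (P.pos ⟨i, h⟩).2, Subtype.coe_eta, P.pos_pos]
    · have h' : ¬f.1 (f.1 i) = f.1 i := by rw [f.2 i]; exact Ne.symm h
      simp only [h, dif_neg, h', not_false_eq_true]
      exact f.2 i
  shift_pos i := by
    by_cases h : f.1 i = i
    · simp only [h, dif_pos, (P.pos ⟨i, h⟩).2, Subtype.coe_eta, P.shift_pos]
    · have h' : ¬f.1 (f.1 i) = f.1 i := by rw [f.2 i]; exact Ne.symm h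
      simp only [h, dif_neg, h', not_false_eq_true, neg_zero]
  shift_ne i hi := by
    by_cases h : f.1 i = i
    · simp only [h, dif_pos]; exact P.shift_ne _
    · simp only [h, dif_neg, not_false_eq_true] at hi

theorem join_pos_free (f : Invol (Fin M)) (P : Pattern d (Free f)) (a : Free f) :
    (join f P).pos a.1 = (P.pos a).1 := by
  simp [join, a.2]

theorem join_shift_free (f : Invol (Fin M)) (P : Pattern d (Free f)) (a : Free f) :
    (join f P).shift a.1 = P.shift a := by
  simp [join, a.2]

theorem join_pos_of_ne (f : Invol (Fin M)) (P : Pattern d (Free f)) {i : Fin M} (h : f.1 i ≠ i) :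
    (join f P).pos i = f.1 i := by
  simp [join, h]

theorem join_shift_eq_zero_iff (f : Invol (Fin M)) (P : Pattern d (Free f)) {i : Fin M} :
    (join f P).shift i = 0 ↔ f.1 i ≠ i := by
  by_cases h : f.1 i = i
  · simp [join, h, P.shift_ne]
  · simp [join, h]

theorem join_injective : Function.Injective
    fun x : Σ f : Invol (Fin M), Pattern d (Free f) => join x.1 x.2 := by
  rintro ⟨f, P⟩ ⟨g, Q⟩ h
  dsimp only at h
  have hfix : ∀ i, f.1 i ≠ i ↔ g.1 i ≠ i := fun i => by
    rw [← join_shift_eq_zero_iff f P, h, join_shift_eq_zero_iff]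
  have hfg : f = g := by
    ext i : 2
    by_cases hi : f.1 i = i
    · rw [hi, not_not.mp (mt (hfix i).mpr (not_not.mpr hi))]
    · rw [← join_pos_of_ne f P hi, h, join_pos_of_ne g Q ((hfix i).mp hi)]
  subst hfg
  have hPQ : P = Q := by
    ext a
    · rw [← join_pos_free, h, join_pos_free]
    · rw [← join_shift_free, h, join_shift_free]
  rw [hPQ]

/-- The inner matching keeps the edges of shift 0 and frees every other point. A point with shift 0
is never its own position, so the free points are exactly those of nonzero shift. -/
theorem join_surjective : Function.Surjective
    fun x : Σ f : Invol (Fin M), Pattern d (Free f) => join x.1 x.2 := by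
  intro D
  let f : Fin M → Fin M := fun i => if D.shift i = 0 then D.pos i else i
  have hf : Function.Involutive f := by
    intro i
    by_cases h : D.shift i = 0
    · simp [f, h, D.shift_pos, D.pos_pos]
    · simp [f, h]
  have hfree : ∀ i, f i = i ↔ D.shift i ≠ 0 := by
    intro i
    by_cases h : D.shift i = 0
    · simp only [f, h, if_true, ne_eq, not_true_eq_false, iff_false]
      exact fun hi => D.shift_ne i hi h
    · simp [f, h]
  let F : Invol (Fin M) := ⟨f, hf⟩
  refine ⟨⟨F, ⟨fun a => ⟨D.pos a.1, (hfree _).mpr ?_⟩, fun a => D.shift a.1, fun a => ?_,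
    fun a => D.shift_pos a.1, fun a => (hfree _).mp a.2⟩⟩, ?_⟩
  · rw [D.shift_pos, neg_ne_zero]
    exact (hfree _).mp a.2
  · exact Subtype.ext (D.pos_pos a.1)
  · ext i : 2
    · by_cases h : f i = i
      · exact join_pos_free F _ ⟨i, h⟩
      · dsimp only
        rw [join_pos_of_ne F _ h]
        have : D.shift i = 0 := by rwa [hfree, ne_eq, not_not] at h
        simp [F, f, this]
    · by_cases h : f i = i
      · exact join_shift_free F _ ⟨i, h⟩
      · have h2 : D.shift i = 0 := by rwa [hfree, ne_eq, not_not] at h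
        rw [h2]
        exact (join_shift_eq_zero_iff F _).mpr h

theorem sum_join (F : PeriodicMatching d M → ℕ) :
    ∑ D, F D = ∑ f : Invol (Fin M), ∑ P : Pattern d (Free f), F (join f P) := by
  have hbij : Function.Bijective fun x : Σ f : Invol (Fin M), Pattern d (Free f) => join x.1 x.2 :=
    ⟨join_injective, join_surjective⟩
  rw [← hbij.sum_comp, Fintype.sum_sigma]

theorem sum_free (f : Invol (Fin M)) (G : Fin M → ℕ) :
    ∑ a : Free f, G a.1 = ∑ i, if f.1 i = i then G i else 0 := by
  rw [← Finset.sum_filter]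
  exact (Finset.sum_subtype _ (by simp) G).symm

end PeriodicMatching

/-- The number of pairs of points whose order is preserved. -/
def Pattern.orderedPairs {d : ℕ} [NeZero d] {α : Type*} [Fintype α] [LinearOrder α]
    (P : Pattern d α) : ℕ :=
  ∑ a, ∑ b, if a < b ∧ P.pos a < P.pos b then 1 else 0

/-- One third of the number of crossings of the edges of a pattern with three arcs. -/
def Pattern.crossThird {α : Type*} [Fintype α] [LinearOrder α] (P : Pattern 3 α) : ℕ :=
  ∑ a, ∑ b, ((if P.shift a = 1 ∧ P.shift b = 1 ∧ a < b ∧ P.pos a < P.pos b then 1 else 0) +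
    if P.shift a = 1 ∧ P.shift b = 2 ∧ a < b then 1 else 0)

namespace PeriodicMatching

variable {M : ℕ}

/-- An edge leaving the arc behaves like a ray to infinity with respect to the edges inside the arc.
This is why free points enter `crossCard`. -/
theorem crossCard_join {d : ℕ} [NeZero d] (f : Invol (Fin M)) (P : Pattern d (Free f)) :
    (∑ i, ∑ j, ((if (join f P).shift i = 0 ∧ (join f P).shift j = 0 ∧ i < j ∧
        j < (join f P).pos i ∧ (join f P).pos i < (join f P).pos j then 1 else 0) +
      if (join f P).shift i = 0 ∧ (join f P).shift j ≠ 0 ∧ i < j ∧ j < (join f P).pos i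
      then 1 else 0)) = crossCard f := by
  refine Finset.sum_congr rfl fun i _ => Finset.sum_congr rfl fun j _ => ?_
  simp only [ne_eq, join_shift_eq_zero_iff]
  by_cases hi : f.1 i = i
  · have : ¬(i < j ∧ j < i ∧ (f.1 j = j ∨ i < f.1 j)) := fun h => absurd h.1 h.2.1.not_gt
    simp [hi, this]
  · rw [join_pos_of_ne f P hi]
    by_cases hj : f.1 j = j
    · simp [hi, hj]
    · rw [join_pos_of_ne f P hj]
      simp [hi, hj]

/-- Transfers the count of crossings between outgoing edges from the whole arc to the free points,
where the pattern lives. -/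
theorem sum_shift_ne_zero {d : ℕ} [NeZero d] (f : Invol (Fin M)) (P : Pattern d (Free f))
    (G : Fin d → Fin d → Prop) [DecidableRel G] (hG : ∀ s t, G s t → s ≠ 0 ∧ t ≠ 0)
    (H : Fin M → Fin M → Fin M → Fin M → Prop) [∀ a b c d, Decidable (H a b c d)] :
    (∑ i, ∑ j, if G ((join f P).shift i) ((join f P).shift j) ∧
      H i j ((join f P).pos i) ((join f P).pos j) then 1 else 0) =
    ∑ a, ∑ b, if G (P.shift a) (P.shift b) ∧ H a.1 b.1 (P.pos a).1 (P.pos b).1 then 1 else 0 := by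
  simp only [← join_pos_free, ← join_shift_free]
  rw [sum_free f (fun i => ∑ b : Free f, if G ((join f P).shift i) ((join f P).shift b.1) ∧
      H i b.1 ((join f P).pos i) ((join f P).pos b.1) then 1 else 0)]
  refine Finset.sum_congr rfl fun i _ => ?_
  rw [sum_free f (fun j => if G ((join f P).shift i) ((join f P).shift j) ∧
      H i j ((join f P).pos i) ((join f P).pos j) then 1 else 0)]
  split_ifs with hi
  · refine Finset.sum_congr rfl fun j _ => ?_
    by_cases hj : f.1 j = j
    · simp [hj]
    · rw [if_neg hj, if_neg]
      exact fun h => (hG _ _ h.1).2 ((join_shift_eq_zero_iff f P).mpr hj)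
  · refine Finset.sum_eq_zero fun j _ => if_neg ?_
    exact fun h => (hG _ _ h.1).1 ((join_shift_eq_zero_iff f P).mpr hi)

/-- Crossings that involve an inner edge occur once in each half. Each edge between the halves has
one end in the first half, and two of them cross exactly when the order of their positions is the
same in both halves. -/
theorem crossNum_two (f : Invol (Fin M)) (P : Pattern 2 (Free f)) :
    (join f P).crossNum = 2 * crossCard f + P.orderedPairs := by
  -- For fixed shifts and fixed order relations of the positions, the sum over the pairs of arcs is
  -- a finite computation. A, B, C stand for i < j, j < pos i, pos i < pos j.
  have key : ∀ (s t : Fin 2) (A B C : Prop) [Decidable A] [Decidable B] [Decidable C],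
      (∑ u : Fin 2, ∑ v : Fin 2, if (u < v ∨ u = v ∧ A) ∧ (v < u + s ∨ v = u + s ∧ B) ∧
        (u + s < v + t ∨ u + s = v + t ∧ C) then 1 else 0) =
      2 * (if s = 0 ∧ t = 0 ∧ A ∧ B ∧ C then 1 else 0) + (if s = 0 ∧ t ≠ 0 ∧ A ∧ B then 1 else 0) +
      (if s ≠ 0 ∧ t = 0 ∧ B ∧ C then 1 else 0) +
      if (s ≠ 0 ∧ t ≠ 0) ∧ A ∧ C then 1 else 0 := by
    intro s t A B C _ _ _
    by_cases hA : A <;> by_cases hB : B <;> by_cases hC : C <;>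
      simp only [hA, hB, hC] <;> revert s t <;> decide
  have h1 := sum_shift_ne_zero f P (fun s t => s ≠ 0 ∧ t ≠ 0) (fun _ _ h => h)
    (fun a b c d => a < b ∧ c < d)
  have h2 : P.orderedPairs = ∑ i, ∑ j, if ((join f P).shift i ≠ 0 ∧ (join f P).shift j ≠ 0) ∧
      i < j ∧ (join f P).pos i < (join f P).pos j then 1 else 0 := by
    rw [h1]
    simp [Pattern.orderedPairs, P.shift_ne]
  rw [h2, ← crossCard_join f P]
  -- An outgoing edge can occur as the first or as the second of a crossing pair; passing from i to
  -- its partner turns the first kind into the second.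
  set D := join f P
  have h3 : (∑ i, ∑ j, if D.shift i ≠ 0 ∧ D.shift j = 0 ∧ j < D.pos i ∧ D.pos i < D.pos j
      then 1 else 0) =
      ∑ i, ∑ j, if D.shift i = 0 ∧ D.shift j ≠ 0 ∧ i < j ∧ j < D.pos i then 1 else 0 := by
    rw [← D.sum_pos, Finset.sum_comm]
    refine Finset.sum_congr rfl fun i _ => Finset.sum_congr rfl fun j _ => ?_
    refine if_congr ?_ rfl rfl
    rw [D.pos_pos, D.shift_pos, neg_ne_zero]
    tauto
  simp only [crossNum, key, Finset.sum_add_distrib, ← Finset.mul_sum]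
  rw [h3]
  ring

/-- Rotation permutes the crossings in orbits of three. The local sums give unequal weights to
shifts 1 and 2, which are the two ends of the same kind of edge; exchanging partners merges them and
makes every weight 3. -/
theorem crossNum_three (f : Invol (Fin M)) (P : Pattern 3 (Free f)) :
    (join f P).crossNum = 3 * (crossCard f + P.crossThird) := by
  have key : ∀ (s t : Fin 3) (A B C : Prop) [Decidable A] [Decidable B] [Decidable C],
      (∑ u : Fin 3, ∑ v : Fin 3, if (u < v ∨ u = v ∧ A) ∧ (v < u + s ∨ v = u + s ∧ B) ∧
        (u + s < v + t ∨ u + s = v + t ∧ C) then 1 else 0) =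
      3 * (if s = 0 ∧ t = 0 ∧ A ∧ B ∧ C then 1 else 0) +
      2 * (if s = 0 ∧ t = 1 ∧ A ∧ B then 1 else 0) + (if s = 0 ∧ t = 2 ∧ A ∧ B then 1 else 0) +
      2 * (if s = 1 ∧ t = 0 ∧ B ∧ C then 1 else 0) + (if s = 2 ∧ t = 0 ∧ B ∧ C then 1 else 0) +
      2 * (if (s = 1 ∧ t = 1) ∧ A ∧ C then 1 else 0) + (if s = 1 ∧ t = 1 ∧ B then 1 else 0) +
      (if (s = 1 ∧ t = 2) ∧ A then 1 else 0) + (if s = 2 ∧ t = 1 ∧ C then 1 else 0) +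
      (if s = 2 ∧ t = 2 ∧ A ∧ C then 1 else 0) := by
    intro s t A B C _ _ _
    by_cases hA : A <;> by_cases hB : B <;> by_cases hC : C <;>
      simp only [hA, hB, hC] <;> revert s t <;> decide
  have h1 := sum_shift_ne_zero f P (fun s t => s = 1 ∧ t = 1) (by decide)
    (fun a b c d => a < b ∧ c < d)
  have h2 := sum_shift_ne_zero f P (fun s t => s = 1 ∧ t = 2) (by decide)
    (fun a b c d => a < b)
  have h3 : P.crossThird =
      (∑ i, ∑ j, if ((join f P).shift i = 1 ∧ (join f P).shift j = 1) ∧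
        i < j ∧ (join f P).pos i < (join f P).pos j then 1 else 0) +
      ∑ i, ∑ j, if ((join f P).shift i = 1 ∧ (join f P).shift j = 2) ∧ i < j then 1 else 0 := by
    rw [h1, h2]
    simp only [Pattern.crossThird, Finset.sum_add_distrib, and_assoc, Subtype.coe_lt_coe]
  rw [h3, ← crossCard_join f P]
  set D := join f P
  have n1 : -(1 : Fin 3) = 2 := by decide
  have n2 : -(2 : Fin 3) = 1 := by decide
  have neg1 : ∀ i, D.shift (D.pos i) = 1 ↔ D.shift i = 2 := fun i => by
    rw [D.shift_pos, neg_eq_iff_eq_neg, n1]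
  have neg2 : ∀ i, D.shift (D.pos i) = 2 ↔ D.shift i = 1 := fun i => by
    rw [D.shift_pos, neg_eq_iff_eq_neg, n2]
  -- The six identities rewrite each class of crossings from `key` in terms of a few standard ones,
  -- by replacing i, or both i and j, by the partner position; this negates the shift and so
  -- exchanges 1 and 2.
  have e1 : (∑ i, ∑ j, if D.shift i = 0 ∧ D.shift j ≠ 0 ∧ i < j ∧ j < D.pos i then 1 else 0) =
      (∑ i, ∑ j, if D.shift i = 0 ∧ D.shift j = 1 ∧ i < j ∧ j < D.pos i then 1 else 0) +
      ∑ i, ∑ j, if D.shift i = 0 ∧ D.shift j = 2 ∧ i < j ∧ j < D.pos i then 1 else 0 := by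
    simp only [← Finset.sum_add_distrib]
    refine Finset.sum_congr rfl fun i _ => Finset.sum_congr rfl fun j _ => ?_
    generalize D.shift i = s
    generalize D.shift j = t
    by_cases hA : i < j <;> by_cases hB : j < D.pos i <;> simp only [hA, hB] <;> revert s t <;>
      decide
  have e2 : (∑ i, ∑ j, if D.shift i = 1 ∧ D.shift j = 0 ∧ j < D.pos i ∧ D.pos i < D.pos j
      then 1 else 0) =
      ∑ i, ∑ j, if D.shift i = 0 ∧ D.shift j = 2 ∧ i < j ∧ j < D.pos i then 1 else 0 := by
    rw [← D.sum_pos, Finset.sum_comm]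
    refine Finset.sum_congr rfl fun i _ => Finset.sum_congr rfl fun j _ => ?_
    refine if_congr ?_ rfl rfl
    rw [D.pos_pos, neg1, and_left_comm]
  have e3 : (∑ i, ∑ j, if D.shift i = 2 ∧ D.shift j = 0 ∧ j < D.pos i ∧ D.pos i < D.pos j
      then 1 else 0) =
      ∑ i, ∑ j, if D.shift i = 0 ∧ D.shift j = 1 ∧ i < j ∧ j < D.pos i then 1 else 0 := by
    rw [← D.sum_pos, Finset.sum_comm]
    refine Finset.sum_congr rfl fun i _ => Finset.sum_congr rfl fun j _ => ?_
    refine if_congr ?_ rfl rfl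
    rw [D.pos_pos, neg2, and_left_comm]
  have e4 : (∑ i, ∑ j, if D.shift i = 1 ∧ D.shift j = 1 ∧ j < D.pos i then 1 else 0) =
      ∑ i, ∑ j, if (D.shift i = 1 ∧ D.shift j = 2) ∧ i < j then 1 else 0 := by
    rw [← D.sum_pos, Finset.sum_comm]
    refine Finset.sum_congr rfl fun i _ => Finset.sum_congr rfl fun j _ => ?_
    refine if_congr ?_ rfl rfl
    rw [D.pos_pos, neg1, and_left_comm, and_assoc]
  have e5 : (∑ i, ∑ j, if D.shift i = 2 ∧ D.shift j = 1 ∧ D.pos i < D.pos j then 1 else 0) =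
      ∑ i, ∑ j, if (D.shift i = 1 ∧ D.shift j = 2) ∧ i < j then 1 else 0 := by
    rw [← D.sum_pos]
    refine Finset.sum_congr rfl fun i _ => ?_
    rw [← D.sum_pos]
    refine Finset.sum_congr rfl fun j _ => ?_
    refine if_congr ?_ rfl rfl
    rw [D.pos_pos, D.pos_pos, neg1, neg2, and_assoc]
  have e6 : (∑ i, ∑ j, if D.shift i = 2 ∧ D.shift j = 2 ∧ i < j ∧ D.pos i < D.pos j
      then 1 else 0) =
      ∑ i, ∑ j, if (D.shift i = 1 ∧ D.shift j = 1) ∧ i < j ∧ D.pos i < D.pos j then 1 else 0 := by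
    rw [← D.sum_pos]
    refine Finset.sum_congr rfl fun i _ => ?_
    rw [← D.sum_pos]
    refine Finset.sum_congr rfl fun j _ => ?_
    refine if_congr ?_ rfl rfl
    rw [D.pos_pos, D.pos_pos, neg2, neg2, and_assoc, and_comm (a := D.pos i < D.pos j)]
  simp only [crossNum, key, Finset.sum_add_distrib, ← Finset.mul_sum]
  rw [e1, e2, e3, e4, e5, e6]
  ring

end PeriodicMatching

/-! ### Counting patterns by removing the edge at an extreme point -/

theorem sum_comp_card_above {α : Type*} [Fintype α] [LinearOrder α] (φ : ℕ → ℕ) :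
    ∑ b : α, φ (∑ t : α, if b < t then 1 else 0) = ∑ l ∈ Finset.range (Fintype.card α), φ l := by
  have h1 : ∀ b : α, φ (∑ t : α, if b < t then 1 else 0) =
      ∑ l ∈ Finset.range (Fintype.card α),
        if (∑ t : α, if b < t then 1 else 0) = l then φ l else 0 := by
    intro b
    rw [Finset.sum_ite_eq, if_pos (Finset.mem_range.mpr (sum_card_above_lt b))]
  simp only [h1]
  rw [Finset.sum_comm]
  refine Finset.sum_congr rfl fun l hl => ?_
  have := sum_card_above_eq (α := α) (Finset.mem_range.mp hl)
  calc _ = ∑ b : α, φ l * (if (∑ t : α, if b < t then 1 else 0) = l then 1 else 0) := by simp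
    _ = φ l := by rw [← Finset.mul_sum, this, mul_one]

theorem sum_comp_card_below {α : Type*} [Fintype α] [LinearOrder α] (φ : ℕ → ℕ) :
    ∑ b : α, φ (∑ t : α, if t < b then 1 else 0) = ∑ l ∈ Finset.range (Fintype.card α), φ l :=
  sum_comp_card_above (α := αᵒᵈ) φ

/-- The points remaining after the removal of an edge. -/
abbrev Rest {α : Type*} (a b : α) := {x : α // x ≠ a ∧ x ≠ b}

theorem sum_eq_add_sum_rest {α : Type*} [Fintype α] [DecidableEq α] (a b : α) (g : α → ℕ) :
    ∑ x, g x = g a + (if b = a then 0 else g b) + ∑ x : Rest a b, g x.1 := by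
  have h : ∑ x : Rest a b, g x.1 = ∑ x ∈ Finset.univ.filter (fun x => x ≠ a ∧ x ≠ b), g x :=
    (Finset.sum_subtype _ (by simp) g).symm
  rw [h, ← Finset.sum_filter_add_sum_filter_not Finset.univ (fun x => x ≠ a ∧ x ≠ b) g, add_comm]
  congr 1
  have h2 : Finset.univ.filter (fun x => ¬(x ≠ a ∧ x ≠ b)) = {a, b} := by
    ext x; simp; tauto
  rw [h2]
  split_ifs with hab
  · simp [hab]
  · rw [Finset.sum_pair (Ne.symm hab)]

theorem card_rest {α : Type*} [Fintype α] [DecidableEq α] (a b : α) :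
    Fintype.card α = 1 + (if b = a then 0 else 1) + Fintype.card (Rest a b) := by
  have := sum_eq_add_sum_rest a b fun _ => 1
  simpa using this

/-- The number of involutions of `n` points in a row with `k` ordered pairs, computed by removing
the first point and its image. -/
def involCount : ℕ → ℕ → ℕ
  | 0, k => if k = 0 then 1 else 0
  | 1, k => if k = 0 then 1 else 0
  | n + 2, k => (if n + 1 ≤ k then involCount (n + 1) (k - (n + 1)) else 0) +
      ∑ l ∈ Finset.range (n + 1), if 2 * l ≤ k then involCount n (k - 2 * l) else 0

theorem involCount_succ (n k : ℕ) : involCount (n + 1) k =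
    (if n ≤ k then involCount n (k - n) else 0) +
      ∑ l ∈ Finset.range n, if 2 * l ≤ k then involCount (n - 1) (k - 2 * l) else 0 := by
  cases n with
  | zero => simp [involCount]
  | succ n => rw [involCount]; rfl

namespace Pattern

variable {d : ℕ} [NeZero d] {α : Type*}

theorem sum_pos [Fintype α] (P : Pattern d α) (F : α → ℕ) : ∑ i, F (P.pos i) = ∑ i, F i :=
  Equiv.sum_comp (Function.Involutive.toPerm P.pos P.pos_pos) F

theorem pos_injective (P : Pattern d α) : Function.Injective P.pos :=
  Function.Involutive.injective P.pos_pos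

/-- The possible partners of the point `a`. -/
abbrev Choice (d : ℕ) [NeZero d] (a : α) :=
  {x : α × Fin d // x.2 ≠ 0 ∧ (x.1 = a → x.2 = -x.2)}

/-- Adding the edge from `a` given by `x` to a pattern on the remaining points. -/
def extend [DecidableEq α] (a : α) (x : Choice d a) (P : Pattern d (Rest a x.1.1)) :
    Pattern d α where
  pos i := if h : i ≠ a ∧ i ≠ x.1.1 then (P.pos ⟨i, h⟩).1 else if i = a then x.1.1 else a
  shift i := if h : i ≠ a ∧ i ≠ x.1.1 then P.shift ⟨i, h⟩ else if i = a then x.1.2 else -x.1.2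
  pos_pos i := by
    by_cases h : i ≠ a ∧ i ≠ x.1.1
    · simp only [dif_pos h, dif_pos (P.pos ⟨i, h⟩).2, Subtype.coe_eta, P.pos_pos]
    · rw [dif_neg h]
      by_cases hi : i = a
      · simp [hi]
      · have : i = x.1.1 := by tauto
        simp [this]
  shift_pos i := by
    by_cases h : i ≠ a ∧ i ≠ x.1.1
    · simp only [dif_pos h, dif_pos (P.pos ⟨i, h⟩).2, Subtype.coe_eta, P.shift_pos]
    · rw [dif_neg h, dif_neg h]
      by_cases hi : i = a
      · by_cases hx : x.1.1 = a
        · simp [hi, hx, ← x.2.2 hx]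
        · simp [hi, hx]
      · simp [hi]
  shift_ne i := by
    by_cases h : i ≠ a ∧ i ≠ x.1.1
    · rw [dif_pos h]; exact P.shift_ne _
    · rw [dif_neg h]
      split_ifs
      · exact x.2.1
      · exact neg_ne_zero.mpr x.2.1

section
variable [DecidableEq α] (a : α) (x : Choice d a) (P : Pattern d (Rest a x.1.1))

theorem extend_pos_rest (i : Rest a x.1.1) : (extend a x P).pos i.1 = (P.pos i).1 := by
  simp [extend, i.2]

theorem extend_shift_rest (i : Rest a x.1.1) : (extend a x P).shift i.1 = P.shift i := by
  simp [extend, i.2]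

theorem extend_pos_left : (extend a x P).pos a = x.1.1 := by simp [extend]

theorem extend_shift_left : (extend a x P).shift a = x.1.2 := by simp [extend]

theorem extend_pos_right : (extend a x P).pos x.1.1 = a := by
  conv_lhs => rw [← extend_pos_left a x P]
  rw [pos_pos]

theorem extend_shift_right : (extend a x P).shift x.1.1 = -x.1.2 := by
  conv_lhs => rw [← extend_pos_left a x P]
  rw [shift_pos, extend_shift_left]

end

theorem extend_bijective [DecidableEq α] (a : α) : Function.Bijective
    fun x : Σ x : Choice d a, Pattern d (Rest a x.1.1) => extend a x.1 x.2 := by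
  constructor
  · rintro ⟨x, P⟩ ⟨y, Q⟩ h
    dsimp only at h
    have hxy : x = y := by
      apply Subtype.ext
      apply Prod.ext
      · rw [← extend_pos_left a x P, h, extend_pos_left]
      · rw [← extend_shift_left a x P, h, extend_shift_left]
    subst hxy
    have : P = Q := by
      ext i
      · rw [← extend_pos_rest, h, extend_pos_rest]
      · rw [← extend_shift_rest, h, extend_shift_rest]
    rw [this]
  · intro D
    let x : Choice d a := ⟨(D.pos a, D.shift a), D.shift_ne a, fun h => by
      have := D.shift_pos a
      simp only at h
      rwa [h] at this⟩
    have hrest : ∀ i : Rest a x.1.1, D.pos i.1 ≠ a ∧ D.pos i.1 ≠ x.1.1 := fun i => by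
      refine ⟨fun h => i.2.2 ?_, fun h => i.2.1 (D.pos_injective h)⟩
      exact (D.pos_pos i.1).symm.trans (congrArg D.pos h)
    let P : Pattern d (Rest a x.1.1) := ⟨fun i => ⟨D.pos i.1, hrest i⟩, fun i => D.shift i.1,
      fun i => Subtype.ext (D.pos_pos i.1), fun i => D.shift_pos i.1, fun i => D.shift_ne i.1⟩
    refine ⟨⟨x, P⟩, ?_⟩
    dsimp only
    have key : ∀ i, i = a ∨ i = x.1.1 ∨ (i ≠ a ∧ i ≠ x.1.1) := fun i => by tauto
    ext i
    · rcases key i with rfl | rfl | h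
      · rw [extend_pos_left]
      · rw [extend_pos_right]; exact (D.pos_pos a).symm
      · exact extend_pos_rest a x P ⟨i, h⟩
    · rcases key i with rfl | rfl | h
      · rw [extend_shift_left]
      · rw [extend_shift_right]; exact congrArg Fin.val (D.shift_pos a).symm
      · exact congrArg Fin.val (extend_shift_rest a x P ⟨i, h⟩)

theorem sum_extend [Fintype α] [DecidableEq α] (a : α) (F : Pattern d α → ℕ) :
    ∑ P, F P = ∑ x : Choice d a, ∑ P : Pattern d (Rest a x.1.1), F (extend a x P) := by
  rw [← (extend_bijective a).sum_comp, Fintype.sum_sigma]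

theorem sum_choice [Fintype α] [DecidableEq α] (a : α) (G : α → Fin d → ℕ) :
    ∑ x : Choice d a, G x.1.1 x.1.2 =
      ∑ b, ∑ c, if c ≠ 0 ∧ (b = a → c = -c) then G b c else 0 := by
  have h : ∑ x : Choice d a, G x.1.1 x.1.2 = ∑ x ∈ Finset.univ.filter
      (fun x : α × Fin d => x.2 ≠ 0 ∧ (x.1 = a → x.2 = -x.2)), G x.1 x.2 :=
    (Finset.sum_subtype _ (by simp) fun x : α × Fin d => G x.1 x.2).symm
  rw [h, Finset.sum_filter, Fintype.sum_prod_type]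

/-- Since `a` is the minimum, it forms an ordered pair with the point y exactly when pos y lies
above the image b of `a`, and b forms one, as the smaller point, exactly with the y above b. The two
counts agree, and for b = a they are the same row, counted once. -/
theorem orderedPairs_extend [Fintype α] [LinearOrder α] (a : α) (ha : ∀ t, a ≤ t)
    (x : Choice d a) (P : Pattern d (Rest a x.1.1)) :
    (extend a x P).orderedPairs = (if x.1.1 = a then 1 else 2) *
      (∑ t : α, if x.1.1 < t then 1 else 0) + P.orderedPairs := by
  set Q := extend a x P with hQ
  have hlt : ∀ t, a < t ↔ t ≠ a := fun t => ⟨fun h => h.ne', fun h => (ha t).lt_of_ne' h⟩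
  have hnot : ∀ t, ¬t < a := fun t => (ha t).not_gt
  have hpa : Q.pos a = x.1.1 := extend_pos_left a x P
  have hpb : Q.pos x.1.1 = a := extend_pos_right a x P
  have row_a : (∑ y, if a < y ∧ Q.pos a < Q.pos y then 1 else 0) =
      ∑ t : α, if x.1.1 < t then 1 else 0 := by
    rw [← Q.sum_pos fun t => if x.1.1 < t then 1 else 0]
    refine Finset.sum_congr rfl fun y _ => if_congr ?_ rfl rfl
    rw [hpa, hlt, and_iff_right_iff_imp]
    rintro h rfl
    rw [hpa] at h
    exact lt_irrefl _ h
  have row_b : (∑ y, if x.1.1 < y ∧ Q.pos x.1.1 < Q.pos y then 1 else 0) =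
      ∑ t : α, if x.1.1 < t then 1 else 0 := by
    refine Finset.sum_congr rfl fun y _ => if_congr ?_ rfl rfl
    rw [hpb, hlt, and_iff_left_iff_imp]
    intro h h2
    rw [← hpb, Q.pos_injective.eq_iff] at h2
    exact h.ne' h2
  have row_rest : ∀ i : Rest a x.1.1, (∑ y, if i.1 < y ∧ Q.pos i.1 < Q.pos y then 1 else 0) =
      ∑ j : Rest a x.1.1, if i < j ∧ P.pos i < P.pos j then 1 else 0 := by
    intro i
    rw [sum_eq_add_sum_rest a x.1.1, if_neg (fun h => hnot _ h.1), hpb,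
      if_neg (c := _ ∧ Q.pos i.1 < a) (fun h => hnot _ h.2), ite_self, zero_add, zero_add]
    refine Finset.sum_congr rfl fun j _ => if_congr ?_ rfl rfl
    rw [hQ, extend_pos_rest, extend_pos_rest, Subtype.coe_lt_coe, Subtype.coe_lt_coe]
  rw [orderedPairs, sum_eq_add_sum_rest a x.1.1, row_a, row_b, Finset.sum_congr rfl fun i _ =>
    row_rest i, orderedPairs]
  congr 1
  split_ifs <;> ring

/-- Let b be the partner position of `a`. New contributions come from points i of shift 1 with pos i
< b, and from points i of shift 1 with i < b. Replacing i by its partner turns the first kind into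
the points of shift 2 below b, so together every point below b is counted once. -/
theorem crossThird_extend_one [Fintype α] [LinearOrder α] (a : α) (ha : ∀ t, t ≤ a)
    (x : Choice 3 a) (hx : x.1.2 = 1) (P : Pattern 3 (Rest a x.1.1)) :
    (extend a x P).crossThird = (∑ t : α, if t < x.1.1 then 1 else 0) + P.crossThird := by
  set Q := extend a x P with hQ
  have hlt : ∀ t, t < a ↔ t ≠ a := fun t => ⟨fun h => h.ne, fun h => (ha t).lt_of_ne h⟩
  have hnot : ∀ t, ¬a < t := fun t => (ha t).not_gt
  have hne : x.1.1 ≠ a := fun h => by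
    have := x.2.2 h
    rw [hx] at this
    exact absurd this (by decide)
  have hpa : Q.pos a = x.1.1 := extend_pos_left a x P
  have hsa : Q.shift a = 1 := (extend_shift_left a x P).trans hx
  have hsb : Q.shift x.1.1 = 2 := by
    rw [hQ, extend_shift_right, hx]; decide
  have row_a : (∑ y, ((if Q.shift a = 1 ∧ Q.shift y = 1 ∧ a < y ∧ Q.pos a < Q.pos y then 1 else 0) +
      if Q.shift a = 1 ∧ Q.shift y = 2 ∧ a < y then 1 else 0)) = 0 := by
    simp [hnot]
  have row_b : (∑ y, ((if Q.shift x.1.1 = 1 ∧ Q.shift y = 1 ∧ x.1.1 < y ∧ Q.pos x.1.1 < Q.pos y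
      then 1 else 0) + if Q.shift x.1.1 = 1 ∧ Q.shift y = 2 ∧ x.1.1 < y then 1 else 0)) = 0 := by
    simp [hsb]
  have row_rest : ∀ i : Rest a x.1.1, (∑ y, ((if Q.shift i.1 = 1 ∧ Q.shift y = 1 ∧ i.1 < y ∧
      Q.pos i.1 < Q.pos y then 1 else 0) +
      if Q.shift i.1 = 1 ∧ Q.shift y = 2 ∧ i.1 < y then 1 else 0)) =
      ((if P.shift i = 1 ∧ (P.pos i).1 < x.1.1 then 1 else 0) +
        if P.shift i = 1 ∧ i.1 < x.1.1 then 1 else 0) +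
      ∑ j, ((if P.shift i = 1 ∧ P.shift j = 1 ∧ i < j ∧ P.pos i < P.pos j then 1 else 0) +
        if P.shift i = 1 ∧ P.shift j = 2 ∧ i < j then 1 else 0) := by
    intro i
    rw [sum_eq_add_sum_rest a x.1.1, if_neg hne, hsa, hsb, hpa]
    congr 1
    · rw [hQ, extend_shift_rest, extend_pos_rest]
      simp [(hlt i.1).mpr i.2.1]
    · refine Finset.sum_congr rfl fun j _ => ?_
      rw [hQ, extend_pos_rest, extend_pos_rest, extend_shift_rest, extend_shift_rest]
      simp only [Subtype.coe_lt_coe]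
  have below : (∑ t : α, if t < x.1.1 then 1 else 0) = ∑ i : Rest a x.1.1,
      ((if P.shift i = 1 ∧ (P.pos i).1 < x.1.1 then 1 else 0) +
        if P.shift i = 1 ∧ i.1 < x.1.1 then 1 else 0) := by
    rw [sum_eq_add_sum_rest a x.1.1, if_neg (hnot _), if_neg (lt_irrefl _), ite_self, zero_add,
      zero_add, Finset.sum_add_distrib, ← P.sum_pos fun i =>
        if P.shift i = 1 ∧ (P.pos i).1 < x.1.1 then 1 else 0, ← Finset.sum_add_distrib]
    refine Finset.sum_congr rfl fun i _ => ?_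
    rw [P.pos_pos, P.shift_pos]
    have := P.shift_ne i
    by_cases h : i.1 < x.1.1 <;> simp only [h] <;> generalize P.shift i = s at this ⊢ <;>
      revert s <;> decide
  rw [crossThird, sum_eq_add_sum_rest a x.1.1, row_a, row_b, ite_self, zero_add, zero_add,
    Finset.sum_congr rfl fun i _ => row_rest i, Finset.sum_add_distrib, ← below, crossThird]

/-- If the maximum has shift 2, every point of shift 1 contributes a pair with it. Each edge has
exactly one end of shift 1, so a second edge makes the value at least 2. -/
theorem crossThird_extend_two [Fintype α] [LinearOrder α] (a : α) (ha : ∀ t, t ≤ a)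
    (x : Choice 3 a) (hx : x.1.2 = 2) (P : Pattern 3 (Rest a x.1.1)) :
    0 < (extend a x P).crossThird ∧
      ((extend a x P).crossThird = 1 ↔ IsEmpty (Rest a x.1.1)) := by
  set Q := extend a x P with hQ
  have hlt : ∀ t, t < a ↔ t ≠ a := fun t => ⟨fun h => h.ne, fun h => (ha t).lt_of_ne h⟩
  have hnot : ∀ t, ¬a < t := fun t => (ha t).not_gt
  have hne : x.1.1 ≠ a := fun h => by
    have := x.2.2 h
    rw [hx] at this
    exact absurd this (by decide)
  have hsa : Q.shift a = 2 := (extend_shift_left a x P).trans hx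
  have hsb : Q.shift x.1.1 = 1 := by
    rw [hQ, extend_shift_right, hx]; decide
  have hge : ∀ i, Q.shift i = 1 → 1 ≤ ∑ y, ((if Q.shift i = 1 ∧ Q.shift y = 1 ∧ i < y ∧
      Q.pos i < Q.pos y then 1 else 0) + if Q.shift i = 1 ∧ Q.shift y = 2 ∧ i < y then 1 else 0) := by
    intro i hi
    refine le_trans ?_ (Finset.single_le_sum (fun _ _ => Nat.zero_le _) (Finset.mem_univ a))
    have : i < a := (hlt i).mpr fun h => by
      rw [h, hsa] at hi
      exact absurd hi (by decide)
    simp [hi, hsa, this]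
  have hb := hge _ hsb
  have hsum : Q.crossThird = _ := sum_eq_add_sum_rest a x.1.1 _
  rw [if_neg hne] at hsum
  refine ⟨by omega, fun h1 => ⟨fun i => ?_⟩, fun hemp => ?_⟩
  · have h0 : ∀ j : Rest a x.1.1, Q.shift j.1 ≠ 1 := by
      intro j hj
      have h2 := hge _ hj
      have h3 := Finset.single_le_sum (f := fun j : Rest a x.1.1 => ∑ y, ((if Q.shift j.1 = 1 ∧
        Q.shift y = 1 ∧ j.1 < y ∧ Q.pos j.1 < Q.pos y then 1 else 0) +
        if Q.shift j.1 = 1 ∧ Q.shift y = 2 ∧ j.1 < y then 1 else 0))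
        (fun _ _ => Nat.zero_le _) (Finset.mem_univ j)
      omega
    have h2 := h0 i
    have h3 := h0 (P.pos i)
    rw [hQ, extend_shift_rest] at h2 h3
    rw [P.shift_pos] at h3
    have h4 := P.shift_ne i
    revert h2 h3 h4
    generalize P.shift i = s
    revert s
    decide
  · rw [hsum]
    simp only [sum_eq_add_sum_rest a x.1.1, Finset.univ_eq_empty, Finset.sum_empty, add_zero]
    simp [hsa, hsb, hne, hnot, (hlt x.1.1).mpr hne]

/-- Shifts carry no information for two arcs, since 1 is the only nonzero one and 1 = -1. Removing
the edge at the minimum reproduces the recursion of `involCount`; the order α varies because the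
induction passes to the remaining points. -/
theorem card_orderedPairs_eq (n k : ℕ) : ∀ {α : Type} [Fintype α] [LinearOrder α],
    Fintype.card α = n →
      (∑ P : Pattern 2 α, if P.orderedPairs = k then 1 else 0) = involCount n k := by
  induction n using Nat.strong_induction_on generalizing k with
  | _ n ih =>
  intro α _ _ hn
  rcases isEmpty_or_nonempty α with hα | hα
  · have : Unique (Pattern 2 α) := ⟨⟨⟨id, hα.elim, hα.elim, hα.elim, hα.elim⟩⟩, fun P => by
      ext i <;> exact hα.elim i⟩
    obtain rfl : n = 0 := by rw [← hn, Fintype.card_eq_zero]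
    rw [Fintype.sum_unique]
    simp [orderedPairs, involCount, eq_comm]
  · obtain ⟨a, ha⟩ := Finite.exists_min (id : α → α)
    simp only [id] at ha
    obtain ⟨m, rfl⟩ : ∃ m, n = m + 1 := ⟨n - 1, by have := Fintype.card_pos (α := α); omega⟩
    have habove : (∑ t : α, if a < t then 1 else 0) = m := by
      rw [Finset.sum_boole, Nat.cast_id]
      have : Finset.univ.filter (a < ·) = Finset.univ.erase a := by
        ext t; simpa using ⟨fun h => h.ne', fun h => (ha t).lt_of_ne' h⟩
      rw [this, Finset.card_erase_of_mem (Finset.mem_univ _), Finset.card_univ, hn,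
        Nat.add_sub_cancel]
    let val : ℕ → ℕ := fun l => if 2 * l ≤ k then involCount (m - 1) (k - 2 * l) else 0
    have hin : ∀ x : Choice 2 a, (∑ P : Pattern 2 (Rest a x.1.1),
        if (extend a x P).orderedPairs = k then 1 else 0) =
        if x.1.1 = a then (if m ≤ k then involCount m (k - m) else 0)
        else val (∑ t : α, if x.1.1 < t then 1 else 0) := by
      intro x
      have hcard := card_rest a x.1.1
      have hsub : ∀ u, (∑ P : Pattern 2 (Rest a x.1.1), if u + P.orderedPairs = k then 1 else 0) =
          if u ≤ k then involCount (Fintype.card (Rest a x.1.1)) (k - u) else 0 := by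
        intro u
        split_ifs with hu
        · rw [← ih (Fintype.card (Rest a x.1.1)) (by omega) (k - u) rfl]
          refine Finset.sum_congr rfl fun P _ => if_congr ?_ rfl rfl
          omega
        · exact Finset.sum_eq_zero fun P _ => if_neg (by omega)
      simp only [orderedPairs_extend a ha, hsub]
      by_cases hxa : x.1.1 = a
      · rw [if_pos hxa] at hcard
        rw [if_pos hxa, if_pos hxa, show Fintype.card (Rest a x.1.1) = m by omega, hxa, habove,
          one_mul]
      · rw [if_neg hxa] at hcard
        rw [if_neg hxa, if_neg hxa, show Fintype.card (Rest a x.1.1) = m - 1 by omega]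
    rw [sum_extend a, Finset.sum_congr rfl fun x _ => hin x, sum_choice a fun b _ =>
      if b = a then (if m ≤ k then involCount m (k - m) else 0)
        else val (∑ t : α, if b < t then 1 else 0), involCount_succ]
    have hone : ∀ b : α, (∑ c : Fin 2, if c ≠ 0 ∧ (b = a → c = -c) then
        (if b = a then (if m ≤ k then involCount m (k - m) else 0)
        else val (∑ t : α, if b < t then 1 else 0)) else 0) =
        if b = a then (if m ≤ k then involCount m (k - m) else 0)
        else val (∑ t : α, if b < t then 1 else 0) := by
      intro b
      have : (1 : Fin 2) = -1 := by decide
      rw [Fin.sum_univ_two]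
      simp [← this]
    simp only [hone]
    -- The points other than the minimum have the ranks 0, …, m - 1 from above; the rank m of the
    -- minimum itself is split off.
    have htot := sum_comp_card_above (α := α) val
    rw [hn, Finset.sum_range_succ, ← Finset.add_sum_erase _ _ (Finset.mem_univ a), habove,
      add_comm, Nat.add_right_cancel_iff] at htot
    rw [← Finset.add_sum_erase _ _ (Finset.mem_univ a), if_pos rfl, ← htot]
    congr 1
    refine Finset.sum_congr rfl fun b hb => if_neg (Finset.ne_of_mem_erase hb)

/-- Remove the edge at the maximum. With shift 1 and partner of rank l from below it contributes l,
so only l = 0 and l = 1 matter. Shift 2 always contributes, and yields the value 1 only for a single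
edge. -/
theorem card_crossThird_eq (n : ℕ) : ∀ {α : Type} [Fintype α] [LinearOrder α],
    Fintype.card α = n →
      (∑ P : Pattern 3 α, if P.crossThird = 0 then 1 else 0) = (if Even n then 1 else 0) ∧
      (∑ P : Pattern 3 α, if P.crossThird = 1 then 1 else 0) = (if Even n then n / 2 else 0) := by
  induction n using Nat.strong_induction_on with
  | _ n ih =>
  intro α _ _ hn
  rcases isEmpty_or_nonempty α with hα | hα
  · have : Unique (Pattern 3 α) := ⟨⟨⟨id, hα.elim, hα.elim, hα.elim, hα.elim⟩⟩, fun P => by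
      ext i <;> exact hα.elim i⟩
    obtain rfl : n = 0 := by rw [← hn, Fintype.card_eq_zero]
    rw [Fintype.sum_unique, Fintype.sum_unique]
    simp [crossThird]
  · obtain ⟨a, ha⟩ := Finite.exists_max (id : α → α)
    simp only [id] at ha
    obtain ⟨m, rfl⟩ : ∃ m, n = m + 1 := ⟨n - 1, by have := Fintype.card_pos (α := α); omega⟩
    have hbelow : (∑ t : α, if t < a then 1 else 0) = m := by
      rw [Finset.sum_boole, Nat.cast_id]
      have : Finset.univ.filter (· < a) = Finset.univ.erase a := by
        ext t; simpa using ⟨fun h => h.ne, fun h => (ha t).lt_of_ne h⟩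
      rw [this, Finset.card_erase_of_mem (Finset.mem_univ _), Finset.card_univ, hn,
        Nat.add_sub_cancel]
    have hne : ∀ x : Choice 3 a, x.1.1 ≠ a ∧ Fintype.card (Rest a x.1.1) + 1 = m := by
      intro x
      have hxa : x.1.1 ≠ a := fun h => by
        have h1 := x.2.2 h
        have h2 := x.2.1
        revert h1 h2
        generalize x.1.2 = c
        revert c
        decide
      have := card_rest a x.1.1
      rw [if_neg hxa] at this
      exact ⟨hxa, by omega⟩
    -- The m possible partners have the ranks 0, …, m - 1 from below; `val` is the contribution with
    -- shift 1 and `w` the constant contribution with shift 2. The point `a` cannot be its own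
    -- partner, since no nonzero element of ℤ/3 equals its negative.
    have htot : ∀ (K w : ℕ) (val : ℕ → ℕ), (∀ x : Choice 3 a, (∑ P : Pattern 3 (Rest a x.1.1),
        if (extend a x P).crossThird = K then 1 else 0) =
        if x.1.2 = 1 then val (∑ t : α, if t < x.1.1 then 1 else 0) else w) →
        (∑ P : Pattern 3 α, if P.crossThird = K then 1 else 0) =
          (∑ l ∈ Finset.range m, val l) + m * w := by
      intro K w val hval
      rw [sum_extend a, Finset.sum_congr rfl fun x _ => hval x, sum_choice a fun b c =>
        if c = 1 then val (∑ t : α, if t < b then 1 else 0) else w]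
      have hone : ∀ b : α, (∑ c : Fin 3, if c ≠ 0 ∧ (b = a → c = -c) then
          (if c = 1 then val (∑ t : α, if t < b then 1 else 0) else w) else 0) =
          if b = a then 0 else val (∑ t : α, if t < b then 1 else 0) + w := by
        intro b
        have h1 : ¬(1 : Fin 3) = -1 := by decide
        have h2 : ¬(2 : Fin 3) = -2 := by decide
        rw [Fin.sum_univ_three]
        by_cases hb : b = a <;> simp [h1, h2, hb]
      simp only [hone]
      have hs := sum_comp_card_below (α := α) val
      rw [hn, Finset.sum_range_succ, ← Finset.add_sum_erase _ _ (Finset.mem_univ a), hbelow,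
        add_comm, Nat.add_right_cancel_iff] at hs
      rw [← Finset.add_sum_erase _ _ (Finset.mem_univ a), if_pos rfl, ← hs, zero_add,
        Finset.sum_congr rfl fun b hb => if_neg (Finset.ne_of_mem_erase hb),
        Finset.sum_add_distrib, Finset.sum_const, Finset.card_erase_of_mem (Finset.mem_univ _),
        Finset.card_univ, hn, Nat.add_sub_cancel, smul_eq_mul]
    have hshift : ∀ x : Choice 3 a, x.1.2 ≠ 1 → x.1.2 = 2 := fun x h => by
      have h1 := x.2.1
      revert h h1
      generalize x.1.2 = c
      revert c
      decide
    constructor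
    · rw [htot 0 0 fun l => if l = 0 then (if Even (m - 1) then 1 else 0) else 0]
      · match m with
        | 0 => simp
        | 1 => simp
        | m + 2 => simp [parity_simps]
      · intro x
        have hr := (hne x).2
        have e0 := (ih (Fintype.card (Rest a x.1.1)) (by omega) (α := Rest a x.1.1) rfl).1
        have hr' : Fintype.card (Rest a x.1.1) = m - 1 := by omega
        rw [hr'] at e0
        by_cases hx : x.1.2 = 1
        · rw [if_pos hx]
          simp only [crossThird_extend_one a ha x hx]
          generalize (∑ t : α, if t < x.1.1 then 1 else 0) = u
          match u with
          | 0 => simpa using e0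
          | u + 1 =>
            rw [if_neg (by omega)]
            exact Finset.sum_eq_zero fun P _ => if_neg (by omega)
        · rw [if_neg hx]
          refine Finset.sum_eq_zero fun P _ => if_neg ?_
          exact (crossThird_extend_two a ha x (hshift x hx) P).1.ne'
    -- Value 1 arises from l = 0 with remainder 1, from l = 1 with remainder 0, or from shift 2 when
    -- only one edge is present (m = 1).
    · rw [htot 1 (if m = 1 then 1 else 0) fun l => if l = 0 then
        (if Even (m - 1) then (m - 1) / 2 else 0) else if l = 1 then
        (if Even (m - 1) then 1 else 0) else 0]
      · match m with
        | 0 => simp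
        | 1 => simp
        | m + 2 =>
          rw [Finset.sum_range_succ', Finset.sum_range_succ']
          simp [parity_simps]
          split_ifs <;> omega
      · intro x
        have hr := (hne x).2
        obtain ⟨e0, e1⟩ := ih (Fintype.card (Rest a x.1.1)) (by omega) (α := Rest a x.1.1) rfl
        have hr' : Fintype.card (Rest a x.1.1) = m - 1 := by omega
        rw [hr'] at e0 e1
        by_cases hx : x.1.2 = 1
        · rw [if_pos hx]
          simp only [crossThird_extend_one a ha x hx]
          generalize (∑ t : α, if t < x.1.1 then 1 else 0) = u
          match u with
          | 0 => simpa using e1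
          | 1 => simpa using e0
          | u + 2 =>
            rw [if_neg (by omega), if_neg (by omega)]
            exact Finset.sum_eq_zero fun P _ => if_neg (by omega)
        · rw [if_neg hx]
          have h2 := fun P => (crossThird_extend_two a ha x (hshift x hx) P).2
          by_cases hm : m = 1
          · have hemp : IsEmpty (Rest a x.1.1) := Fintype.card_eq_zero_iff.mp (by omega)
            rw [hm, if_pos (by simp)] at e0
            rw [if_pos hm]
            refine Eq.trans ?_ e0
            refine Finset.sum_congr rfl fun P _ => ?_
            rw [if_pos ((h2 P).mpr hemp), if_pos (by simp [crossThird])]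
          · rw [if_neg hm]
            refine Finset.sum_eq_zero fun P _ => if_neg fun hc => ?_
            have := Fintype.card_eq_zero_iff.mpr ((h2 P).mp hc)
            omega

end Pattern

/-! ### Values for at most three crossings, and summation over the number of free points -/

theorem involCount_closed (n : ℕ) :
    involCount n 0 = 1 ∧
    involCount n 1 = (if Even n ∧ 2 ≤ n then 1 else 0) ∧
    involCount n 2 = (if Even n then n / 2 - 1 else if 3 ≤ n then n / 2 + 1 else 0) ∧
    involCount n 3 = (if Even n then (if 4 ≤ n then n / 2 else 0) else if 3 ≤ n then 1 else 0) := by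
  induction n using Nat.strong_induction_on with
  | _ n ih =>
  match n with
  | 0 => simp [involCount]
  | 1 => simp [involCount]
  | 2 => simp [involCount]
  | 3 => simp [involCount, Finset.sum_range_succ, parity_simps]
  | 4 => simp [involCount, Finset.sum_range_succ, parity_simps]
  | n + 5 =>
    obtain ⟨h0, h1, h2, h3⟩ := ih (n + 3) (by omega)
    -- For k ≤ 3 only an image of rank 0 or 1 from above is affordable: fixing the first point costs
    -- n + 4, and rank l costs 2l. The recursion then has step two, which is why parity governs the
    -- closed forms.
    have key : ∀ k ≤ 3, involCount (n + 5) k =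
        involCount (n + 3) k + if 2 ≤ k then involCount (n + 3) (k - 2) else 0 := by
      intro k hk
      rw [involCount, if_neg (by omega), zero_add, Finset.sum_range_succ', Finset.sum_range_succ',
        Finset.sum_eq_zero fun l _ => if_neg (by omega)]
      simp [add_comm]
    rw [key 0 (by norm_num), key 1 (by norm_num), key 2 (by norm_num), key 3 (by norm_num)]
    simp only [h0, h1, h2, h3]
    have hp : Even (n + 5) ↔ Even (n + 3) := by simp [parity_simps]
    simp only [hp]
    by_cases he : Even (n + 3)
    · have hr := Nat.two_mul_div_two_of_even he
      simp only [he, true_and, if_true]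
      refine ⟨?_, ?_, ?_, ?_⟩ <;> split_ifs <;> omega
    · simp only [he, false_and, if_false]
      refine ⟨?_, ?_, ?_, ?_⟩ <;> split_ifs <;> omega

theorem freeCard_le {N : ℕ} (f : Invol (Fin N)) : freeCard f ≤ N := by
  rw [freeCard_eq]
  simpa using Fintype.card_subtype_le fun i : Fin N => f.1 i = i

/-- Groups partial matchings by the number m of their edges; the number of free points is then N -
2m, and all other values contribute nothing. -/
theorem sum_crossCard_eq (N k : ℕ) (w : ℕ → ℕ) :
    (∑ f : Invol (Fin N), if crossCard f = k then w (freeCard f) else 0) =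
      ∑ m ∈ Finset.range (N / 2 + 1), pmCount N (N - 2 * m) k * w (N - 2 * m) := by
  have h1 : ∀ f : Invol (Fin N), (if crossCard f = k then w (freeCard f) else 0) =
      ∑ h ∈ Finset.range (N + 1), (if freeCard f = h ∧ crossCard f = k then 1 else 0) * w h := by
    intro f
    rw [Finset.sum_eq_single (freeCard f)]
    · simp
    · intro h _ hh
      simp [Ne.symm hh]
    · intro h
      exact absurd (Finset.mem_range.mpr (Nat.lt_succ_of_le (freeCard_le f))) h
  simp only [h1]
  rw [Finset.sum_comm]
  simp only [← Finset.sum_mul]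
  change ∑ h ∈ Finset.range (N + 1), pmCount N h k * w h = _
  symm
  refine Finset.sum_of_injOn (fun m => N - 2 * m) ?_ ?_ ?_ ?_
  · intro a ha b hb hab
    simp only [Finset.coe_range, Set.mem_Iio] at ha hb hab
    omega
  · intro a _
    simp only [Finset.coe_range, Set.mem_Iio]
    omega
  · intro h hh hm
    rw [pmCount_eq_zero, zero_mul]
    intro m hN
    apply hm
    refine ⟨m, ?_, ?_⟩
    · simp only [Finset.coe_range, Set.mem_Iio]; omega
    · dsimp only; omega
  · intro _ _; rfl

theorem sum_ballot (N J : ℕ) : ∑ m ∈ Finset.range J, ballot N m = binom N (J - 1) := by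
  induction J with
  | zero => simp [binom_of_neg]
  | succ J ih => rw [Finset.sum_range_succ, ih, ballot]; push_cast; ring_nf

theorem sum_ballot_sub_one (N J : ℕ) :
    ∑ m ∈ Finset.range J, ballot N (m - 1) = binom N (J - 2) := by
  induction J with
  | zero => simp [binom_of_neg]
  | succ J ih => rw [Finset.sum_range_succ, ih, ballot]; push_cast; ring_nf

theorem binom_mul_sub (N : ℕ) (i : ℤ) :
    (binom N i : ℚ) * (N - i) = binom N (i + 1) * (i + 1) := by
  rcases lt_trichotomy i (-1) with hi | rfl | hi
  · rw [binom_of_neg _ (by omega), binom_of_neg _ (by omega)]; simp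
  · rw [binom_of_neg _ (by omega)]; simp
  · obtain ⟨j, rfl⟩ := Int.eq_ofNat_of_zero_le (show 0 ≤ i by omega)
    rw [← Nat.cast_succ, binom_natCast, binom_natCast]
    rcases le_or_gt j N with h | h
    · have := Nat.choose_succ_right_eq N j
      have h2 : ((N.choose (j + 1) * (j + 1) : ℕ) : ℚ) = (N.choose j * (N - j) : ℕ) := by rw [this]
      push_cast [Nat.cast_sub h] at h2
      push_cast
      linarith
    · rw [Nat.choose_eq_zero_of_lt h, Nat.choose_eq_zero_of_lt (by omega)]; simp

theorem succ_mul_binom (N : ℕ) (i : ℤ) :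
    ((N : ℚ) + 1) * binom N i = binom (N + 1) (i + 1) * (i + 1) := by
  have h1 := binom_mul_sub N i
  rw [binom_succ, add_sub_cancel_right]
  push_cast
  linarith

/-! ### All matchings -/

/-- Complete matchings are the partial ones without free points, and then `crossCard` is the
ordinary number of crossings. -/
theorem card_crossings_eq (n k : ℕ) :
    Nat.card {τ : Matching n // crossings τ = k} = pmCount (2 * n) 0 k := by
  have hcr : ∀ f : Invol (Fin (2 * n)), ∀ hf : ∀ i, f.1 i ≠ i,
      crossCard f = crossings ⟨f.1, f.2, hf⟩ := by
    intro f hf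
    rw [crossings, crossingPairs, Finset.card_filter, ← Finset.univ_product_univ,
      Finset.sum_product, crossCard]
    simp [hf]
  have hfree : ∀ f : Invol (Fin (2 * n)), freeCard f = 0 ↔ ∀ i, f.1 i ≠ i := by
    intro f
    simp [freeCard]
  rw [pmCount, Finset.sum_boole, Nat.cast_id, ← Fintype.card_subtype, ← Nat.card_eq_fintype_card]
  refine Nat.card_congr ⟨fun τ => ⟨⟨τ.1.partner, τ.1.partner_partner⟩, ?_, ?_⟩,
    fun f => ⟨⟨f.1.1, f.1.2, (hfree _).mp f.2.1⟩, ?_⟩, fun _ => rfl, fun _ => rfl⟩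
  · exact (hfree _).mpr τ.1.partner_ne
  · exact (hcr _ τ.1.partner_ne).trans τ.2
  · exact (hcr _ _).symm.trans f.2.2

/-- The ballot formulas at h = 0 agree with the product formulas once all binomials are written as
rational multiples of the central one. -/
theorem card_crossings_few (n : ℕ) :
    (Nat.card {τ : Matching n // crossings τ = 1} : ℚ) = binom (2 * n) (n - 2) ∧
    (Nat.card {τ : Matching n // crossings τ = 2} : ℚ) = (n + 3) / 2 * binom (2 * n) (n - 3) ∧
    (Nat.card {τ : Matching n // crossings τ = 3} : ℚ) =
      (n + 5) * (n + 4) / 6 * binom (2 * n) (n - 4) + binom (2 * n) (n - 3) := by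
  simp only [card_crossings_eq]
  obtain ⟨-, h1, h2, h3⟩ := pmCount_formula (2 * n) n 0 rfl
  rw [if_neg (by norm_num)] at h2
  rw [if_neg (by norm_num), if_neg (by norm_num)] at h3
  have e0 := binom_mul_sub (2 * n) (n - 1)
  have e1 := binom_mul_sub (2 * n) (n - 2)
  have e2 := binom_mul_sub (2 * n) (n - 3)
  have e3 := binom_mul_sub (2 * n) (n - 4)
  rw [h1, h2, h3]
  simp only [ballot]
  have i1 : (n : ℤ) - 1 + 1 = n := by ring
  have i2 : (n : ℤ) - 2 + 1 = n - 1 := by ring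
  have i3 : (n : ℤ) - 3 + 1 = n - 2 := by ring
  have i4 : (n : ℤ) - 4 + 1 = n - 3 := by ring
  have i5 : (n : ℤ) - 1 - 1 = n - 2 := by ring
  have i6 : (n : ℤ) - 2 - 1 = n - 3 := by ring
  simp only [i1, i2, i3, i4, i5, i6] at e0 e1 e2 e3 ⊢
  push_cast at e0 e1 e2 e3
  generalize (binom (2 * n) n : ℚ) = b0 at *
  generalize (binom (2 * n) (n - 1) : ℚ) = b1 at *
  generalize (binom (2 * n) (n - 2) : ℚ) = b2 at *
  generalize (binom (2 * n) (n - 3) : ℚ) = b3 at *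
  generalize (binom (2 * n) (n - 4) : ℚ) = b4 at *
  have n1 : (n : ℚ) + 1 ≠ 0 := by positivity
  have n2 : (n : ℚ) + 2 ≠ 0 := by positivity
  have n3 : (n : ℚ) + 3 ≠ 0 := by positivity
  have n4 : (n : ℚ) + 4 ≠ 0 := by positivity
  have f1 : b1 = b0 * n / (n + 1) := by field_simp; linarith
  have f2 : b2 = b1 * (n - 1) / (n + 2) := by field_simp; linarith
  have f3 : b3 = b2 * (n - 2) / (n + 3) := by field_simp; linarith
  have f4 : b4 = b3 * (n - 3) / (n + 4) := by field_simp; linarith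
  subst f1 f2 f3 f4
  refine ⟨?_, ?_, ?_⟩ <;> · field_simp; ring

/-! ### Matchings invariant under a half turn -/

/-- Two half circles of n points: an inner matching costs twice its crossings, and the rest must
come from ordered pairs of the involution on its free points. -/
theorem card_fixed_two (n k : ℕ) :
    Nat.card {τ : Matching n // crossings τ = k ∧ rotate^[n] τ = τ} =
      ∑ f : Invol (Fin n), if 2 * crossCard f ≤ k then
        involCount (freeCard f) (k - 2 * crossCard f) else 0 := by
  rw [← Nat.card_congr (PeriodicMatching.equivFixed (d := 2) (M := n) (n := n) rfl k),
    Nat.card_eq_fintype_card, Fintype.card_subtype, Finset.card_filter, PeriodicMatching.sum_join]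
  refine Finset.sum_congr rfl fun f _ => ?_
  simp only [PeriodicMatching.crossNum_two]
  split_ifs with h
  · rw [freeCard_eq, ← Pattern.card_orderedPairs_eq _ _ (α := Free f) rfl]
    refine Finset.sum_congr rfl fun P _ => if_congr ?_ rfl rfl
    omega
  · exact Finset.sum_eq_zero fun P _ => if_neg (by omega)

theorem card_fixed_two_one (n : ℕ) :
    Nat.card {τ : Matching n // crossings τ = 1 ∧ rotate^[n] τ = τ} =
      ∑ m ∈ Finset.range (n / 2 + 1), pmCount n (n - 2 * m) 0 * involCount (n - 2 * m) 1 := by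
  rw [card_fixed_two, ← sum_crossCard_eq n 0 fun h => involCount h 1]
  refine Finset.sum_congr rfl fun f _ => ?_
  generalize crossCard f = c
  match c with
  | 0 => simp
  | c + 1 => rw [if_neg (by omega), if_neg (by omega)]

/-- Either the inner matching is noncrossing and the involution has two ordered pairs, or it has one
crossing and the involution is the order reversal, the only one without ordered pairs. -/
theorem card_fixed_two_two (n : ℕ) :
    Nat.card {τ : Matching n // crossings τ = 2 ∧ rotate^[n] τ = τ} =
      ∑ m ∈ Finset.range (n / 2 + 1), (pmCount n (n - 2 * m) 0 * involCount (n - 2 * m) 2 +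
        pmCount n (n - 2 * m) 1) := by
  have h1 := sum_crossCard_eq n 1 fun _ => 1
  simp only [mul_one] at h1
  rw [card_fixed_two, Finset.sum_add_distrib, ← h1, ← sum_crossCard_eq n 0 fun h => involCount h 2,
    ← Finset.sum_add_distrib]
  refine Finset.sum_congr rfl fun f _ => ?_
  generalize crossCard f = c
  match c with
  | 0 => simp
  | 1 => simp [(involCount_closed _).1]
  | c + 2 => rw [if_neg (by omega), if_neg (by omega), if_neg (by omega)]

theorem card_fixed_two_three (n : ℕ) :
    Nat.card {τ : Matching n // crossings τ = 3 ∧ rotate^[n] τ = τ} =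
      ∑ m ∈ Finset.range (n / 2 + 1), (pmCount n (n - 2 * m) 0 * involCount (n - 2 * m) 3 +
        pmCount n (n - 2 * m) 1 * involCount (n - 2 * m) 1) := by
  rw [card_fixed_two, Finset.sum_add_distrib, ← sum_crossCard_eq n 1 fun h => involCount h 1,
    ← sum_crossCard_eq n 0 fun h => involCount h 3, ← Finset.sum_add_distrib]
  refine Finset.sum_congr rfl fun f _ => ?_
  generalize crossCard f = c
  match c with
  | 0 => simp
  | 1 => simp
  | c + 2 => rw [if_neg (by omega), if_neg (by omega), if_neg (by omega)]

/-- With the closed forms of `involCount` the summands become a constant times ballot(2q, m) minus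
ballot(2q, m-1), and the sums telescope. The terms with few free points deviate from the general
form and are separated. -/
theorem card_fixed_two_even (q : ℕ) :
    Nat.card {τ : Matching (2 * q) // crossings τ = 1 ∧ rotate^[2 * q] τ = τ} =
      binom (2 * q) (q - 1) ∧
    (Nat.card {τ : Matching (2 * q) // crossings τ = 2 ∧ rotate^[2 * q] τ = τ} : ℚ) =
      q * binom (2 * q) q - 2 * binom (2 * q) (q - 1) ∧
    (0 < q → (Nat.card {τ : Matching (2 * q) // crossings τ = 3 ∧ rotate^[2 * q] τ = τ} : ℚ) =
      (q - 1) * binom (2 * q) (q - 1)) := by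
  have hpm : ∀ m < q + 1, (pmCount (2 * q) (2 * q - 2 * m) 0 : ℚ) = ballot (2 * q) m ∧
      (pmCount (2 * q) (2 * q - 2 * m) 1 : ℚ) =
        m * ballot (2 * q) m - ballot (2 * q) (m - 1) := by
    intro m hm
    obtain ⟨h0, h1, -⟩ := pmCount_formula (2 * q) m (2 * q - 2 * m) (by omega)
    exact ⟨h0, h1⟩
  have hev : ∀ m, Even (2 * q - 2 * m) := fun m => by
    rw [← Nat.mul_sub]; exact even_two_mul _
  rw [card_fixed_two_one, card_fixed_two_two, card_fixed_two_three,
    Nat.mul_div_cancel_left _ two_pos]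
  have hq : ballot (2 * q) q = binom (2 * q) q - binom (2 * q) (q - 1) := rfl
  have hq1 : ballot (2 * q) (q - 1) = binom (2 * q) (q - 1) - binom (2 * q) (q - 2) := by
    rw [ballot, show (q : ℤ) - 1 - 1 = q - 2 by ring]
  refine ⟨?_, ?_, ?_⟩
  · have h2 : ∑ m ∈ Finset.range q, ballot (2 * q) m = _ := sum_ballot (2 * q) q
    rw [← Nat.cast_inj (R := ℚ), ← h2, Finset.sum_range_succ, Nat.sub_self]
    push_cast
    rw [show involCount 0 1 = 0 from rfl, Nat.cast_zero, mul_zero, add_zero]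
    refine Finset.sum_congr rfl fun m hm => ?_
    rw [Finset.mem_range] at hm
    rw [(hpm m (by omega)).1, (involCount_closed _).2.1, if_pos ⟨hev m, by omega⟩]
    simp
  · rw [Finset.sum_range_succ, Nat.sub_self]
    push_cast
    have hz := hpm q (by omega)
    rw [Nat.sub_self] at hz
    rw [show involCount 0 2 = 0 from rfl, hz.2, Nat.cast_zero, mul_zero, zero_add]
    have : ∀ m ∈ Finset.range q, ((pmCount (2 * q) (2 * q - 2 * m) 0 : ℚ) *
        involCount (2 * q - 2 * m) 2 + pmCount (2 * q) (2 * q - 2 * m) 1) =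
        (q - 1) * ballot (2 * q) m - ballot (2 * q) (m - 1) := by
      intro m hm
      rw [Finset.mem_range] at hm
      rw [(hpm m (by omega)).1, (hpm m (by omega)).2, (involCount_closed _).2.2.1, if_pos (hev m),
        show (2 * q - 2 * m) / 2 - 1 = q - (m + 1) by omega, Nat.cast_sub hm]
      push_cast
      ring
    rw [Finset.sum_congr rfl this, Finset.sum_sub_distrib, ← Finset.mul_sum, sum_ballot,
      sum_ballot_sub_one, hq, hq1]
    ring
  · intro hpos
    obtain ⟨r, rfl⟩ : ∃ r, q = r + 1 := ⟨q - 1, by omega⟩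
    -- Two terms are split off: with no free point nothing is contributed, and with two free points
    -- there is no involution with three ordered pairs, contrary to the general value h/2.
    rw [Finset.sum_range_succ, Nat.sub_self, Finset.sum_range_succ,
      show 2 * (r + 1) - 2 * r = 2 by omega]
    have hz := hpm r (by omega)
    rw [show 2 * (r + 1) - 2 * r = 2 by omega] at hz
    have : ∀ m ∈ Finset.range r, ((pmCount (2 * (r + 1)) (2 * (r + 1) - 2 * m) 0 : ℚ) *
        involCount (2 * (r + 1) - 2 * m) 3 +
        pmCount (2 * (r + 1)) (2 * (r + 1) - 2 * m) 1 * involCount (2 * (r + 1) - 2 * m) 1) =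
        (r + 1) * ballot (2 * (r + 1)) m - ballot (2 * (r + 1)) (m - 1) := by
      intro m hm
      rw [Finset.mem_range] at hm
      rw [(hpm m (by omega)).1, (hpm m (by omega)).2, (involCount_closed _).2.2.2,
        (involCount_closed _).2.1, if_pos (hev m), if_pos (by omega), if_pos ⟨hev m, by omega⟩,
        show (2 * (r + 1) - 2 * m) / 2 = r + 1 - m by omega, Nat.cast_sub (by omega)]
      push_cast
      ring
    push_cast
    rw [Finset.sum_congr rfl this, Finset.sum_sub_distrib, ← Finset.mul_sum, sum_ballot,
      sum_ballot_sub_one, hz.1, hz.2, show involCount 2 3 = 0 by decide,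
      show involCount 2 1 = 1 by decide, show involCount 0 3 = 0 by decide,
      show involCount 0 1 = 0 by decide]
    simp only [ballot]
    push_cast
    rw [show (r : ℤ) + 1 - 1 = r by ring, show (r : ℤ) - 1 - 1 = r - 2 by ring]
    ring

theorem card_fixed_two_odd (q : ℕ) :
    Nat.card {τ : Matching (2 * q + 1) // crossings τ = 1 ∧ rotate^[2 * q + 1] τ = τ} = 0 ∧
    (Nat.card {τ : Matching (2 * q + 1) // crossings τ = 2 ∧ rotate^[2 * q + 1] τ = τ} : ℚ) =
      q * binom (2 * q + 1) q ∧
    Nat.card {τ : Matching (2 * q + 1) // crossings τ = 3 ∧ rotate^[2 * q + 1] τ = τ} =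
      binom (2 * q + 1) (q - 1) := by
  have hpm : ∀ m < q + 1, (pmCount (2 * q + 1) (2 * q + 1 - 2 * m) 0 : ℚ) =
      ballot (2 * q + 1) m ∧ (pmCount (2 * q + 1) (2 * q + 1 - 2 * m) 1 : ℚ) =
        m * ballot (2 * q + 1) m - ballot (2 * q + 1) (m - 1) := by
    intro m hm
    obtain ⟨h0, h1, -⟩ := pmCount_formula (2 * q + 1) m (2 * q + 1 - 2 * m) (by omega)
    exact ⟨h0, h1⟩
  have hodd : ∀ m < q + 1, ¬Even (2 * q + 1 - 2 * m) := fun m hm => by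
    rw [Nat.not_even_iff_odd]; exact ⟨q - m, by omega⟩
  rw [card_fixed_two_one, card_fixed_two_two, card_fixed_two_three,
    show (2 * q + 1) / 2 = q by omega]
  refine ⟨?_, ?_, ?_⟩
  · refine Finset.sum_eq_zero fun m hm => ?_
    rw [Finset.mem_range] at hm
    rw [(involCount_closed _).2.1, if_neg (fun h => hodd m hm h.1), mul_zero]
  -- The case of one free point is separated, since it admits no involution with two ordered pairs.
  · rw [Finset.sum_range_succ, show 2 * q + 1 - 2 * q = 1 by omega]
    push_cast
    have hz := hpm q (by omega)
    rw [show 2 * q + 1 - 2 * q = 1 by omega] at hz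
    rw [show involCount 1 2 = 0 from rfl, hz.2, Nat.cast_zero, mul_zero, zero_add]
    have : ∀ m ∈ Finset.range q, ((pmCount (2 * q + 1) (2 * q + 1 - 2 * m) 0 : ℚ) *
        involCount (2 * q + 1 - 2 * m) 2 + pmCount (2 * q + 1) (2 * q + 1 - 2 * m) 1) =
        (q + 1) * ballot (2 * q + 1) m - ballot (2 * q + 1) (m - 1) := by
      intro m hm
      rw [Finset.mem_range] at hm
      rw [(hpm m (by omega)).1, (hpm m (by omega)).2, (involCount_closed _).2.2.1,
        if_neg (hodd m (by omega)), if_pos (by omega),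
        show (2 * q + 1 - 2 * m) / 2 + 1 = q + 1 - m by omega, Nat.cast_sub (by omega)]
      push_cast
      ring
    rw [Finset.sum_congr rfl this, Finset.sum_sub_distrib, ← Finset.mul_sum, sum_ballot,
      sum_ballot_sub_one]
    simp only [ballot]
    rw [show (q : ℤ) - 1 - 1 = q - 2 by ring]
    ring
  · have h2 : ∑ m ∈ Finset.range q, ballot (2 * q + 1) m = _ := sum_ballot (2 * q + 1) q
    rw [← Nat.cast_inj (R := ℚ), ← h2, Finset.sum_range_succ, show 2 * q + 1 - 2 * q = 1 by omega]
    push_cast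
    rw [show involCount 1 3 = 0 from rfl, show involCount 1 1 = 0 from rfl, Nat.cast_zero, mul_zero,
      mul_zero, add_zero, add_zero]
    refine Finset.sum_congr rfl fun m hm => ?_
    rw [Finset.mem_range] at hm
    rw [(hpm m (by omega)).1, (involCount_closed _).2.1, (involCount_closed _).2.2.2,
      if_neg (hodd m (by omega)), if_pos (by omega), if_neg (fun h => hodd m (by omega) h.1)]
    simp

/-! ### Matchings invariant under a third of a turn -/

/-- Three arcs of 2q points: one orbit of crossings comes either from a noncrossing inner matching
and a pattern with `crossThird` equal to 1, or from one inner crossing and the unique pattern with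
`crossThird` equal to 0. -/
theorem card_fixed_three (q : ℕ) :
    (Nat.card {τ : Matching (3 * q) // crossings τ = 3 ∧ rotate^[2 * q] τ = τ} : ℚ) =
      q * binom (2 * q) q - binom (2 * q) (q - 1) := by
  have hsum : Nat.card {τ : Matching (3 * q) // crossings τ = 3 ∧ rotate^[2 * q] τ = τ} =
      ∑ m ∈ Finset.range (q + 1), (pmCount (2 * q) (2 * q - 2 * m) 0 *
        (if Even (2 * q - 2 * m) then (2 * q - 2 * m) / 2 else 0) +
        pmCount (2 * q) (2 * q - 2 * m) 1 * (if Even (2 * q - 2 * m) then 1 else 0)) := by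
    have s0 := sum_crossCard_eq (2 * q) 0 fun h => if Even h then h / 2 else 0
    have s1 := sum_crossCard_eq (2 * q) 1 fun h => if Even h then 1 else 0
    rw [Nat.mul_div_cancel_left q two_pos] at s0 s1
    rw [← Nat.card_congr (PeriodicMatching.equivFixed (d := 3) (M := 2 * q) (n := 3 * q)
      (by ring) 3), Nat.card_eq_fintype_card, Fintype.card_subtype, Finset.card_filter,
      PeriodicMatching.sum_join, Finset.sum_add_distrib, ← s0, ← s1, ← Finset.sum_add_distrib]
    refine Finset.sum_congr rfl fun f _ => ?_
    simp only [PeriodicMatching.crossNum_three]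
    obtain ⟨e0, e1⟩ := Pattern.card_crossThird_eq _ (α := Free f) rfl
    rw [freeCard_eq, ← e0, ← e1]
    generalize crossCard f = c
    match c with
    | 0 =>
      rw [if_pos rfl, if_neg zero_ne_one, add_zero]
      refine Finset.sum_congr rfl fun P _ => if_congr ?_ rfl rfl
      omega
    | 1 =>
      rw [if_neg one_ne_zero, if_pos rfl, zero_add]
      refine Finset.sum_congr rfl fun P _ => if_congr ?_ rfl rfl
      omega
    | c + 2 =>
      rw [if_neg (by omega), if_neg (by omega)]
      exact Finset.sum_eq_zero fun P _ => if_neg (by omega)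
  rw [hsum]
  push_cast
  have : ∀ m ∈ Finset.range (q + 1), ((pmCount (2 * q) (2 * q - 2 * m) 0 : ℚ) *
        (if Even (2 * q - 2 * m) then (((2 * q - 2 * m) / 2 : ℕ) : ℚ) else 0) +
        pmCount (2 * q) (2 * q - 2 * m) 1 * (if Even (2 * q - 2 * m) then 1 else 0)) =
        q * ballot (2 * q) m - ballot (2 * q) (m - 1) := by
    intro m hm
    rw [Finset.mem_range] at hm
    obtain ⟨h0, h1, -⟩ := pmCount_formula (2 * q) m (2 * q - 2 * m) (by omega)
    have hev : Even (2 * q - 2 * m) := by rw [← Nat.mul_sub]; exact even_two_mul _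
    rw [h0, h1, if_pos hev, if_pos hev, show (2 * q - 2 * m) / 2 = q - m by omega,
      Nat.cast_sub (by omega)]
    ring
  rw [Finset.sum_congr rfl this, Finset.sum_sub_distrib, ← Finset.mul_sum, sum_ballot,
    sum_ballot_sub_one]
  push_cast
  rw [show (q : ℤ) + 1 - 1 = q by ring, show (q : ℤ) + 1 - 2 = q - 1 by ring]

/-! ### Fewer crossings than the order of the rotation: only diameters cross -/

theorem antipodal_of_rotation_invariant {a b c e s n : ℕ} (hab : a < b) (hbc : b < c) (hce : c < e)
    (he : e < 2 * n) (hs : 0 < s) (hsn : s < 2 * n)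
    (h : ∀ z ∈ ({a, b, c, e} : Finset ℕ), (z + s) % (2 * n) ∈ ({a, b, c, e} : Finset ℕ)) :
    c = a + n ∧ e = b + n := by
  have key : ∀ z ∈ ({a, b, c, e} : Finset ℕ), ∃ w ∈ ({a, b, c, e} : Finset ℕ),
      w = z + s ∨ w + 2 * n = z + s := by
    intro z hz
    refine ⟨_, h z hz, ?_⟩
    have hz2 : z < 2 * n := by
      simp only [Finset.mem_insert, Finset.mem_singleton] at hz
      omega
    rcases lt_or_ge (z + s) (2 * n) with hlt | hge
    · exact Or.inl (Nat.mod_eq_of_lt hlt)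
    · right
      rw [Nat.mod_eq_sub_mod hge, Nat.mod_eq_of_lt (by omega)]
      omega
  have ha := key a (by simp)
  have hb := key b (by simp)
  have hc := key c (by simp)
  have he' := key e (by simp)
  simp only [Finset.mem_insert, Finset.mem_singleton, exists_eq_or_imp, exists_eq_left]
    at ha hb hc he'
  -- A nontrivial rotation moves four points in cyclic order by one, two or three places. In each
  -- case opposite gaps agree, so points two places apart are antipodal.
  rcases ha with ha | ha | ha | ha <;> rcases hb with hb | hb | hb | hb <;> omega

theorem insert_rotate (a b c e : ℕ) : ({a, b, c, e} : Finset ℕ) = {b, c, e, a} := by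
  ext z
  simp only [Finset.mem_insert, Finset.mem_singleton]
  tauto

/-- The four endpoints of a pair of edges. -/
def endpoints {n : ℕ} (τ : Matching n) (p : Fin (2 * n) × Fin (2 * n)) : Finset ℕ :=
  {p.1.val, p.2.val, (τ.partner p.1).val, (τ.partner p.2).val}

theorem mem_crossingPairs {n : ℕ} {τ : Matching n} {p : Fin (2 * n) × Fin (2 * n)} :
    p ∈ crossingPairs τ ↔ p.1.val < p.2.val ∧ p.2.val < (τ.partner p.1).val ∧
      (τ.partner p.1).val < (τ.partner p.2).val := by
  simp only [crossingPairs, Finset.mem_filter, Finset.mem_univ, true_and, Fin.lt_def]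

/-- A rotated crossing is again a crossing, but naming it by the smaller endpoints depends on where
the rotation passes the origin. Comparing endpoint sets avoids following that naming. -/
theorem exists_endpoints_rotate {n m : ℕ} {τ : Matching n} (hτ : rotate^[m] τ = τ)
    {p : Fin (2 * n) × Fin (2 * n)} (hp : p ∈ crossingPairs τ) :
    ∃ q ∈ crossingPairs τ, endpoints τ q = (endpoints τ p).image fun z => (z + m) % (2 * n) := by
  rw [rotate_iterate_eq_self_iff] at hτ
  obtain ⟨i, j⟩ := p
  rw [mem_crossingPairs] at hp
  have hv := val_finRotate_pow (N := 2 * n) m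
  set g := finRotate (2 * n) ^ m
  have himg : (endpoints τ (i, j)).image (fun z => (z + m) % (2 * n)) =
      {(g i).val, (g j).val, (τ.partner (g i)).val, (τ.partner (g j)).val} := by
    simp only [endpoints, Finset.image_insert, Finset.image_singleton, hτ, hv]
  have hval : ∀ x, (g x).val = x.val + m % (2 * n) ∨ (g x).val + 2 * n = x.val + m % (2 * n) := by
    intro x
    have hm := Nat.mod_lt m (Fin.pos x)
    rw [hv, ← Nat.add_mod_mod]
    rcases lt_or_ge (x.val + m % (2 * n)) (2 * n) with hlt | hge
    · exact Or.inl (Nat.mod_eq_of_lt hlt)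
    · right
      rw [Nat.mod_eq_sub_mod hge, Nat.mod_eq_of_lt (by omega)]
      omega
  have hi := hval i
  have hj := hval j
  have hi' := hval (τ.partner i)
  have hj' := hval (τ.partner j)
  rw [← hτ] at hi' hj'
  rw [himg]
  have l1 := (g i).isLt
  have l2 := (g j).isLt
  have l3 := (τ.partner (g i)).isLt
  have l4 := (τ.partner (g j)).isLt
  have lm := Nat.mod_lt m (Fin.pos i)
  dsimp only at hp
  -- The rotated points are in the same cyclic order; the cases tell which of them has become the
  -- smallest.
  by_cases c1 : (g i).val < (g j).val
  · by_cases c2 : (g j).val < (τ.partner (g i)).val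
    · by_cases c3 : (τ.partner (g i)).val < (τ.partner (g j)).val
      · exact ⟨(g i, g j), mem_crossingPairs.mpr ⟨c1, c2, c3⟩, rfl⟩
      · refine ⟨(τ.partner (g j), g i), mem_crossingPairs.mpr ?_, ?_⟩
        · simp only [τ.partner_partner]
          omega
        · simp only [endpoints, τ.partner_partner]
          rw [insert_rotate]
    · refine ⟨(τ.partner (g i), τ.partner (g j)), mem_crossingPairs.mpr ?_, ?_⟩
      · simp only [τ.partner_partner]
        omega
      · simp only [endpoints, τ.partner_partner]
        rw [insert_rotate, insert_rotate]
  · refine ⟨(g j, τ.partner (g i)), mem_crossingPairs.mpr ?_, ?_⟩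
    · simp only [τ.partner_partner]
      omega
    · simp only [endpoints, τ.partner_partner]
      rw [insert_rotate, insert_rotate, insert_rotate]

theorem rotate_iterate_mul_eq_self {n M : ℕ} {τ : Matching n} (hτ : rotate^[M] τ = τ) (k : ℕ) :
    rotate^[M * k] τ = τ := by
  rw [Function.iterate_mul]
  exact Function.iterate_fixed hτ k

/-- If the number of crossings of a matching is less than the order of a rotation which leaves
it invariant, all crossings are crossings of diameters. -/
theorem antipodal_of_mem_crossingPairs {n d M : ℕ} (h : d * M = 2 * n) {τ : Matching n}
    (hτ : rotate^[M] τ = τ) (hd : crossings τ < d) {p : Fin (2 * n) × Fin (2 * n)}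
    (hp : p ∈ crossingPairs τ) :
    (τ.partner p.1).val = p.1.val + n ∧ (τ.partner p.2).val = p.2.val + n := by
  by_contra hcon
  apply hd.not_ge
  let S : ℕ → Finset ℕ := fun k => (endpoints τ p).image fun z => (z + M * k) % (2 * n)
  have hlt : ∀ z ∈ endpoints τ p, z < 2 * n := by
    intro z hz
    simp only [endpoints, Finset.mem_insert, Finset.mem_singleton] at hz
    rcases hz with rfl | rfl | rfl | rfl <;> exact Fin.isLt _
  -- If two of the d rotates coincide, the endpoint set is stable under the rotation by M(l - k),
  -- which lies strictly between 0 and 2n, so both edges are diameters. Hence otherwise there are at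
  -- least d crossings.
  have hne : ∀ k l, k < l → l < d → S k ≠ S l := by
    intro k l hkl hl hS
    have hM : 0 < M := by
      rcases Nat.eq_zero_or_pos M with rfl | hM
      · have := Fin.pos p.1
        omega
      · exact hM
    refine hcon ?_
    rw [mem_crossingPairs] at hp
    refine antipodal_of_rotation_invariant hp.1 hp.2.1 hp.2.2 (Fin.isLt _) (s := M * (l - k))
      (Nat.mul_pos hM (by omega)) ?_ ?_
    · rw [← h, mul_comm d]
      exact Nat.mul_lt_mul_of_pos_left (by omega) hM
    · intro z hz
      have hz2 : (z + M * l) % (2 * n) ∈ S k := hS ▸ Finset.mem_image_of_mem _ hz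
      obtain ⟨w, hw, hwz⟩ := Finset.mem_image.mp hz2
      have hl : M * l = M * (l - k) + M * k := by rw [← mul_add]; congr 1; omega
      rw [hl, ← add_assoc] at hwz
      have := Nat.ModEq.add_right_cancel' (M * k) (show w + M * k ≡ z + M * (l - k) + M * k
        [MOD 2 * n] from hwz)
      have e : (z + M * (l - k)) % (2 * n) = w := by
        rw [← this, Nat.mod_eq_of_lt (hlt w hw)]
      rw [e]
      exact hw
  have hinj : Set.InjOn S (Finset.range d) := by
    intro k hk l hl hkl
    rw [Finset.coe_range, Set.mem_Iio] at hk hl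
    rcases lt_trichotomy k l with hlt | heq | hgt
    · exact absurd hkl (hne k l hlt hl)
    · exact heq
    · exact absurd hkl.symm (hne l k hgt hk)
  have hmaps : ∀ k ∈ Finset.range d, S k ∈ (crossingPairs τ).image (endpoints τ) := by
    intro k _
    obtain ⟨q, hq, hqS⟩ := exists_endpoints_rotate (rotate_iterate_mul_eq_self hτ k) hp
    exact Finset.mem_image.mpr ⟨q, hq, hqS⟩
  have := Finset.card_le_card_of_injOn S hmaps hinj
  rw [Finset.card_range] at this
  exact this.trans Finset.card_image_le

/-- The points joined to their antipodes. -/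
def diameterPoints {n : ℕ} (τ : Matching n) : Finset (Fin (2 * n)) :=
  Finset.univ.filter fun x => τ.partner x = (finRotate (2 * n) ^ n) x

theorem mem_diameterPoints {n : ℕ} {τ : Matching n} {x : Fin (2 * n)} :
    x ∈ diameterPoints τ ↔ (τ.partner x).val = x.val + n ∨ (τ.partner x).val + n = x.val := by
  rw [diameterPoints, Finset.mem_filter, Fin.ext_iff, val_finRotate_pow]
  simp only [Finset.mem_univ, true_and]
  have hx := x.isLt
  rcases lt_or_ge (x.val + n) (2 * n) with hlt | hge
  · rw [Nat.mod_eq_of_lt hlt]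
    omega
  · rw [Nat.mod_eq_sub_mod hge, Nat.mod_eq_of_lt (by omega)]
    have := (τ.partner x).isLt
    omega

theorem card_filter_lt_two_mul {α : Type*} [LinearOrder α] (s : Finset α) :
    2 * ((s ×ˢ s).filter fun p => p.1 < p.2).card + s.card = s.card * s.card := by
  have h1 : ((s ×ˢ s).filter fun p => p.2 < p.1).card = ((s ×ˢ s).filter fun p => p.1 < p.2).card :=
    Finset.card_bij (fun p _ => (p.2, p.1)) (by simp; tauto) (by simp; tauto) (by simp; tauto)
  have h2 : ((s ×ˢ s).filter fun p => p.1 = p.2).card = s.card := by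
    refine Finset.card_bij (fun p _ => p.1) ?_ ?_ ?_
    · simp only [Finset.mem_filter, Finset.mem_product]
      exact fun p hp => hp.1.1
    · simp only [Finset.mem_filter, Finset.mem_product]
      exact fun p hp q hq hpq => Prod.ext hpq (hp.2 ▸ hq.2 ▸ hpq)
    · exact fun x hx => ⟨(x, x), by simpa using hx, rfl⟩
  have h3 := Finset.card_filter_add_card_filter_not (s := s ×ˢ s) (fun p => p.1 < p.2)
  have h4 := Finset.card_filter_add_card_filter_not
    (s := (s ×ˢ s).filter fun p => ¬ p.1 < p.2) (fun p => p.1 = p.2)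
  have h5 : ((s ×ˢ s).filter fun p => ¬ p.1 < p.2).filter (fun p => p.1 = p.2) =
      (s ×ˢ s).filter fun p => p.1 = p.2 := by
    rw [Finset.filter_filter]
    refine Finset.filter_congr fun p _ => ⟨fun h => h.2, fun h => ⟨h.symm ▸ lt_irrefl _, h⟩⟩
  have h6 : ((s ×ˢ s).filter fun p => ¬ p.1 < p.2).filter (fun p => ¬ p.1 = p.2) =
      (s ×ˢ s).filter fun p => p.2 < p.1 := by
    rw [Finset.filter_filter]
    refine Finset.filter_congr fun p _ => ⟨fun h => ?_, fun h => ⟨h.not_gt, h.ne'⟩⟩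
    exact lt_of_le_of_ne (not_lt.mp h.1) (Ne.symm h.2)
  rw [h5, h6, h1, h2] at h4
  rw [Finset.card_product] at h3
  omega

/-- If only diameters cross, the number `m` of endpoints of diameters determines the number of
crossings. -/
theorem crossings_of_antipodal {n : ℕ} {τ : Matching n}
    (hτ : ∀ p ∈ crossingPairs τ,
      (τ.partner p.1).val = p.1.val + n ∧ (τ.partner p.2).val = p.2.val + n) :
    8 * crossings τ + 2 * (diameterPoints τ).card =
      (diameterPoints τ).card * (diameterPoints τ).card := by
  set s : Finset (Fin (2 * n)) := Finset.univ.filter fun x => (τ.partner x).val = x.val + n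
  set t : Finset (Fin (2 * n)) := Finset.univ.filter fun x => (τ.partner x).val + n = x.val
  have hst : s.card = t.card := by
    refine Finset.card_bij (fun x _ => τ.partner x) ?_ ?_ ?_
    · simp only [s, t, Finset.mem_filter, Finset.mem_univ, true_and, τ.partner_partner]
      intro x hx; exact hx.symm
    · intro x _ y _ hxy
      rw [← τ.partner_partner x, hxy, τ.partner_partner]
    · simp only [s, t, Finset.mem_filter, Finset.mem_univ, true_and, exists_prop]
      intro y hy
      exact ⟨τ.partner y, by rw [τ.partner_partner]; exact hy.symm, τ.partner_partner y⟩
  have hD : (diameterPoints τ).card = s.card + t.card := by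
    rw [← Finset.card_union_of_disjoint]
    · congr 1
      ext x
      simp only [mem_diameterPoints, s, t, Finset.mem_union, Finset.mem_filter, Finset.mem_univ,
        true_and]
    · rw [Finset.disjoint_filter]
      intro x _ h1 h2
      have := Fin.pos x
      omega
  -- Any two diameters cross, and by hypothesis nothing else does; each diameter is represented by
  -- its smaller endpoint.
  have hC : crossingPairs τ = (s ×ˢ s).filter fun p => p.1 < p.2 := by
    ext p
    constructor
    · intro hp
      have := hτ p hp
      rw [mem_crossingPairs] at hp
      simp only [s, Finset.mem_filter, Finset.mem_product, Finset.mem_univ, true_and, Fin.lt_def]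
      exact ⟨this, hp.1⟩
    · simp only [s, Finset.mem_filter, Finset.mem_product, Finset.mem_univ, true_and, Fin.lt_def,
        mem_crossingPairs]
      have := (τ.partner p.2).isLt
      omega
  have := card_filter_lt_two_mul s
  rw [← hC] at this
  rw [hD, ← hst, crossings]
  linarith

theorem finRotate_pow_mem_diameterPoints {n m : ℕ} {τ : Matching n} {x : Fin (2 * n)} :
    (finRotate (2 * n) ^ m) x ∈ diameterPoints (rotate^[m] τ) ↔ x ∈ diameterPoints τ := by
  simp only [diameterPoints, Finset.mem_filter, Finset.mem_univ, true_and, rotate_iterate, relabel,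
    Equiv.symm_apply_apply]
  rw [← Equiv.Perm.mul_apply, ← pow_add, add_comm n m, pow_add, Equiv.Perm.mul_apply,
    EmbeddingLike.apply_eq_iff_eq]

theorem rotate_iterate_injective {n : ℕ} (m : ℕ) :
    Function.Injective (rotate^[m] : Matching n → Matching n) := by
  refine Function.Injective.iterate (fun τ ρ h => ?_) m
  ext1
  funext x
  have := congrArg (fun τ => τ.partner (finRotate (2 * n) x)) h
  simpa only [rotate, relabel, Equiv.symm_apply_apply, EmbeddingLike.apply_eq_iff_eq] using this

theorem point_mem_diameterPoints {n d M : ℕ} [NeZero d] (h : d * M = 2 * n) {τ : Matching n}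
    (hτ : rotate^[M] τ = τ) (u : Fin d) (i : Fin M) :
    PeriodicMatching.point h (u, i) ∈ diameterPoints τ ↔
      PeriodicMatching.point h (0, i) ∈ diameterPoints τ := by
  rw [← PeriodicMatching.finRotate_pow_point_zero h u]
  conv_lhs => rw [← rotate_iterate_mul_eq_self hτ u.val]
  exact finRotate_pow_mem_diameterPoints

/-- The set of endpoints of diameters is invariant under the rotation, so each arc contains equally
many of them. -/
theorem card_diameterPoints {n d M : ℕ} [NeZero d] (h : d * M = 2 * n) {τ : Matching n}
    (hτ : rotate^[M] τ = τ) :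
    (diameterPoints τ).card = d * (Finset.univ.filter fun i : Fin M =>
      PeriodicMatching.point h (0, i) ∈ diameterPoints τ).card := by
  classical
  have h1 : (diameterPoints τ).card =
      ∑ x : Fin (2 * n), if x ∈ diameterPoints τ then 1 else 0 := by
    rw [Finset.sum_boole, Nat.cast_id, Finset.filter_univ_mem]
  rw [h1, ← (PeriodicMatching.point h).sum_comp, Fintype.sum_prod_type]
  simp only [point_mem_diameterPoints h hτ, Finset.sum_boole, Nat.cast_id, Finset.sum_const,
    Finset.card_univ, Fintype.card_fin, smul_eq_mul]

/-- If a matching with `k < d` crossings is invariant under a rotation of order `d`, its crossings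
are those of `d / 2` diameters. -/
theorem card_diameterPoints_of_few {n d M : ℕ} (h : d * M = 2 * n) {τ : Matching n}
    (hτ : rotate^[M] τ = τ) (hd : crossings τ < d) :
    8 * crossings τ + 2 * (diameterPoints τ).card =
      (diameterPoints τ).card * (diameterPoints τ).card :=
  crossings_of_antipodal fun _ hp => antipodal_of_mem_crossingPairs h hτ hd hp

theorem card_diameterPoints_eq {n d M : ℕ} (h : d * M = 2 * n) {τ : Matching n}
    (hτ : rotate^[M] τ = τ) (hd : crossings τ < d) (h0 : 0 < crossings τ)
    (h3 : crossings τ ≤ 3) (hd3 : 3 ≤ d) : (diameterPoints τ).card = d ∧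
      (d = 4 ∧ crossings τ = 1 ∨ d = 6 ∧ crossings τ = 3) := by
  have : NeZero d := ⟨by omega⟩
  have h1 := card_diameterPoints_of_few h hτ hd
  have h2 := card_diameterPoints h hτ
  generalize (Finset.univ.filter fun i : Fin M =>
      PeriodicMatching.point h (0, i) ∈ diameterPoints τ).card = a at h2
  generalize (diameterPoints τ).card = m at *
  generalize crossings τ = k at *
  -- From m² - 2m = 8k ≤ 24. What remains is a finite check using that m is a multiple of d ≥ 3 and
  -- that k < d.
  have hm : m ≤ 6 := by nlinarith
  match a with
  | 0 => interval_cases m <;> omega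
  | 1 => interval_cases m <;> omega
  | a + 2 => interval_cases m <;> interval_cases k <;> first | omega | nlinarith

theorem card_fixed_of_few {n d M k : ℕ} (h : d * M = 2 * n) (hd : k < d) (h0 : 0 < k)
    (h3 : k ≤ 3) (hd3 : 3 ≤ d) (hex : ¬(d = 4 ∧ k = 1 ∨ d = 6 ∧ k = 3)) :
    Nat.card {τ : Matching n // crossings τ = k ∧ rotate^[M] τ = τ} = 0 := by
  rw [Nat.card_eq_zero]
  refine Or.inl ⟨fun τ => hex ?_⟩
  obtain ⟨τ, rfl, hτ⟩ := τ
  exact (card_diameterPoints_eq h hτ hd h0 h3 hd3).2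

namespace PeriodicMatching

variable {d N : ℕ} [NeZero d]

/-- The matching consisting of a diameter at the last point of each arc, and a copy of `f` in each
arc. Here `e` is half a turn. -/
def ofDiameter (e : Fin d) (he : e = -e) (he0 : e ≠ 0) (f : Invol (Fin N)) (hf : ∀ i, f.1 i ≠ i) :
    PeriodicMatching d (N + 1) where
  pos := Fin.lastCases (Fin.last N) fun a => (f.1 a).castSucc
  shift := Fin.lastCases e fun _ => 0
  pos_pos i := by
    induction i using Fin.lastCases with
    | last => simp
    | cast a => simp [f.2 a]
  shift_pos i := by
    induction i using Fin.lastCases with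
    | last => simpa using he
    | cast a => simp
  shift_ne i := by
    induction i using Fin.lastCases with
    | last => simpa using he0
    | cast a => simp [hf a]

/-- The copies of f are noncrossing, and the diameters end at the last points of arcs, hence under
no edge of f. Only pairs of diameters remain. -/
theorem crossNum_ofDiameter (e : Fin d) (he : e = -e) (he0 : e ≠ 0) (f : Invol (Fin N))
    (hf : ∀ i, f.1 i ≠ i) (hc : crossCard f = 0) : (ofDiameter e he he0 f hf).crossNum =
      ∑ u : Fin d, ∑ v : Fin d, if u < v ∧ v < u + e ∧ u + e < v + e then 1 else 0 := by
  have hc2 : ∀ a b, a < b → b < f.1 a → ¬ f.1 a < f.1 b := by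
    intro a b hab hb hfb
    simp only [crossCard, Finset.sum_eq_zero_iff, Finset.mem_univ, true_imp_iff] at hc
    have := hc a b
    rw [if_pos ⟨hab, hb, Or.inr hfb⟩] at this
    exact one_ne_zero this
  simp only [crossNum, Fin.sum_univ_castSucc]
  rw [Finset.sum_eq_zero, zero_add, Finset.sum_eq_zero, zero_add]
  · simp [ofDiameter]
  · intro b _
    refine Finset.sum_eq_zero fun u _ => Finset.sum_eq_zero fun v _ => if_neg ?_
    simp only [ofDiameter, Fin.lastCases_last, Fin.lastCases_castSucc, add_zero]
    rintro ⟨-, h1, h2⟩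
    have hb := Fin.castSucc_lt_last b
    have hb' := Fin.castSucc_lt_last (f.1 b)
    rcases h1 with h1 | h1 <;> rcases h2 with h2 | h2
    · exact h1.not_gt h2
    · exact h1.ne h2.1.symm
    · exact h2.ne h1.1.symm
    · exact h2.2.not_gt hb'
  · intro a _
    have key : ∀ j : Fin (N + 1), ∀ u v : Fin d, ¬((u < v ∨ u = v ∧ a.castSucc < j) ∧
        (v < u ∨ v = u ∧ j < (f.1 a).castSucc) ∧
        (u < v + (ofDiameter e he he0 f hf).shift j ∨
          u = v + (ofDiameter e he he0 f hf).shift j ∧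
            (f.1 a).castSucc < (ofDiameter e he he0 f hf).pos j)) := by
      rintro j u v ⟨h1, h2, h3⟩
      have huv : u = v := by
        rcases h1 with h1 | h1
        · rcases h2 with h2 | h2
          · exact absurd h1 h2.not_gt
          · exact h2.1.symm
        · exact h1.1
      subst huv
      simp only [lt_irrefl, false_or, true_and] at h1 h2
      induction j using Fin.lastCases with
      | last => exact h2.not_gt (Fin.castSucc_lt_last _)
      | cast b =>
        simp only [ofDiameter, Fin.lastCases_castSucc, add_zero, lt_irrefl, false_or, true_and,
          Fin.castSucc_lt_castSucc_iff] at h1 h2 h3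
        exact hc2 a b h1 h2 h3
    have hsa : (ofDiameter e he he0 f hf).shift a.castSucc = 0 := by simp [ofDiameter]
    have hpa : (ofDiameter e he he0 f hf).pos a.castSucc = (f.1 a).castSucc := by simp [ofDiameter]
    simp only [hsa, hpa, add_zero]
    have hz : ∀ j, ∑ u : Fin d, ∑ v : Fin d, (if (u < v ∨ u = v ∧ a.castSucc < j) ∧
        (v < u ∨ v = u ∧ j < (f.1 a).castSucc) ∧
        (u < v + (ofDiameter e he he0 f hf).shift j ∨
          u = v + (ofDiameter e he he0 f hf).shift j ∧
            (f.1 a).castSucc < (ofDiameter e he he0 f hf).pos j) then 1 else 0) = 0 := fun j =>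
      Finset.sum_eq_zero fun u _ => Finset.sum_eq_zero fun v _ => if_neg (key j u v)
    rw [hz, add_zero]
    exact Finset.sum_eq_zero fun j _ => hz _

theorem mem_diameterPoints_iff {n M : ℕ} (h : d * M = 2 * n) (D : PeriodicMatching d M) {e : Fin d}
    (hn : M * e.val = n) (hsh : ∀ s : Fin d, s = -s → s ≠ 0 → s = e) (u : Fin d) (i : Fin M) :
    point h (u, i) ∈ diameterPoints (D.toMatching h) ↔ D.pos i = i := by
  rw [diameterPoints, Finset.mem_filter, toMatching_point]
  simp only [Finset.mem_univ, true_and]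
  have key := finRotate_pow_point h e.val u i
  rw [hn, Fin.ofNat_val_eq_self] at key
  rw [key, EmbeddingLike.apply_eq_iff_eq, Prod.mk.injEq]
  refine ⟨fun h => h.2, fun hi => ⟨?_, hi⟩⟩
  rw [hsh (D.shift i) (by rw [← D.shift_pos, hi]) (D.shift_ne i hi)]

/-- All crossings are between diameters, so an edge that is not a diameter crosses nothing. The
diameters from the ends of the arcs then confine it to a single arc. -/
theorem exists_ofDiameter {n : ℕ} (h : d * (N + 1) = 2 * n) {e : Fin d} (he : e = -e) (he0 : e ≠ 0)
    (hn : (N + 1) * e.val = n) (hsh : ∀ s : Fin d, s = -s → s ≠ 0 → s = e)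
    (D : PeriodicMatching d (N + 1)) (hD : D.crossNum < d)
    (hp : ∀ i, D.pos i = i ↔ i = Fin.last N) :
    ∃ (f : Invol (Fin N)) (hf : ∀ i, f.1 i ≠ i), crossCard f = 0 ∧
      ofDiameter e he he0 f hf = D := by
  have hlast : D.pos (Fin.last N) = Fin.last N := (hp _).mpr rfl
  have hslast : D.shift (Fin.last N) = e :=
    hsh _ (by rw [← D.shift_pos, hlast]) (D.shift_ne _ hlast)
  have hcross : ∀ i y, (point h (0, i), y) ∈ crossingPairs (D.toMatching h) → i = Fin.last N := by
    intro i y hi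
    rw [← hp, ← mem_diameterPoints_iff h D hn hsh 0, mem_diameterPoints]
    rw [← crossings_toMatching h] at hD
    exact Or.inl (antipodal_of_mem_crossingPairs h (rotate_toMatching h D) hD hi).1
  have hposlast : ∀ a : Fin N, D.pos a.castSucc ≠ Fin.last N := by
    intro a ha
    have := D.pos_pos a.castSucc
    rw [ha, hlast] at this
    exact (Fin.castSucc_lt_last a).ne this.symm
  have hshift : ∀ a : Fin N, D.shift a.castSucc = 0 := by
    intro a
    by_contra hs
    have hlt := Fin.castSucc_lt_last a
    have hlt' := Fin.lt_last_iff_ne_last.mpr (hposlast a)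
    have hspos : 0 < D.shift a.castSucc := Fin.pos_iff_ne_zero.mpr hs
    refine hlt.ne ?_
    -- An edge from arc 0 to arc s ≠ 0 crosses the diameter from the last point of arc 0 if s ≤ e,
    -- and the diameter joining the last points of the arcs s - e and s if s > e.
    rcases le_or_gt (D.shift a.castSucc) e with hse | hse
    · refine hcross a.castSucc (point h (0, Fin.last N)) ?_
      simp only [crossingPairs, Finset.mem_filter, Finset.mem_univ, true_and, toMatching_point,
        point_lt_point, zero_add, hslast, hlast]
      exact ⟨Or.inr hlt, Or.inl hspos, hse.lt_or_eq.imp_right fun h => ⟨h, hlt'⟩⟩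
    · refine hcross a.castSucc (point h (D.shift a.castSucc - e, Fin.last N)) ?_
      simp only [crossingPairs, Finset.mem_filter, Finset.mem_univ, true_and, toMatching_point,
        point_lt_point, zero_add, hslast, hlast, sub_add_cancel]
      refine ⟨Or.inl ?_, Or.inl ?_, Or.inr hlt'⟩
      · exact Fin.pos_iff_ne_zero.mpr (sub_ne_zero.mpr hse.ne')
      · rw [Fin.lt_def, Fin.sub_val_of_le hse.le]
        have := Fin.pos_iff_ne_zero.mpr he0
        rw [Fin.lt_def, Fin.val_zero] at this
        rw [Fin.lt_def] at hse
        omega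
  have hex : ∀ a : Fin N, ∃ b : Fin N, b.castSucc = D.pos a.castSucc := fun a =>
    Fin.exists_castSucc_eq.mpr (hposlast a)
  choose g hg using hex
  have hgg : Function.Involutive g := fun a => by
    rw [← (Fin.castSucc_injective N).eq_iff, hg, hg, D.pos_pos]
  have hgne : ∀ a, g a ≠ a := by
    intro a ha
    have := hg a
    rw [ha, eq_comm, hp] at this
    exact (Fin.castSucc_lt_last a).ne this
  refine ⟨⟨g, hgg⟩, hgne, ?_, ?_⟩
  · refine Finset.sum_eq_zero fun a _ => Finset.sum_eq_zero fun b _ => if_neg ?_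
    rintro ⟨h1, h2, h3 | h3⟩
    · exact hgne b h3
    · refine (Fin.castSucc_lt_last a).ne (hcross a.castSucc (point h (0, b.castSucc)) ?_)
      simp only [crossingPairs, Finset.mem_filter, Finset.mem_univ, true_and, toMatching_point,
        point_lt_point, hshift, add_zero, ← hg, Fin.castSucc_lt_castSucc_iff]
      exact ⟨Or.inr h1, Or.inr h2, Or.inr h3⟩
  · ext1
    · funext i
      induction i using Fin.lastCases with
      | last => simp [ofDiameter, hlast]
      | cast a => simp [ofDiameter, hg]
    · funext i
      induction i using Fin.lastCases with
      | last => simp [ofDiameter, hslast]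
      | cast a => simp [ofDiameter, hshift]

end PeriodicMatching

-- Each arc contains exactly one endpoint of a diameter. Its position can be chosen in N + 1 ways by
-- rotating, and cutting behind it leaves a noncrossing matching of N points. The hypothesis `hkd`
-- says that d endpoints of diameters produce k crossings.
open PeriodicMatching in
theorem card_fixed_ofDiameter {n d N k : ℕ} [NeZero d] (h : d * (N + 1) = 2 * n) (hk : k < d)
    (hkd : 8 * k + 2 * d = d * d) (h2d : 2 < d) {e : Fin d} (he : e = -e) (he0 : e ≠ 0)
    (hn : (N + 1) * e.val = n) (hsh : ∀ s : Fin d, s = -s → s ≠ 0 → s = e)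
    (hcount : ∑ u : Fin d, ∑ v : Fin d, (if u < v ∧ v < u + e ∧ u + e < v + e then 1 else 0) = k) :
    Nat.card {τ : Matching n // crossings τ = k ∧ rotate^[N + 1] τ = τ} =
      (N + 1) * pmCount N 0 0 := by
  have hfree : ∀ f : Invol (Fin N), freeCard f = 0 → ∀ i, f.1 i ≠ i := by
    intro f
    simp [freeCard]
  have hcard : Nat.card (Fin (N + 1) × {f : Invol (Fin N) // freeCard f = 0 ∧ crossCard f = 0}) =
      (N + 1) * pmCount N 0 0 := by
    rw [Nat.card_prod, Nat.card_eq_fintype_card, Fintype.card_fin, pmCount, Finset.sum_boole,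
      Nat.cast_id, ← Fintype.card_subtype, Nat.card_eq_fintype_card]
  rw [← hcard]
  symm
  have hcomm : ∀ (m : ℕ) (τ : Matching n), rotate^[N + 1] τ = τ →
      rotate^[N + 1] (rotate^[m] τ) = rotate^[m] τ := by
    intro m τ hτ
    rw [← Function.iterate_add_apply, add_comm, Function.iterate_add_apply, hτ]
  let base : {f : Invol (Fin N) // freeCard f = 0 ∧ crossCard f = 0} → Matching n := fun f =>
    (ofDiameter e he he0 f.1 (hfree f.1 f.2.1)).toMatching h
  have hbase : ∀ f, crossings (base f) = k ∧ rotate^[N + 1] (base f) = base f := fun f =>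
    ⟨by rw [crossings_toMatching, crossNum_ofDiameter _ _ _ _ _ f.2.2, hcount],
      rotate_toMatching h _⟩
  have hbasep : ∀ f u i, point h (u, i) ∈ diameterPoints (base f) ↔ i = Fin.last N := by
    intro f u i
    rw [mem_diameterPoints_iff h _ hn hsh]
    induction i using Fin.lastCases with
    | last => simp [ofDiameter]
    | cast a => simpa [ofDiameter, (Fin.castSucc_lt_last a).ne] using hfree f.1 f.2.1 a
  -- Both d and the number da of endpoints solve x² - 2x = 8k. Since d > 2 excludes a = 0 and x² -
  -- 2x is increasing for larger x, it follows that a = 1.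
  have hone : ∀ τ : Matching n, crossings τ = k → rotate^[N + 1] τ = τ →
      ∃ i, ∀ j, point h (0, j) ∈ diameterPoints τ ↔ j = i := by
    intro τ hτk hτ
    have h1 := card_diameterPoints_of_few h hτ (by omega)
    have h2 := card_diameterPoints h hτ
    have h3 : (Finset.univ.filter fun i : Fin (N + 1) =>
        point h (0, i) ∈ diameterPoints τ).card = 1 := by
      rw [h2, hτk] at h1
      generalize (Finset.univ.filter fun i : Fin (N + 1) =>
        point h (0, i) ∈ diameterPoints τ).card = a at h1
      match a with
      | 0 => nlinarith
      | 1 => rfl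
      | a + 2 =>
        exfalso
        have hy : 2 * d ≤ d * (a + 2) := by
          rw [mul_comm]
          exact Nat.mul_le_mul_left _ (by omega)
        generalize d * (a + 2) = y at h1 hy
        have : d * d + 2 * y = y * y + 2 * d := by omega
        nlinarith
    obtain ⟨i, hi⟩ := Finset.card_eq_one.mp h3
    refine ⟨i, fun j => ?_⟩
    rw [← Finset.mem_singleton, ← hi]
    simp
  -- The rotation by i + 1 points carries the last point of arc 0 to the point i of the next arc, so
  -- i is recovered from the position of the diameters.
  have hpt : ∀ i : Fin (N + 1), (finRotate (2 * n) ^ (i.val + 1)) (point h (0, Fin.last N)) =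
      point h (1, i) := by
    intro i
    have hd1 : ((1 : Fin d) : ℕ) = 1 := by
      rw [Fin.val_one', Nat.mod_eq_of_lt (by omega)]
    ext
    rw [val_finRotate_pow, val_point, val_point, hd1, Fin.val_zero, Fin.val_last, ← h,
      Nat.mod_eq_of_lt]
    · omega
    · have : 2 * (N + 1) ≤ d * (N + 1) := Nat.mul_le_mul_right _ (by omega)
      omega
  refine Nat.card_congr (Equiv.ofBijective (fun x => ⟨rotate^[x.1.val + 1] (base x.2),
    by rw [crossings_rotate_iterate, (hbase _).1], hcomm _ _ (hbase _).2⟩) ⟨?_, ?_⟩)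
  · rintro ⟨i, f⟩ ⟨j, g⟩ hij
    replace hij := congrArg Subtype.val hij
    dsimp only at hij
    have hi : ∀ i f, point h (1, i) ∈ diameterPoints (rotate^[i.val + 1] (base f)) := by
      intro i f
      rw [← hpt, finRotate_pow_mem_diameterPoints, hbasep]
    obtain ⟨l, hl⟩ := hone (rotate^[i.val + 1] (base f))
      (by rw [crossings_rotate_iterate, (hbase _).1]) (hcomm _ _ (hbase _).2)
    have h1 := hi i f
    have h2 := hi j g
    rw [← hij, point_mem_diameterPoints h (hcomm _ _ (hbase _).2), hl] at h2
    rw [point_mem_diameterPoints h (hcomm _ _ (hbase _).2), hl] at h1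
    obtain rfl : i = j := h1.trans h2.symm
    have hfg := toMatching_injective h (rotate_iterate_injective _ hij)
    refine Prod.ext rfl (Subtype.ext (Subtype.ext (funext fun a => ?_)))
    have := congrArg (fun D => D.pos a.castSucc) hfg
    simpa [ofDiameter] using this
  · rintro ⟨τ, hτk, hτ⟩
    obtain ⟨i, hi⟩ := hone τ hτk hτ
    have hi' := i.isLt
    -- Rotating by N - i moves the diameter endpoint to the end of the arc; the further rotation by
    -- i + 1 completes one period.
    set ρ := rotate^[N - i.val] τ with hρ
    have hρM : rotate^[N + 1] ρ = ρ := hcomm _ _ hτ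
    have hρk : crossings ρ = k := by rw [hρ, crossings_rotate_iterate, hτk]
    have hback : rotate^[i.val + 1] ρ = τ := by
      rw [hρ, ← Function.iterate_add_apply, show i.val + 1 + (N - i.val) = N + 1 by omega, hτ]
    have hρlast : point h (0, Fin.last N) ∈ diameterPoints ρ := by
      rw [← finRotate_pow_mem_diameterPoints (m := i.val + 1), hback, hpt,
        point_mem_diameterPoints h hτ, hi]
    obtain ⟨l, hl⟩ := hone ρ hρk hρM
    obtain rfl := (hl _).mp hρlast
    obtain ⟨D, hD⟩ := exists_toMatching_eq h ρ hρM
    obtain ⟨f, hf, hfc, rfl⟩ := exists_ofDiameter h he he0 hn hsh D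
      (by rw [← crossings_toMatching h, hD, hρk]; exact hk)
      (fun j => by rw [← mem_diameterPoints_iff h D hn hsh 0, hD, hl])
    refine ⟨(i, ⟨f, by simpa [freeCard] using hf, hfc⟩), Subtype.ext ?_⟩
    dsimp only [base]
    rw [hD, hback]

theorem card_fixed_four (N n : ℕ) (h : 2 * (N + 1) = n) :
    Nat.card {τ : Matching n // crossings τ = 1 ∧ rotate^[N + 1] τ = τ} =
      (N + 1) * pmCount N 0 0 :=
  card_fixed_ofDiameter (d := 4) (by omega) (by norm_num) (by norm_num) (by norm_num) (e := 2)
    (by decide) (by decide) (by rw [← h, mul_comm]; rfl) (by decide) (by decide)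

theorem card_fixed_six (N n : ℕ) (h : 3 * (N + 1) = n) :
    Nat.card {τ : Matching n // crossings τ = 3 ∧ rotate^[N + 1] τ = τ} =
      (N + 1) * pmCount N 0 0 :=
  card_fixed_ofDiameter (d := 6) (by omega) (by norm_num) (by norm_num) (by norm_num) (e := 3)
    (by decide) (by decide) (by rw [← h, mul_comm]; rfl) (by decide) (by decide)

/-- The noncrossing matchings are counted by the Catalan number C_q, and (2q + 1) C_q is the
binomial coefficient delivered by q-Lucas. -/
theorem mul_pmCount_even (q : ℕ) : (2 * q + 1) * pmCount (2 * q) 0 0 = (2 * q + 1).choose q := by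
  obtain ⟨h0, -⟩ := pmCount_formula (2 * q) q 0 rfl
  have h1 := binom_mul_sub (2 * q) (q - 1)
  rw [sub_add_cancel] at h1
  rw [ballot] at h0
  have h2 : ((2 * q + 1 : ℕ) : ℚ) * pmCount (2 * q) 0 0 = (2 * q + 1).choose q := by
    rw [h0, ← binom_natCast, binom_succ]
    push_cast at h1 ⊢
    linear_combination -2 * h1
  exact_mod_cast h2

theorem pmCount_odd (q : ℕ) : pmCount (2 * q + 1) 0 0 = 0 := pmCount_eq_zero 0 (by omega)

/-! ### `q`-integers and `q`-binomial coefficients as polynomials -/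

/-- The `q`-integer as a polynomial. -/
noncomputable def qIntPoly (m : ℕ) : ℂ[X] := ∑ i ∈ Finset.range m, X ^ i

/-- The `q`-binomial coefficient as a polynomial. -/
noncomputable def qChoose : ℕ → ℕ → ℂ[X]
  | _, 0 => 1
  | 0, _ + 1 => 0
  | m + 1, k + 1 => qChoose m k + X ^ (k + 1) * qChoose m (k + 1)

theorem qChoose_zero_right (m : ℕ) : qChoose m 0 = 1 := by cases m <;> rfl

theorem qChoose_zero_succ (k : ℕ) : qChoose 0 (k + 1) = 0 := rfl

theorem qChoose_succ_succ (m k : ℕ) :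
    qChoose (m + 1) (k + 1) = qChoose m k + X ^ (k + 1) * qChoose m (k + 1) := rfl

theorem qChoose_eq_zero {m k : ℕ} (h : m < k) : qChoose m k = 0 := by
  induction m generalizing k with
  | zero =>
    obtain ⟨k, rfl⟩ := Nat.exists_eq_succ_of_ne_zero h.ne'
    rfl
  | succ m ih =>
    obtain ⟨k, rfl⟩ := Nat.exists_eq_succ_of_ne_zero (Nat.ne_zero_of_lt h)
    rw [qChoose_succ_succ, ih (by omega), ih (by omega), mul_zero, add_zero]

theorem qChoose_self (m : ℕ) : qChoose m m = 1 := by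
  induction m with
  | zero => rfl
  | succ m ih =>
    rw [qChoose_succ_succ, ih, qChoose_eq_zero (Nat.lt_succ_self m), mul_zero, add_zero]

theorem qIntPoly_zero : qIntPoly 0 = 0 := Finset.sum_range_zero _

theorem qIntPoly_one : qIntPoly 1 = 1 := by simp [qIntPoly]

theorem qIntPoly_add (m k : ℕ) : qIntPoly (m + k) = qIntPoly m + X ^ m * qIntPoly k := by
  simp only [qIntPoly, Finset.sum_range_add, Finset.mul_sum, pow_add]

/-- Isolates the factor of [da] that vanishes at a primitive d-th root of unity (d > 1); the
cofactor takes the value a there. -/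
theorem qIntPoly_mul (d a : ℕ) :
    qIntPoly (d * a) = qIntPoly d * ∑ i ∈ Finset.range a, (X ^ d) ^ i := by
  induction a with
  | zero => simp [qIntPoly_zero]
  | succ a ih =>
    rw [Nat.mul_succ, qIntPoly_add, ih, Finset.sum_range_succ, mul_add, ← pow_mul]
    ring

theorem qChoose_succ_mul_qIntPoly (m k : ℕ) :
    qChoose m (k + 1) * qIntPoly (k + 1) = qChoose m k * qIntPoly (m - k) := by
  induction m generalizing k with
  | zero => simp [qChoose_zero_succ, qIntPoly_zero]
  | succ m ih =>
    have h1 : ∀ k, k ≤ m →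
        qIntPoly (k + 1) + X ^ (k + 1) * qIntPoly (m - k) = qIntPoly (m + 1) := by
      intro k hk
      rw [← qIntPoly_add]
      congr 1
      omega
    rcases le_or_gt k m with hk | hk
    · have h2 : qChoose (m + 1) (k + 1) * qIntPoly (k + 1) = qChoose m k * qIntPoly (m + 1) := by
        rw [qChoose_succ_succ, add_mul, mul_assoc, ih, ← h1 k hk]
        ring
      rw [h2]
      cases k with
      | zero => simp [qChoose_zero_right]
      | succ k =>
        rw [qChoose_succ_succ, add_mul, Nat.add_sub_add_right, ← ih, ← h1 k (by omega)]
        ring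
    · rw [qChoose_eq_zero (by omega), zero_mul]
      rcases Nat.lt_or_ge (m + 1) k with hk2 | hk2
      · rw [qChoose_eq_zero hk2, zero_mul]
      · rw [show m + 1 - k = 0 by omega, qIntPoly_zero, mul_zero]

/-- The q-absorption identity. It exposes a factor [m+1] that can be cancelled against a vanishing
denominator. -/
theorem qChoose_succ_succ_mul (m k : ℕ) :
    qChoose (m + 1) (k + 1) * qIntPoly (k + 1) = qIntPoly (m + 1) * qChoose m k := by
  rcases le_or_gt k m with hk | hk
  · have h1 : qIntPoly (m + 1) = qIntPoly (k + 1) + X ^ (k + 1) * qIntPoly (m - k) := by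
      rw [← qIntPoly_add]
      congr 1
      omega
    rw [qChoose_succ_succ, add_mul, mul_assoc, qChoose_succ_mul_qIntPoly, h1]
    ring
  · rw [qChoose_eq_zero hk, qChoose_eq_zero (by omega), zero_mul, mul_zero]

theorem qChoose_mul_prod (m k : ℕ) : qChoose m k * ∏ i ∈ Finset.range k, qIntPoly (i + 1) =
    ∏ i ∈ Finset.range k, qIntPoly (m - i) := by
  induction k with
  | zero => simp [qChoose_zero_right]
  | succ k ih =>
    rw [Finset.prod_range_succ, Finset.prod_range_succ, ← ih, mul_left_comm,
      qChoose_succ_mul_qIntPoly]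
    ring

theorem eval_one_qIntPoly (m : ℕ) : (qIntPoly m).eval 1 = m := by
  simp [qIntPoly, eval_finsetSum]

theorem eval_one_qChoose (m k : ℕ) : (qChoose m k).eval 1 = m.choose k := by
  induction m generalizing k with
  | zero => cases k <;> simp [qChoose_zero_right, qChoose_zero_succ]
  | succ m ih =>
    cases k with
    | zero => simp [qChoose_zero_right]
    | succ k => simp [qChoose_succ_succ, ih, Nat.choose_succ_succ]

theorem qIntPoly_succ_ne_zero (m : ℕ) : qIntPoly (m + 1) ≠ 0 := by
  intro h
  have := eval_one_qIntPoly (m + 1)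
  rw [h, eval_zero] at this
  exact Nat.cast_ne_zero.mpr (Nat.succ_ne_zero m) this.symm

theorem algebraMap_qIntPoly (m : ℕ) : algebraMap ℂ[X] (RatFunc ℂ) (qIntPoly m) = qInt m := by
  simp [qIntPoly, qInt]

theorem qInt_succ_ne_zero (m : ℕ) : qInt (m + 1) ≠ 0 := by
  rw [← algebraMap_qIntPoly]
  exact (map_ne_zero_iff _ (RatFunc.algebraMap_injective ℂ)).mpr (qIntPoly_succ_ne_zero m)

theorem algebraMap_qChoose (m k : ℕ) :
    algebraMap ℂ[X] (RatFunc ℂ) (qChoose m k) = qBinom m k := by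
  rw [qBinom, if_pos (Int.natCast_nonneg k), Int.toNat_natCast,
    eq_div_iff (Finset.prod_ne_zero_iff.mpr fun i _ => qInt_succ_ne_zero i)]
  simp only [← algebraMap_qIntPoly, ← map_prod, ← map_mul, qChoose_mul_prod]

theorem qBinom_of_neg (m : ℕ) {k : ℤ} (hk : k < 0) : qBinom m k = 0 := if_neg hk.not_ge

/-! ### Values at roots of unity -/

section RootOfUnity

variable {d : ℕ} {w : ℂ}

theorem eval_qIntPoly_eq_zero_iff (hw : IsPrimitiveRoot w d) (hd : 1 < d) (m : ℕ) :
    (qIntPoly m).eval w = 0 ↔ d ∣ m := by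
  have h1 : w - 1 ≠ 0 := sub_ne_zero.mpr (hw.ne_one hd)
  have h2 : (qIntPoly m).eval w * (w - 1) = w ^ m - 1 := by
    rw [qIntPoly, eval_finsetSum]
    simpa using geom_sum_mul w m
  rw [← hw.pow_eq_one_iff_dvd, ← sub_eq_zero (a := w ^ m), ← h2, mul_eq_zero, or_iff_left h1]

theorem eval_sum_pow_pow (hw : IsPrimitiveRoot w d) (a : ℕ) :
    (∑ i ∈ Finset.range a, (X ^ d) ^ i : ℂ[X]).eval w = a := by
  simp [eval_finsetSum, hw.pow_eq_one]

theorem eval_qChoose_self (hw : IsPrimitiveRoot w d) {k : ℕ} (hk0 : 0 < k) (hk : k < d) :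
    (qChoose d k).eval w = 0 := by
  obtain ⟨k, rfl⟩ := Nat.exists_eq_succ_of_ne_zero hk0.ne'
  obtain ⟨d, rfl⟩ := Nat.exists_eq_succ_of_ne_zero (Nat.ne_zero_of_lt hk)
  have h := congrArg (eval w) (qChoose_succ_succ_mul d k)
  rw [eval_mul, eval_mul, (eval_qIntPoly_eq_zero_iff hw (by omega) _).mpr dvd_rfl, zero_mul,
    mul_eq_zero] at h
  refine h.resolve_right fun h0 => ?_
  rw [eval_qIntPoly_eq_zero_iff hw (by omega)] at h0
  exact (Nat.le_of_dvd (Nat.succ_pos k) h0).not_gt hk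

/-- Increasing m by d acts like Pascal's rule in blocks of length d. For m = 0 this is the vanishing
of the inner entries of row d; the induction uses the q-Pascal rule, in which w^(k+d) = w^k. -/
theorem eval_qChoose_add (hw : IsPrimitiveRoot w d) (hd : 0 < d) (m : ℕ) :
    (∀ k, (qChoose (m + d) (k + d)).eval w = (qChoose m k).eval w + (qChoose m (k + d)).eval w) ∧
      ∀ k < d, (qChoose (m + d) k).eval w = (qChoose m k).eval w := by
  induction m with
  | zero =>
    constructor
    · intro k
      rw [zero_add, qChoose_eq_zero (m := 0) (k := k + d) (by omega), eval_zero, add_zero]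
      cases k with
      | zero => rw [zero_add, qChoose_self, qChoose_zero_right]
      | succ k => rw [qChoose_eq_zero (by omega), qChoose_zero_succ]
    · intro k hk
      rw [zero_add]
      cases k with
      | zero => rw [qChoose_zero_right, qChoose_zero_right]
      | succ k => rw [eval_qChoose_self hw (by omega) hk, qChoose_zero_succ, eval_zero]
  | succ m ih =>
    obtain ⟨ih1, ih2⟩ := ih
    have hp := hw.pow_eq_one
    constructor
    · intro k
      cases k with
      | zero =>
        obtain ⟨e, rfl⟩ := Nat.exists_eq_succ_of_ne_zero hd.ne'
        have h1 := ih1 0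
        have h2 := ih2 e (by omega)
        rw [zero_add] at h1 ⊢
        rw [Nat.succ_eq_add_one] at *
        rw [Nat.add_right_comm, qChoose_succ_succ, qChoose_succ_succ]
        simp only [eval_add, eval_mul, eval_pow, eval_X, h1, h2, hp, qChoose_zero_right]
        ring
      | succ k =>
        rw [Nat.add_right_comm m, Nat.add_right_comm k, qChoose_succ_succ, qChoose_succ_succ,
          qChoose_succ_succ, ← Nat.add_right_comm k]
        simp only [eval_add, eval_mul, eval_pow, eval_X, ih1, pow_add, hp]
        ring
    · intro k hk
      cases k with
      | zero => rw [qChoose_zero_right, qChoose_zero_right]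
      | succ k =>
        rw [Nat.add_right_comm, qChoose_succ_succ, qChoose_succ_succ]
        simp only [eval_add, eval_mul, eval_pow, eval_X, ih2 k (by omega), ih2 (k + 1) hk]

/-- The `q`-analogue of Lucas' theorem. -/
theorem eval_qChoose_mul_add (hw : IsPrimitiveRoot w d) (a b : ℕ) {r s : ℕ} (hr : r < d)
    (hs : s < d) : (qChoose (d * a + r) (d * b + s)).eval w =
      a.choose b * (qChoose r s).eval w := by
  induction a generalizing b with
  | zero =>
    cases b with
    | zero => simp
    | succ b =>
      rw [Nat.mul_succ, qChoose_eq_zero (by omega)]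
      simp
  | succ a ih =>
    obtain ⟨h1, h2⟩ := eval_qChoose_add hw (by omega) (d * a + r)
    rw [Nat.mul_succ, Nat.add_right_comm]
    cases b with
    | zero =>
      rw [mul_zero, zero_add, h2 s hs]
      simpa using ih 0
    | succ b =>
      have h3 := ih (b + 1)
      rw [Nat.mul_succ, Nat.add_right_comm (d * b)] at h3 ⊢
      rw [h1, ih, h3, Nat.choose_succ_succ]
      push_cast
      ring

theorem eval_qChoose_of_not_dvd (hw : IsPrimitiveRoot w d) (hd : 0 < d) (M : ℕ) {k : ℕ}
    (hk : ¬d ∣ k) : (qChoose (d * M) k).eval w = 0 := by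
  have hs : k % d ≠ 0 := fun h => hk (Nat.dvd_of_mod_eq_zero h)
  have := eval_qChoose_mul_add hw M (k / d) hd (Nat.mod_lt k hd)
  rw [Nat.div_add_mod, add_zero, qChoose_eq_zero (Nat.pos_of_ne_zero hs)] at this
  simpa using this

end RootOfUnity

/-- The `q`-binomial coefficient with an integral lower index as a polynomial. -/
noncomputable def qBinomPoly (m : ℕ) (k : ℤ) : ℂ[X] := if 0 ≤ k then qChoose m k.toNat else 0

theorem qBinomPoly_of_neg (m : ℕ) {k : ℤ} (hk : k < 0) : qBinomPoly m k = 0 := if_neg hk.not_ge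

theorem qBinomPoly_natCast (m k : ℕ) : qBinomPoly m (k : ℤ) = qChoose m k := by simp [qBinomPoly]

theorem algebraMap_qBinomPoly (m : ℕ) (k : ℤ) :
    algebraMap ℂ[X] (RatFunc ℂ) (qBinomPoly m k) = qBinom m k := by
  rcases lt_or_ge k 0 with hk | hk
  · rw [qBinomPoly_of_neg m hk, qBinom_of_neg m hk, map_zero]
  · lift k to ℕ using hk
    rw [qBinomPoly_natCast, algebraMap_qChoose]

theorem eval_one_qBinomPoly (m : ℕ) (k : ℤ) : (qBinomPoly m k).eval 1 = binom m k := by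
  rcases lt_or_ge k 0 with hk | hk
  · rw [qBinomPoly_of_neg m hk, binom_of_neg m hk, eval_zero, Nat.cast_zero]
  · lift k to ℕ using hk
    rw [qBinomPoly_natCast, binom_natCast, eval_one_qChoose]

theorem eval_qBinomPoly_mul_add {d : ℕ} {w : ℂ} (hw : IsPrimitiveRoot w d) (a : ℕ) (b : ℤ)
    {r s : ℕ} (hr : r < d) (hs : s < d) : (qBinomPoly (d * a + r) (d * b + s)).eval w =
      binom a b * (qChoose r s).eval w := by
  rcases lt_or_ge b 0 with hb | hb
  · have : (d : ℤ) * b ≤ d * (-1) := mul_le_mul_of_nonneg_left (by omega) (by omega)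
    rw [qBinomPoly_of_neg _ (by omega), binom_of_neg _ hb]
    simp
  · lift b to ℕ using hb
    have h := qBinomPoly_natCast (d * a + r) (d * b + s)
    push_cast at h
    rw [h, binom_natCast, eval_qChoose_mul_add hw a b hr hs]

theorem eval_qBinomPoly_of_dvd {d : ℕ} {w : ℂ} (hw : IsPrimitiveRoot w d) (hd : 0 < d) (M : ℕ)
    (b : ℤ) : (qBinomPoly (d * M) (d * b)).eval w = binom M b := by
  simpa [qChoose_zero_right] using eval_qBinomPoly_mul_add hw M b hd hd

theorem eval_qBinomPoly_of_not_dvd {d : ℕ} {w : ℂ} (hw : IsPrimitiveRoot w d) (hd : 0 < d) (M : ℕ)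
    {k : ℤ} (hk : ¬(d : ℤ) ∣ k) : (qBinomPoly (d * M) k).eval w = 0 := by
  rcases lt_or_ge k 0 with hk0 | hk0
  · rw [qBinomPoly_of_neg _ hk0, eval_zero]
  · lift k to ℕ using hk0
    rw [qBinomPoly_natCast, eval_qChoose_of_not_dvd hw hd M
      fun h => hk (Int.natCast_dvd_natCast.mpr h)]

theorem eval_qIntPoly_mul_add {d : ℕ} {w : ℂ} (hw : IsPrimitiveRoot w d) (hd : 1 < d) (a r : ℕ) :
    (qIntPoly (d * a + r)).eval w = (qIntPoly r).eval w := by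
  rw [qIntPoly_add, eval_add, eval_mul, eval_pow, eval_X, pow_mul, hw.pow_eq_one, one_pow, one_mul,
    (eval_qIntPoly_eq_zero_iff hw hd _).mpr (Dvd.intro _ rfl), zero_add]

/-- For prime p, [p]_q is the p-th cyclotomic polynomial, a product of distinct linear factors over
ℂ. -/
theorem qIntPoly_dvd {p : ℕ} (hp : p.Prime) {P : ℂ[X]}
    (hP : ∀ w, IsPrimitiveRoot w p → P.eval w = 0) : qIntPoly p ∣ P := by
  have := Fact.mk hp
  rw [qIntPoly, ← cyclotomic_prime,
    cyclotomic_eq_prod_X_sub_primitiveRoots (Complex.isPrimitiveRoot_exp p hp.ne_zero)]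
  refine Finset.prod_dvd_of_coprime ?_ ?_
  · exact fun a _ b _ hab => pairwise_coprime_X_sub_C Function.injective_id hab
  · intro w hw
    exact dvd_iff_isRoot.mpr (hP w ((mem_primitiveRoots hp.pos).mp hw))

theorem complex_binom_mul_sub (N : ℕ) (i : ℤ) :
    (binom N i : ℂ) * (N - i) = binom N (i + 1) * (i + 1) := by
  exact_mod_cast congrArg (fun x : ℚ => (x : ℂ)) (binom_mul_sub N i)

theorem complex_succ_mul_binom (N : ℕ) (i : ℤ) :
    ((N : ℂ) + 1) * binom N i = binom (N + 1) (i + 1) * (i + 1) := by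
  exact_mod_cast congrArg (fun x : ℚ => (x : ℂ)) (succ_mul_binom N i)

/-- The number of matchings with `k` crossings invariant under the rotation by `M` points. -/
noncomputable def fixedCard (n k M : ℕ) : ℕ :=
  Nat.card {τ : Matching n // crossings τ = k ∧ rotate^[M] τ = τ}

theorem fixedCard_two_mul (n k : ℕ) :
    fixedCard n k (2 * n) = Nat.card {τ : Matching n // crossings τ = k} := by
  simp only [fixedCard, rotate_iterate_two_mul, and_true]

/-- The values of `f` at the roots of unity are the numbers of invariant matchings. -/
def Counts (n k : ℕ) (f : ℂ[X]) : Prop :=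
  ∀ (d M : ℕ) (w : ℂ), d * M = 2 * n → IsPrimitiveRoot w d → f.eval w = fixedCard n k M

/-- The order of a rotation is one, two or at least three. -/
theorem counts_of_cases {n k : ℕ} (hn : 0 < n) {f : ℂ[X]}
    (h1 : f.eval 1 = fixedCard n k (2 * n))
    (h2 : ∀ w, IsPrimitiveRoot w 2 → f.eval w = fixedCard n k n)
    (h3 : ∀ (d M : ℕ) (w : ℂ), 3 ≤ d → d * M = 2 * n → IsPrimitiveRoot w d →
      f.eval w = fixedCard n k M) : Counts n k f := by
  intro d M w hdM hw
  match d with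
  | 0 => omega
  | 1 =>
    obtain rfl : M = 2 * n := by omega
    rwa [IsPrimitiveRoot.one_right_iff.mp hw]
  | 2 =>
    obtain rfl : M = n := by omega
    exact h2 w hw
  | d + 3 => exact h3 _ M w (by omega) hdM hw

/-! ### The three sieving polynomials at roots of unity -/

theorem exists_counts_fOne {n : ℕ} (hn : 0 < n) :
    ∃ f : ℂ[X], algebraMap ℂ[X] (RatFunc ℂ) f = fOne n ∧ Counts n 1 f := by
  refine ⟨qBinomPoly (2 * n) (n - 2), algebraMap_qBinomPoly _ _, counts_of_cases hn ?_ ?_ ?_⟩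
  · have h := (card_crossings_few n).1
    rw [eval_one_qBinomPoly, fixedCard_two_mul]
    exact_mod_cast h.symm
  · intro w hw
    rcases n.even_or_odd' with ⟨q, rfl | rfl⟩
    · rw [fixedCard, (card_fixed_two_even q).1]
      have := eval_qBinomPoly_of_dvd hw two_pos (2 * q) (q - 1)
      rw [← this]
      congr 2
      push_cast
      ring
    · rw [fixedCard, (card_fixed_two_odd q).1, eval_qBinomPoly_of_not_dvd hw two_pos, Nat.cast_zero]
      push_cast
      omega
  · intro d M w hd hdM hw
    have hd0 : 0 < d := by omega
    by_cases h4 : d = 4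
    · subst h4
      obtain ⟨N, rfl⟩ : ∃ N, M = N + 1 := Nat.exists_eq_succ_of_ne_zero (by omega)
      rw [fixedCard, card_fixed_four N n (by omega), ← hdM]
      rcases N.even_or_odd' with ⟨q, rfl | rfl⟩
      · rw [mul_pmCount_even, ← binom_natCast, ← eval_qBinomPoly_of_dvd hw hd0]
        congr 2
        push_cast
        omega
      · rw [pmCount_odd, eval_qBinomPoly_of_not_dvd hw hd0, mul_zero, Nat.cast_zero]
        push_cast
        omega
    · rw [fixedCard, card_fixed_of_few hdM (by omega) one_pos (by norm_num) hd (by omega), ← hdM,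
        eval_qBinomPoly_of_not_dvd hw hd0, Nat.cast_zero]
      rintro ⟨b, hb⟩
      -- The polynomial vanishes unless d divides n - 2. As d divides 2n, it would then divide 2n -
      -- 2(n-2) = 4, which leaves only the excluded d = 4.
      have h5 : (d : ℤ) ∣ 4 := ⟨M - 2 * b, by
        have : (d : ℤ) * M = 2 * n := by exact_mod_cast hdM
        linear_combination -this - 2 * hb⟩
      have h6 : d ∣ 4 := by exact_mod_cast h5
      have h7 := Nat.le_of_dvd (by norm_num) h6
      interval_cases d <;> omega

theorem eval_qBinomPoly_two_even {w : ℂ} (hw : IsPrimitiveRoot w 2) (q : ℕ) (i : ℤ)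
    (hi : i = 2 * q - 3) : (qBinomPoly (2 * (2 * q)) i).eval w = 0 := by
  refine eval_qBinomPoly_of_not_dvd hw two_pos _ ?_
  push_cast
  omega

theorem exists_counts_fTwo {n : ℕ} (hn : 0 < n) :
    ∃ f : ℂ[X], algebraMap ℂ[X] (RatFunc ℂ) f = fTwo n ∧ Counts n 2 f := by
  -- At -1 the q-binomial vanishes for even n because n - 3 is odd, and [n+3] vanishes for odd n.
  have hdvd : qIntPoly 2 ∣ qIntPoly (n + 3) * qBinomPoly (2 * n) (n - 3) := by
    refine qIntPoly_dvd Nat.prime_two fun w hw => ?_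
    rw [eval_mul]
    rcases n.even_or_odd' with ⟨q, rfl | rfl⟩
    · rw [eval_qBinomPoly_two_even hw q _ (by push_cast; ring), mul_zero]
    · rw [(eval_qIntPoly_eq_zero_iff hw one_lt_two _).mpr (by omega), zero_mul]
  obtain ⟨f, hf⟩ := hdvd
  refine ⟨f, ?_, counts_of_cases hn ?_ ?_ ?_⟩
  · have h := congrArg (algebraMap ℂ[X] (RatFunc ℂ)) hf
    rw [map_mul, map_mul, algebraMap_qIntPoly, algebraMap_qIntPoly, algebraMap_qBinomPoly] at h
    have h2 := qInt_succ_ne_zero 1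
    rw [fTwo, div_mul_eq_mul_div, h, mul_div_cancel_left₀ _ h2]
  · have h := congrArg (eval 1) hf
    have hc := congrArg (fun x : ℚ => (x : ℂ)) (card_crossings_few n).2.1
    rw [eval_mul, eval_mul, eval_one_qIntPoly, eval_one_qIntPoly, eval_one_qBinomPoly] at h
    rw [fixedCard_two_mul]
    push_cast at h hc
    rw [hc]
    linear_combination -h / 2
  · intro w hw
    have h20 := qIntPoly_succ_ne_zero 1
    rcases n.even_or_odd' with ⟨q, rfl | rfl⟩
    · have hc := congrArg (fun x : ℚ => (x : ℂ)) (card_fixed_two_even q).2.1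
      push_cast at hc
      rw [fixedCard, hc]
      match q with
      | 0 => omega
      | 1 =>
        rw [qBinomPoly_of_neg _ (by norm_num), mul_zero, zero_eq_mul, or_iff_right h20] at hf
        rw [hf]
        norm_num [binom]
      | q + 2 =>
        -- At -1 the quotient has the form 0/0. Absorption replaces the q-binomial by [2n] times one
        -- with upper index 2n - 1, divided by [n-3], where [n-3] is 1 at -1; then [2] cancels from
        -- [2n].
        have h1 := qChoose_succ_succ_mul (2 * (2 * (q + 2)) - 1) (2 * q)
        rw [Nat.sub_add_cancel (by omega), qIntPoly_mul] at h1
        have h2 : ((2 * (q + 2) : ℕ) : ℤ) - 3 = (2 * q + 1 : ℕ) := by push_cast; ring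
        rw [h2, qBinomPoly_natCast] at hf
        have h3 : f * qIntPoly (2 * q + 1) = qIntPoly (2 * (q + 2) + 3) *
            (∑ i ∈ Finset.range (2 * (q + 2)), (X ^ 2) ^ i) *
              qChoose (2 * (2 * (q + 2)) - 1) (2 * q) := by
          refine mul_left_cancel₀ h20 ?_
          linear_combination -qIntPoly (2 * q + 1) * hf + qIntPoly (2 * (q + 2) + 3) * h1
        have h4 := congrArg (eval w) h3
        have h5 := eval_qChoose_mul_add hw (2 * q + 3) q one_lt_two zero_lt_two
        rw [show 2 * (2 * q + 3) + 1 = 2 * (2 * (q + 2)) - 1 by omega, add_zero] at h5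
        rw [show 2 * (q + 2) + 3 = 2 * (q + 3) + 1 by ring] at h4
        simp only [eval_mul, eval_sum_pow_pow hw, h5, eval_qIntPoly_mul_add hw one_lt_two,
          qIntPoly_one, eval_one, qChoose_zero_right, mul_one, one_mul] at h4
        rw [h4]
        have b1 := complex_binom_mul_sub (2 * (q + 2)) (q + 1)
        have b2 := complex_succ_mul_binom (2 * q + 3) q
        rw [← binom_natCast]
        push_cast at b1 b2 ⊢
        have e1 : (q : ℤ) + 1 + 1 = q + 2 := by ring
        have e2 : (q : ℤ) + 2 - 1 = q + 1 := by ring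
        rw [e1] at b1
        rw [e2]
        rw [show 2 * q + 3 + 1 = 2 * (q + 2) by ring] at b2
        linear_combination b2 + b1
    · have hc := congrArg (fun x : ℚ => (x : ℂ)) (card_fixed_two_odd q).2.1
      push_cast at hc
      rw [fixedCard, hc]
      rw [show 2 * q + 1 + 3 = 2 * (q + 2) by ring, qIntPoly_mul, mul_assoc] at hf
      rw [← mul_left_cancel₀ h20 hf, eval_mul, eval_sum_pow_pow hw,
        show ((2 * q + 1 : ℕ) : ℤ) - 3 = (2 : ℕ) * ((q : ℤ) - 1) by push_cast; ring,
        eval_qBinomPoly_of_dvd hw two_pos]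
      have b1 := complex_binom_mul_sub (2 * q + 1) (q - 1)
      rw [sub_add_cancel] at b1
      push_cast at b1 ⊢
      linear_combination b1
  · intro d M w hd hdM hw
    have hd0 : 0 < d := by omega
    rw [fixedCard, card_fixed_of_few hdM (by omega) two_pos (by norm_num) hd (by omega),
      Nat.cast_zero]
    have h := congrArg (eval w) hf
    rw [eval_mul, eval_mul] at h
    have h2 : (qIntPoly 2).eval w ≠ 0 := by
      rw [Ne, eval_qIntPoly_eq_zero_iff hw (by omega)]
      exact fun h => (Nat.le_of_dvd two_pos h).not_gt hd
    -- If d divides n - 3, then it also divides n + 3 = 2n - (n - 3), so one of the factors always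
    -- vanishes.
    have h0 : (qIntPoly (n + 3)).eval w * (qBinomPoly (2 * n) (n - 3)).eval w = 0 := by
      by_cases hb : (d : ℤ) ∣ n - 3
      · obtain ⟨b, hb⟩ := hb
        have : (d : ℤ) ∣ (n + 3 : ℕ) := ⟨M - b, by
          have : (d : ℤ) * M = 2 * n := by exact_mod_cast hdM
          push_cast
          linear_combination -this - hb⟩
        rw [(eval_qIntPoly_eq_zero_iff hw (by omega) _).mpr (by exact_mod_cast this), zero_mul]
      · rw [← hdM, eval_qBinomPoly_of_not_dvd hw hd0 M hb, mul_zero]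
    rw [h0, zero_eq_mul] at h
    exact h.resolve_left h2

theorem card_fixed_three_eq (q : ℕ) :
    Nat.card {τ : Matching (3 * q) // crossings τ = 3 ∧ rotate^[2 * q] τ = τ} =
      q * binom (2 * q) (q - 1) := by
  have hc := card_fixed_three q
  have b1 := binom_mul_sub (2 * q) (q - 1)
  rw [sub_add_cancel] at b1
  push_cast at b1
  have : (Nat.card {τ : Matching (3 * q) // crossings τ = 3 ∧ rotate^[2 * q] τ = τ} : ℚ) =
      (q * binom (2 * q) (q - 1) : ℕ) := by
    rw [hc]
    push_cast
    linear_combination -b1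
  exact_mod_cast this

/-- The product [m+2][m+1] vanishes, while the denominator [2] does not, as d > 2. -/
theorem eval_qChoose_two_eq_zero {d : ℕ} {w : ℂ} (hw : IsPrimitiveRoot w d) (hd : 3 ≤ d) {m : ℕ}
    (hm : d ∣ m + 1 ∨ d ∣ m + 2) : (qChoose (m + 2) 2).eval w = 0 := by
  have h1 := qChoose_succ_succ_mul (m + 1) 1
  have h2 := qChoose_succ_succ_mul m 0
  rw [zero_add, qIntPoly_one, mul_one, qChoose_zero_right, mul_one] at h2
  rw [h2] at h1
  replace h1 := congrArg (eval w) h1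
  have h0 : (qIntPoly (m + 1 + 1)).eval w * (qIntPoly (m + 1)).eval w = 0 := by
    rw [mul_eq_zero, eval_qIntPoly_eq_zero_iff hw (by omega),
      eval_qIntPoly_eq_zero_iff hw (by omega)]
    exact hm.symm
  rw [eval_mul, eval_mul, h0, mul_eq_zero, eval_qIntPoly_eq_zero_iff hw (by omega)] at h1
  exact h1.resolve_right fun h => (Nat.le_of_dvd two_pos h).not_gt hd

/-- For n divisible by 3 the index n - 4 is not; in the other residue classes 3 divides n + 5 or n +
4. -/
theorem eval_fThree_numerator {w : ℂ} (n : ℕ) (hw : IsPrimitiveRoot w 3) :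
    (qChoose (n + 5) 2 * qBinomPoly (2 * n) (n - 4)).eval w = 0 := by
  rw [eval_mul]
  obtain ⟨q, r, hr, rfl⟩ : ∃ q r, r < 3 ∧ n = 3 * q + r :=
    ⟨n / 3, n % 3, Nat.mod_lt _ three_pos, (Nat.div_add_mod n 3).symm⟩
  interval_cases r
  · rw [show 2 * (3 * q + 0) = 3 * (2 * q) by ring,
      eval_qBinomPoly_of_not_dvd hw three_pos, mul_zero]
    push_cast
    omega
  · rw [eval_qChoose_two_eq_zero hw le_rfl (m := 3 * q + 4) (Or.inr (by omega)), zero_mul]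
  · rw [eval_qChoose_two_eq_zero hw le_rfl (m := 3 * q + 5) (Or.inl (by omega)), zero_mul]

/-- The case 0/0 at a cube root of unity. After absorption, [2n] = [2 · 3q] supplies the factor [3]
to be cancelled and leaves 2q. The factors [2] coming from q-Lucas and from [n-4] cancel as well.
For q = 1 the lower index is negative and everything is zero. -/
theorem eval_of_qIntPoly_three_mul {w : ℂ} (hw : IsPrimitiveRoot w 3) {q : ℕ} (hq : 0 < q)
    {g : ℂ[X]}
    (hg : qChoose (3 * q + 5) 2 * qBinomPoly (2 * (3 * q)) ((3 * q : ℕ) - 4) = qIntPoly 3 * g) :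
    g.eval w = 2 * q * binom (2 * q - 1) (q - 2) := by
  have h30 := qIntPoly_succ_ne_zero 2
  obtain rfl | ⟨p, rfl⟩ : q = 1 ∨ ∃ p, q = p + 2 := by
    rcases Nat.lt_or_ge q 2 with h | h
    · exact Or.inl (by omega)
    · exact Or.inr ⟨q - 2, by omega⟩
  · rw [qBinomPoly_of_neg _ (by norm_num), mul_zero, zero_eq_mul, or_iff_right h30] at hg
    rw [hg, binom_of_neg _ (by norm_num)]
    simp
  · have h1 := qChoose_succ_succ_mul (3 * (2 * (p + 2)) - 1) (3 * p + 1)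
    rw [Nat.sub_add_cancel (by omega), qIntPoly_mul] at h1
    have h2 : ((3 * (p + 2) : ℕ) : ℤ) - 4 = (3 * p + 1 + 1 : ℕ) := by push_cast; ring
    rw [h2, qBinomPoly_natCast, show 2 * (3 * (p + 2)) = 3 * (2 * (p + 2)) by ring] at hg
    have h3 : g * qIntPoly (3 * p + 1 + 1) = qChoose (3 * (p + 2) + 5) 2 *
        (∑ i ∈ Finset.range (2 * (p + 2)), (X ^ 3) ^ i) *
          qChoose (3 * (2 * (p + 2)) - 1) (3 * p + 1) := by
      refine mul_left_cancel₀ h30 ?_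
      linear_combination -qIntPoly (3 * p + 1 + 1) * hg + qChoose (3 * (p + 2) + 5) 2 * h1
    have h4 := congrArg (eval w) h3
    have h5 := eval_qChoose_mul_add hw (2 * p + 3) p (r := 2) (s := 1) (by norm_num) (by norm_num)
    rw [show 3 * (2 * p + 3) + 2 = 3 * (2 * (p + 2)) - 1 by omega] at h5
    have h6 := eval_qChoose_mul_add hw (p + 3) 0 (r := 2) (s := 2) (by norm_num) (by norm_num)
    rw [show 3 * (p + 3) + 2 = 3 * (p + 2) + 5 by ring, mul_zero, zero_add, qChoose_self,
      Nat.choose_zero_right, eval_one] at h6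
    have h7 : (qIntPoly 2).eval w ≠ 0 := by
      rw [Ne, eval_qIntPoly_eq_zero_iff hw (by norm_num)]
      norm_num
    have h8 : qChoose 2 1 = qIntPoly 2 := by
      simpa [qIntPoly_one, qChoose_zero_right] using qChoose_succ_succ_mul 1 0
    rw [add_assoc (3 * p) 1 1, eval_mul, eval_mul, eval_mul, eval_sum_pow_pow hw, h5, h6, h8,
      eval_qIntPoly_mul_add hw (by norm_num)] at h4
    refine mul_right_cancel₀ h7 ?_
    rw [show 2 * (p + 2) - 1 = 2 * p + 3 by omega,
      show ((p + 2 : ℕ) : ℤ) - 2 = p by push_cast; ring, binom_natCast]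
    push_cast at h4 ⊢
    linear_combination h4

theorem exists_counts_fThree {n : ℕ} (hn : 0 < n) :
    ∃ f : ℂ[X], algebraMap ℂ[X] (RatFunc ℂ) f = fThree n ∧ Counts n 3 f := by
  obtain ⟨g, hg⟩ := qIntPoly_dvd Nat.prime_three fun w hw => eval_fThree_numerator n hw
  refine ⟨g + qBinomPoly (2 * n) (n - 3), ?_, counts_of_cases hn ?_ ?_ ?_⟩
  · have h := congrArg (algebraMap ℂ[X] (RatFunc ℂ)) hg
    rw [map_mul, map_mul, algebraMap_qChoose, algebraMap_qIntPoly, algebraMap_qBinomPoly] at h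
    have h2 := qInt_succ_ne_zero 2
    rw [map_add, fThree, algebraMap_qBinomPoly, mul_assoc]
    push_cast at h
    rw [h, one_div, inv_mul_cancel_left₀ h2]
  · have h := congrArg (eval 1) hg
    have hc := congrArg (fun x : ℚ => (x : ℂ)) (card_crossings_few n).2.2
    rw [eval_mul, eval_mul, eval_one_qIntPoly, eval_one_qChoose, eval_one_qBinomPoly,
      Nat.cast_choose_two] at h
    rw [fixedCard_two_mul, eval_add, eval_one_qBinomPoly]
    push_cast at h hc
    rw [hc]
    linear_combination -h / 3
  · intro w hw
    have h := congrArg (eval w) hg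
    -- At -1 the denominator is 1 - 1 + 1 = 1, so no cancellation is needed.
    have h3 : (qIntPoly 3).eval w = 1 := by
      have := eval_qIntPoly_mul_add hw one_lt_two 1 1
      rwa [qIntPoly_one, eval_one] at this
    rw [eval_mul, eval_mul, h3, one_mul] at h
    rw [eval_add, ← h]
    rcases n.even_or_odd' with ⟨q, rfl | rfl⟩
    · have hc := congrArg (fun x : ℚ => (x : ℂ)) ((card_fixed_two_even q).2.2 (by omega))
      push_cast at hc
      have h5 := eval_qChoose_mul_add hw (q + 2) 1 one_lt_two zero_lt_two
      rw [show 2 * (q + 2) + 1 = 2 * q + 5 by ring] at h5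
      have b1 := complex_binom_mul_sub (2 * q) (q - 2)
      rw [fixedCard, hc, eval_qBinomPoly_two_even hw q (((2 * q : ℕ) : ℤ) - 3) (by push_cast; ring),
        show (qChoose (2 * q + 5) 2).eval w = _ from h5,
        show ((2 * q : ℕ) : ℤ) - 4 = (2 : ℕ) * ((q : ℤ) - 2) by push_cast; ring,
        eval_qBinomPoly_of_dvd hw two_pos, qChoose_zero_right, eval_one, Nat.choose_one_right]
      rw [show (q : ℤ) - 2 + 1 = q - 1 by ring] at b1
      push_cast at b1 ⊢
      linear_combination b1
    · rw [fixedCard, (card_fixed_two_odd q).2.2,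
        show ((2 * q + 1 : ℕ) : ℤ) - 3 = (2 : ℕ) * ((q : ℤ) - 1) by push_cast; ring,
        eval_qBinomPoly_of_dvd hw two_pos, eval_qBinomPoly_of_not_dvd hw two_pos, mul_zero,
        zero_add]
      push_cast
      omega
  · intro d M w hd hdM hw
    have hd0 : 0 < d := by omega
    have hdM' : (d : ℤ) * M = 2 * n := by exact_mod_cast hdM
    have h := congrArg (eval w) hg
    rw [eval_mul, eval_mul] at h
    rw [eval_add]
    by_cases hd3 : d = 3
    · subst hd3
      obtain ⟨q, rfl⟩ : ∃ q, n = 3 * q := ⟨n / 3, by omega⟩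
      obtain rfl : M = 2 * q := by omega
      rw [fixedCard, card_fixed_three_eq, ← hdM,
        show ((3 * q : ℕ) : ℤ) - 3 = (3 : ℕ) * ((q : ℤ) - 1) by push_cast; ring,
        eval_qBinomPoly_of_dvd hw three_pos]
      rw [eval_of_qIntPoly_three_mul hw (by omega) hg]
      have b1 := complex_succ_mul_binom (2 * q - 1) (q - 2)
      rw [Nat.sub_add_cancel (by omega), Nat.cast_sub (by omega)] at b1
      rw [show (q : ℤ) - 2 + 1 = q - 1 by ring] at b1
      push_cast at b1 ⊢
      linear_combination b1
    · have h3 : (qIntPoly 3).eval w ≠ 0 := by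
        rw [Ne, eval_qIntPoly_eq_zero_iff hw (by omega)]
        exact fun h => hd3 (le_antisymm (Nat.le_of_dvd three_pos h) hd)
      -- If d divides n - 4, then it divides n + 4 = 2n - (n - 4), which is one of the factors of
      -- the first q-binomial. Only the second summand of the polynomial survives for d > 3.
      have h0 : (qChoose (n + 5) 2).eval w * (qBinomPoly (2 * n) (n - 4)).eval w = 0 := by
        by_cases hb : (d : ℤ) ∣ n - 4
        · obtain ⟨b, hb⟩ := hb
          have : (d : ℤ) ∣ (n + 3 + 1 : ℕ) := ⟨M - b, by
            push_cast
            linear_combination -hdM' - hb⟩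
          rw [eval_qChoose_two_eq_zero hw hd (Or.inl (by exact_mod_cast this)), zero_mul]
        · rw [← hdM, eval_qBinomPoly_of_not_dvd hw hd0 M hb, mul_zero]
      rw [h0, zero_eq_mul, or_iff_right h3] at h
      rw [h, zero_add, ← hdM]
      by_cases h6 : d = 6
      · subst h6
        obtain ⟨N, rfl⟩ : ∃ N, M = N + 1 := Nat.exists_eq_succ_of_ne_zero (by omega)
        rw [fixedCard, card_fixed_six N n (by omega)]
        rcases N.even_or_odd' with ⟨q, rfl | rfl⟩
        · rw [mul_pmCount_even, ← binom_natCast, ← eval_qBinomPoly_of_dvd hw hd0]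
          congr 2
          push_cast
          omega
        · rw [pmCount_odd, eval_qBinomPoly_of_not_dvd hw hd0, mul_zero, Nat.cast_zero]
          push_cast
          omega
      · rw [fixedCard, card_fixed_of_few hdM (by omega) three_pos le_rfl hd (by omega),
          eval_qBinomPoly_of_not_dvd hw hd0, Nat.cast_zero]
        rintro ⟨b, hb⟩
        -- From 2n - 2(n-3) = 6; the divisors 3 and 6 have been treated separately.
        have h5 : (d : ℤ) ∣ 6 := ⟨M - 2 * b, by linear_combination -hdM' - 2 * hb⟩
        have h6 : d ∣ 6 := by exact_mod_cast h5
        have h7 := Nat.le_of_dvd (by norm_num) h6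
        interval_cases d <;> omega

/-! ### Cyclic sieving -/

/-- The rotations by j and by gcd(j, 2n) points generate the same subgroup, hence fix the same
matchings. -/
theorem fixedCard_gcd (n k j : ℕ) : fixedCard n k (Nat.gcd j (2 * n)) = fixedCard n k j := by
  refine Nat.card_congr (Equiv.subtypeEquivRight fun τ => and_congr_right fun _ => ⟨fun h => ?_,
    fun h => ?_⟩)
  · obtain ⟨m, hm⟩ := Nat.gcd_dvd_left j (2 * n)
    have := rotate_iterate_mul_eq_self h m
    rwa [← hm] at this
  · exact Function.IsPeriodicPt.gcd h (rotate_iterate_two_mul τ)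

theorem isPrimitiveRoot_exp_pi {n : ℕ} (hn : 0 < n) :
    IsPrimitiveRoot (Complex.exp (Real.pi * Complex.I / n)) (2 * n) := by
  have h := Complex.isPrimitiveRoot_exp (2 * n) (by omega)
  have hn' : (n : ℂ) ≠ 0 := Nat.cast_ne_zero.mpr hn.ne'
  rwa [show 2 * (Real.pi : ℂ) * Complex.I / (2 * n : ℕ) = Real.pi * Complex.I / n by
    push_cast; field_simp] at h

theorem Counts.eval_pow {n k : ℕ} (hn : 0 < n) {f : ℂ[X]} (hf : Counts n k f) (j : ℕ) :
    f.eval (Complex.exp (Real.pi * Complex.I / n) ^ j) = fixedCard n k j := by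
  have hξ := isPrimitiveRoot_exp_pi hn
  have hg : 0 < Nat.gcd j (2 * n) := Nat.gcd_pos_of_pos_right _ (by omega)
  rw [← fixedCard_gcd]
  refine hf (2 * n / Nat.gcd j (2 * n)) _ _ (Nat.div_mul_cancel (Nat.gcd_dvd_right _ _)) ?_
  have h1 := IsPrimitiveRoot.pow (by omega) hξ
    (Nat.mul_div_cancel' (Nat.gcd_dvd_right j (2 * n))).symm
  have h2 := h1.pow_of_coprime (j / Nat.gcd j (2 * n)) (Nat.coprime_div_gcd_div_gcd hg)
  rwa [← pow_mul, Nat.mul_div_cancel' (Nat.gcd_dvd_left _ _)] at h2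

/-- Both groups are cyclic, and both generators have order 2n: the rotation is a single cycle
through all 2n points. -/
theorem exists_mulEquiv_rootsOfUnity {n : ℕ} (hn : 0 < n) :
    ∃ ω : RotationGroup n ≃* rootsOfUnity (2 * n) ℂ,
      ((ω (generator n) : ℂˣ) : ℂ) = Complex.exp (Real.pi * Complex.I / n) := by
  have : NeZero (2 * n) := ⟨by omega⟩
  obtain ⟨ζ, hζ⟩ := (isPrimitiveRoot_exp_pi hn).isUnit (by omega)
  have hprim := isPrimitiveRoot_exp_pi hn
  rw [← hζ, IsPrimitiveRoot.coe_units_iff] at hprim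
  have hmem : ζ ∈ rootsOfUnity (2 * n) ℂ := hprim.pow_eq_one
  have hg : ∀ x : RotationGroup n, x ∈ Subgroup.zpowers (generator n) := by
    rintro ⟨x, m, rfl⟩
    exact ⟨m, rfl⟩
  have hg' : ∀ x : rootsOfUnity (2 * n) ℂ,
      x ∈ Subgroup.zpowers (⟨ζ, hmem⟩ : rootsOfUnity (2 * n) ℂ) := by
    rintro ⟨x, hx⟩
    rw [← hprim.zpowers_eq] at hx
    obtain ⟨m, rfl⟩ := hx
    exact ⟨m, rfl⟩
  have hord : orderOf (generator n) = orderOf (⟨ζ, hmem⟩ : rootsOfUnity (2 * n) ℂ) := by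
    rw [← Subgroup.orderOf_coe, ← Subgroup.orderOf_coe]
    change orderOf (finRotate (2 * n)) = orderOf ζ
    rw [← hprim.eq_orderOf, (isCycle_finRotate_of_le (by omega)).orderOf,
      support_finRotate_of_le (by omega), Finset.card_univ, Fintype.card_fin]
  refine ⟨mulEquivOfOrderOfEq hg hg' hord, ?_⟩
  rw [mulEquivOfOrderOfEq_apply_gen, hζ]

theorem Counts.sievesMatchings {n k : ℕ} (hn : 0 < n)
    {ω : RotationGroup n ≃* rootsOfUnity (2 * n) ℂ}
    (hω : ((ω (generator n) : ℂˣ) : ℂ) = Complex.exp (Real.pi * Complex.I / n)) {f : ℂ[X]}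
    {F : RatFunc ℂ} (hF : algebraMap ℂ[X] (RatFunc ℂ) f = F) (hf : Counts n k f) :
    SievesMatchings n k ω F := by
  refine ⟨f, hF, hf.eval_pow hn, fun c => ?_⟩
  obtain ⟨c, hc⟩ := c
  -- The group is finite, so every element is a natural power of the rotation, and the evaluation at
  -- powers of ξ applies.
  obtain ⟨m, rfl⟩ := mem_powers_iff_mem_zpowers.mpr hc
  have hgen : (⟨finRotate (2 * n) ^ m, hc⟩ : RotationGroup n) = generator n ^ m := rfl
  have hpow : ((ω (generator n ^ m) : ℂˣ) : ℂ) =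
      Complex.exp (Real.pi * Complex.I / n) ^ m := by
    rw [map_pow, SubmonoidClass.coe_pow, Units.val_pow_eq_pow_val, hω]
  change f.eval ((ω (⟨finRotate (2 * n) ^ m, hc⟩ : RotationGroup n) : ℂˣ) : ℂ) = _
  rw [hgen, hpow, hf.eval_pow hn]
  refine congrArg Nat.cast (Nat.card_congr ?_)
  refine ⟨fun τ => ⟨⟨τ.1, τ.2.1⟩, Subtype.ext ?_⟩, fun x => ⟨x.1.1, x.1.2, ?_⟩, fun _ => rfl,
    fun _ => rfl⟩
  · exact (rotate_iterate m τ.1).symm.trans τ.2.2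
  · exact (rotate_iterate m x.1.1).trans (congrArg Subtype.val x.2)

end CircleMatching

open CircleMatching
theorem mainTheorem1 (n : ℕ) (hn : 0 < n) :
    -- for the isomorphism `ω` from `C_{2n}` to the roots of unity with `ω σ = exp (π i / n)`
    (∃ ω : RotationGroup n ≃* rootsOfUnity (2 * n) ℂ,
      ((ω (generator n) : ℂˣ) : ℂ) = Complex.exp (Real.pi * Complex.I / n) ∧
      SievesMatchings n 1 ω (fOne n) ∧
      SievesMatchings n 2 ω (fTwo n) ∧
      SievesMatchings n 3 ω (fThree n)) ∧
    -- the number of matchings with three crossings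
    ((Nat.card {τ : Matching n // crossings τ = 3} : ℚ) =
      1 / 3 * (n + 5).choose 2 * binom (2 * n) (n - 4) + binom (2 * n) (n - 3)) ∧
    -- those of them fixed by the rotation through a third of the circle
    (3 ∣ n → Nat.card {τ : Matching n // crossings τ = 3 ∧ rotate^[2 * n / 3] τ = τ} =
      n / 3 * (2 * n / 3).choose (n / 3 - 1)) := by
  refine ⟨?_, ?_, ?_⟩
  · obtain ⟨ω, hω⟩ := exists_mulEquiv_rootsOfUnity hn
    obtain ⟨f₁, hF₁, hf₁⟩ := exists_counts_fOne hn
    obtain ⟨f₂, hF₂, hf₂⟩ := exists_counts_fTwo hn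
    obtain ⟨f₃, hF₃, hf₃⟩ := exists_counts_fThree hn
    exact ⟨ω, hω, hf₁.sievesMatchings hn hω hF₁, hf₂.sievesMatchings hn hω hF₂,
      hf₃.sievesMatchings hn hω hF₃⟩
  · rw [(card_crossings_few n).2.2, Nat.cast_choose_two]
    push_cast
    ring
  · rintro ⟨q, rfl⟩
    -- Here n > 0 gives q ≥ 1, so the truncated subtraction is the true one.
    have hq : ((q : ℤ) - 1) = (q - 1 : ℕ) := by omega
    rw [show 2 * (3 * q) / 3 = 2 * q by omega, Nat.mul_div_cancel_left q three_pos,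
      card_fixed_three_eq, hq, binom_natCast]
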